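/- Let $d\ge 2$ and $g\ge 0$ be integers, let $T$ be the infinite $d$-regular tree (the Cayley tree of degree $d$), and let $\Gamma=\Gamma_{d,g}$ be the decorated Cayley tree obtained from $T$ by adding $g$ sites on each edge, i.e. by replacing each edge by a path with $g$ interior vertices. Fix any vertex $o$ of $\Gamma$ as root, and let $B_n$ be the set of the vertices at graph distance at most $n$ from $o$. **The AKLT model.** Each vertex $x$ of $\Gamma$ carries a quantum spin $\deg(x)/2$, where $\deg$ is the degree in $\Gamma$. For an edge $xy$ let $P_{xy}$ be the orthogonal projection onto the states in which the spins at $x$ and $y$ have the maximal total spin $(\deg x+\deg y)/2$, and let $H_n=\sum P_{xy}$ over the edges $xy$ with both ends in $B_n$. A finite-volume ground state on $B_n$ (with an arbitrary boundary condition) is a state given by a density matrix $\rho_n$ with $H_n\rho_n=0$. An infinite-volume ground state $\omega$ is a weak limit $\omega(A)=\lim_n \operatorname{Tr}(\rho_nA)$ (for all local observables $A$) of a sequence of finite-volume ground states. The ground state is *unique* if there is exactly one infinite-volume ground state. The model is *ordered* if it has an infinite-volume ground state with antiferromagnetic (Néel) order, i.e. some infinite-volume ground state $\omega$ and $m>0$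 satisfy $(-1)^{|x-o|}\,\omega(S^3_x)\ge m$ for all vertices $x$. It is *disordered* if $\omega(S^\alpha_x)=0$ for every infinite-volume ground state $\omega$, every vertex $x$ and $\alpha=1,2,3$. **The transfer functions.** For $n\ge 1$ and $0\le k\le n+1$ let $w_k\in(\mathbb C^2)^{\otimes n}$ be the sum of all basis vectors with exactly $k$ ups ($w_{-1}=w_{n+1}=0$), and put $$W_k=\binom{n+1}{k}^{-1/2}\bigl(|{\uparrow}\rangle\langle{\downarrow}|-|{\downarrow}\rangle\langle{\uparrow}|\bigr)\bigl(|{\uparrow}\rangle\langle w_{k-1}|+|{\downarrow}\rangle\langle w_k|\bigr).$$ The transfer operator of a site of degree $n+1$ is $$\tilde{\mathbb F}_{n+1}:M_2(\mathbb C)^{\otimes n}\to M_2(\mathbb C),\qquad \tilde{\mathbb F}_{n+1}(M)=\frac{2}{n+2}\sum_{k=0}^{n+1}W_kMW_k^* .$$ The transfer operator of the cell of $\Gamma_{d,g}$ (a site of degree $d$ followed by $g$ sites of degree $2$) is $\tilde{\mathbb F}_{d,g}=\tilde{\mathbb F}_2^{\circ g}\circ\tilde{\mathbb F}_d$. For $\mathbf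 x\in\mathbb R^3$ with $\|\mathbf x\|\le 1$ let $R_{d,g}(\mathbf x)$ be the multiple with trace $2$ of $\tilde{\mathbb F}_{d,g}\bigl((\mathbb 1+\mathbf x\cdot\boldsymbol\sigma)^{\otimes(d-1)}\bigr)$, where $\boldsymbol\sigma$ is the vector of the Pauli matrices, and define $F_{d,g}(\mathbf x)=-\|R_{d,g}(\mathbf x)-\mathbb 1\|$ (operator norm). Let $F_d(0)=0$ and, for $0<t\le 1$, $$F_d(t)=-\frac{(d+1)\,t\,\bigl((1+t)^d+(1-t)^d\bigr)-\bigl((1+t)^{d+1}-(1-t)^{d+1}\bigr)}{(d+1)\,t\,\bigl((1+t)^d-(1-t)^d\bigr)},$$ which is $-\frac1{d+1}\bigl(d\coth(d\tanh^{-1}t)-\frac1t\bigr)$ for $0<t<1$. **Claim.** 1. $F_{d,g}(\mathbf x)=3^{-g}F_d(\|\mathbf x\|)$ for all $\mathbf x\in\mathbb R^3$ with $\|\mathbf x\|\le1$; in particular $F_{d,g}$ depends only on $t=\|\mathbf x\|$. 2. If $d>3^{g+1}+1$, the AKLT model on $\Gamma_{d,g}$ is ordered and its ground state is not unique. 3.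 If $d<3^{g+1}+1$, the AKLT model on $\Gamma_{d,g}$ is disordered and its ground state is unique. -/

import Mathlib

open scoped Matrix

/-! ### Decorated trees -/

/-- For an edge `e` of `T` with (arbitrarily oriented) endpoints `a = e.out.1` and `b = e.out.2`,
the `g + 2` consecutive points `0, 1, …, g + 1` of the path which replaces `e` when `g` sites are
added on `e`: point `0` is `a`, points `1, …, g` are the new sites, point `g + 1` is `b`. -/
noncomputable def decorationPoint {V : Type*} (T : SimpleGraph V) (g : ℕ) (e : T.edgeSet) (i : ℕ) :
    V ⊕ T.edgeSet × Fin g :=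
  if i = 0 then Sum.inl (Quot.out (e : Sym2 V)).1
  else if h : i - 1 < g then Sum.inr (e, ⟨i - 1, h⟩)
  else Sum.inl (Quot.out (e : Sym2 V)).2

/-- The graph obtained from `T` by adding `g` sites on each edge: every edge is replaced by a path
with `g` new interior vertices, i.e. with `g + 1` edges. -/
noncomputable def decorate {V : Type*} (T : SimpleGraph V) (g : ℕ) :
    SimpleGraph (V ⊕ T.edgeSet × Fin g) :=
  SimpleGraph.fromRel fun x y =>
    ∃ e : T.edgeSet, ∃ i ≤ g, x = decorationPoint T g e i ∧ y = decorationPoint T g e (i + 1)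

theorem decorationPoint_edges_finite {V : Type*} (T : SimpleGraph V) [T.LocallyFinite] (g : ℕ)
    (x : V ⊕ T.edgeSet × Fin g) :
    {e : T.edgeSet | ∃ i, x = decorationPoint T g e i}.Finite := by
  classical
  rcases x with v | ⟨e₀, j⟩
  · have hfin : (T.incidenceSet v).Finite := Set.toFinite _
    refine Set.Finite.subset (hfin.preimage (f := fun e : T.edgeSet => (e : Sym2 V))
      Subtype.val_injective.injOn) ?_
    rintro e ⟨i, hi⟩
    refine ⟨e.2, ?_⟩
    unfold decorationPoint at hi
    split_ifs at hi
    · rw [Sum.inl.inj hi]; exact Sym2.out_fst_mem _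
    · rw [Sum.inl.inj hi]; exact Sym2.out_snd_mem _
  · refine Set.Finite.subset (Set.finite_singleton e₀) ?_
    rintro e ⟨i, hi⟩
    unfold decorationPoint at hi
    split_ifs at hi
    exact (congrArg Prod.fst (Sum.inr.inj hi)).symm

noncomputable instance decorateLocallyFinite {V : Type*} (T : SimpleGraph V) [T.LocallyFinite]
    (g : ℕ) : (decorate T g).LocallyFinite := fun x =>
  Set.Finite.fintype <| by
    refine Set.Finite.subset (((decorationPoint_edges_finite T g x).prod
      (Set.finite_Iic (g + 1))).image
        fun p : T.edgeSet × ℕ => decorationPoint T g p.1 p.2) ?_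
    intro y hy
    rw [SimpleGraph.mem_neighborSet, decorate, SimpleGraph.fromRel_adj] at hy
    rcases hy.2 with ⟨e, i, hi, hx, hy⟩ | ⟨e, i, hi, hy, hx⟩
    · exact ⟨(e, i + 1), ⟨⟨i, hx⟩, by simpa using hi⟩, hy.symm⟩
    · exact ⟨(e, i), ⟨⟨i + 1, hx⟩, Set.mem_Iic.mpr (by omega)⟩, hy.symm⟩

/-! ### Spin operators -/

/-- The spin raising operator of spin `n / 2`, in the orthonormal basis `0, …, n` of eigenvectors of
`S³`, where basis vector `k` has `S³`-eigenvalue `k - n / 2`. -/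
noncomputable def spinRaise (n : ℕ) : Matrix (Fin (n + 1)) (Fin (n + 1)) ℂ :=
  Matrix.of fun i j =>
    if (i : ℕ) = j + 1 then ((Real.sqrt (((j : ℝ) + 1) * ((n : ℝ) - j)) : ℝ) : ℂ) else 0

/-- The spin operators `S¹, S², S³` of spin `n / 2`. -/
noncomputable def spinMatrix (n : ℕ) : Fin 3 → Matrix (Fin (n + 1)) (Fin (n + 1)) ℂ :=
  ![(1 / 2 : ℂ) • (spinRaise n + (spinRaise n)ᴴ),
    (-Complex.I / 2) • (spinRaise n - (spinRaise n)ᴴ),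
    Matrix.diagonal fun k => (k : ℂ) - (n : ℂ) / 2]

/-! ### The AKLT model on a locally finite graph -/

section AKLT

open scoped Classical ComplexOrder

variable {W : Type*} (G : SimpleGraph W) [G.LocallyFinite]

/-- Labels of the product basis of the Hilbert space `⨂ x ∈ Λ, ℂ ^ (deg x + 1)`: the site `x` carries
a spin `deg x / 2`, where `deg x` is the degree in the whole graph. -/
abbrev Config (Λ : Finset W) : Type _ := (x : Λ) → Fin (G.degree x + 1)

/-- Operators on the Hilbert space of the finite region `Λ`. -/
abbrev LocalOp (Λ : Finset W) : Type _ := Matrix (Config G Λ) (Config G Λ) ℂ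

/-- The operator on the Hilbert space of `Λ` which acts as `A` on the site `x` and as the identity on
the other sites. -/
noncomputable def siteOp {Λ : Finset W} (x : Λ)
    (A : Matrix (Fin (G.degree x + 1)) (Fin (G.degree x + 1)) ℂ) : LocalOp G Λ :=
  Matrix.of fun σ τ => if ∀ y, y ≠ x → σ y = τ y then A (σ x) (τ x) else 0

/-- The embedding `A ↦ A ⊗ 1` of the operators on `Λ` into the operators on a larger region. -/
noncomputable def extendOp {Λ Λ' : Finset W} (h : Λ ⊆ Λ') (A : LocalOp G Λ) : LocalOp G Λ' :=
  Matrix.of fun σ τ =>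
    if ∀ y : Λ', (y : W) ∉ Λ → σ y = τ y then
      A (fun x => σ ⟨x, h x.2⟩) (fun x => τ ⟨x, h x.2⟩) else 0

/-- The square of the total spin of the two sites `x` and `y`. -/
noncomputable def totalSpinSq {Λ : Finset W} (x y : Λ) : LocalOp G Λ :=
  ∑ α : Fin 3, (siteOp G x (spinMatrix (G.degree x) α) + siteOp G y (spinMatrix (G.degree y) α)) ^ 2

/-- The maximal total spin `J = (deg x + deg y) / 2` of the two sites `x` and `y`. -/
noncomputable def maxSpin (x y : W) : ℂ := ((G.degree x : ℂ) + (G.degree y : ℂ)) / 2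

/-- The orthogonal projection onto the states in which the spins `deg x / 2` and `deg y / 2` at `x`
and `y` add up to the maximal total spin `J = (deg x + deg y) / 2`, that is, onto the eigenspace of
the square of the total spin for the eigenvalue `J (J + 1)`. -/
noncomputable def bondProjection {Λ : Finset W} (x y : Λ) : LocalOp G Λ :=
  (Matrix.toEuclideanCLM (n := Config G Λ) (𝕜 := ℂ)).symm
    (Module.End.eigenspace (Matrix.toEuclideanLin (totalSpinSq G x y))
      (maxSpin G x y * (maxSpin G x y + 1))).starProjection

/-- The AKLT Hamiltonian of the region `Λ`: the sum of the projections `bondProjection` over all edges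
inside `Λ` (each edge occurs twice in the double sum, hence the factor `1 / 2`). -/
noncomputable def akltHamiltonian (Λ : Finset W) : LocalOp G Λ :=
  (1 / 2 : ℂ) • ∑ x : Λ, ∑ y : Λ, if G.Adj x y then bondProjection G x y else 0

/-- The set of the vertices within graph distance `n` from `o`. -/
noncomputable def graphBall (o : W) : ℕ → Finset W
  | 0 => {o}
  | n + 1 =>
    graphBall o n ∪ (graphBall o n).biUnion fun x => G.neighborFinset x

/-- `ρ` is the density matrix of a ground state on `Λ`, with an arbitrary boundary condition: a
state that is supported on the kernel of the Hamiltonian. -/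
def IsFiniteVolumeGroundState {Λ : Finset W} (ρ : LocalOp G Λ) : Prop :=
  ρ.PosSemidef ∧ ρ.trace = 1 ∧ akltHamiltonian G Λ * ρ = 0

/-- The expectation of the observable `A` in the state `ρ` (with the default value `0` if the region
of `A` is not contained in that of `ρ`). -/
noncomputable def expectation {Λ' : Finset W} (ρ : LocalOp G Λ') {Λ : Finset W} (A : LocalOp G Λ) :
    ℂ :=
  if h : Λ ⊆ Λ' then (ρ * extendOp G h A).trace else 0

/-- `ω` is an infinite-volume ground state: the weak limit (on all local observables) of a sequence
of ground states on the balls around the root `o`. -/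
def IsInfiniteVolumeGroundState (o : W) (ω : (Λ : Finset W) → LocalOp G Λ → ℂ) : Prop :=
  ∃ ρ : (n : ℕ) → LocalOp G (graphBall G o n),
    (∀ n, IsFiniteVolumeGroundState G (ρ n)) ∧
    ∀ (Λ : Finset W) (A : LocalOp G Λ),
      Filter.Tendsto (fun n => expectation G (ρ n) A) Filter.atTop (nhds (ω Λ A))

/-- The spin component `S^α` at the site `x`, as a local observable. -/
noncomputable def spinAt (x : W) (α : Fin 3) : LocalOp G {x} :=
  siteOp G (⟨x, Finset.mem_singleton_self x⟩ : ({x} : Finset W)) (spinMatrix (G.degree x) α)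

/-- The infinite-volume ground state is unique: all the weak limits of ground states on the balls,
for all choices of boundary conditions, agree. -/
def HasUniqueGroundState (o : W) : Prop :=
  ∃! ω : (Λ : Finset W) → LocalOp G Λ → ℂ, IsInfiniteVolumeGroundState G o ω

/-- Antiferromagnetic (Néel) order: some infinite-volume ground state has a staggered magnetization
that is bounded away from zero. -/
def IsOrdered (o : W) : Prop :=
  ∃ ω : (Λ : Finset W) → LocalOp G Λ → ℂ, IsInfiniteVolumeGroundState G o ω ∧
    ∃ m : ℝ, 0 < m ∧ ∀ x : W, m ≤ (-1) ^ G.dist o x * (ω {x} (spinAt G x 2)).re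

/-- Disorder: no infinite-volume ground state has a magnetization at any site. -/
def IsDisordered (o : W) : Prop :=
  ∀ ω : (Λ : Finset W) → LocalOp G Λ → ℂ, IsInfiniteVolumeGroundState G o ω →
    ∀ (x : W) (α : Fin 3), ω {x} (spinAt G x α) = 0

end AKLT

/-! ### Transfer operators -/

/-- The Pauli matrices `σ₁, σ₂, σ₃`; the index `0` is "up", the index `1` is "down". -/
def pauli : Fin 3 → Matrix (Fin 2) (Fin 2) ℂ :=
  ![!![0, 1; 1, 0], !![0, -Complex.I; Complex.I, 0], !![1, 0; 0, -1]]

/-- `𝟙 + x · σ`. -/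
noncomputable def blochMatrix (x : EuclideanSpace ℝ (Fin 3)) : Matrix (Fin 2) (Fin 2) ℂ :=
  1 + ∑ i, (x i : ℂ) • pauli i

/-- The boundary condition `(𝟙 + x · σ) ^ {⊗ n}`, an element of `M₂(ℂ) ^ {⊗ n}`. -/
noncomputable def productBoundary (n : ℕ) (x : EuclideanSpace ℝ (Fin 3)) :
    Matrix (Fin n → Fin 2) (Fin n → Fin 2) ℂ :=
  Matrix.of fun a b => ∏ i, blochMatrix x (a i) (b i)

/-- The number of ups of a basis vector of `(ℂ²) ^ {⊗ n}`. -/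
def numUps {n : ℕ} (a : Fin n → Fin 2) : ℕ := (Finset.univ.filter fun i => a i = 0).card

/-- For a site of degree `n + 1`, with `n` ingoing legs and one outgoing leg: the operator
`P_k = binom(n + 1, k) ^ (-1/2) (|↑⟩⟨w_{k-1}| + |↓⟩⟨w_k|)`, where `w_k` is the sum of all the basis
vectors of `(ℂ²) ^ {⊗ n}` with `k` ups. -/
noncomputable def sitePk (n k : ℕ) : Matrix (Fin 2) (Fin n → Fin 2) ℂ :=
  Matrix.of fun s a =>
    if (s = 0 ∧ numUps a + 1 = k) ∨ (s = 1 ∧ numUps a = k) then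
      (((Real.sqrt ((n + 1).choose k : ℝ))⁻¹ : ℝ) : ℂ) else 0

/-- `W_k = S P_k` with the singlet matrix `S = |↑⟩⟨↓| - |↓⟩⟨↑|`. -/
noncomputable def siteWk (n k : ℕ) : Matrix (Fin 2) (Fin n → Fin 2) ℂ :=
  (!![0, 1; -1, 0] : Matrix (Fin 2) (Fin 2) ℂ) * sitePk n k

/-- The unital transfer operator `M₂(ℂ) ^ {⊗ n} → M₂(ℂ)` of a single AKLT site of degree `n + 1`:
`M ↦ 2 / (n + 2) ∑ k, W_k M W_k^*`. -/
noncomputable def siteTransfer (n : ℕ) (M : Matrix (Fin n → Fin 2) (Fin n → Fin 2) ℂ) :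
    Matrix (Fin 2) (Fin 2) ℂ :=
  (2 / ((n : ℂ) + 2)) • ∑ k ∈ Finset.range (n + 2), siteWk n k * M * (siteWk n k)ᴴ

/-- The transfer operator `M₂(ℂ) → M₂(ℂ)` of a site of degree `2`. -/
noncomputable def chainTransfer (M : Matrix (Fin 2) (Fin 2) ℂ) : Matrix (Fin 2) (Fin 2) ℂ :=
  siteTransfer 1 (Matrix.of fun a b => M (a 0) (b 0))

/-- The transfer operator of the cell of the decorated Cayley tree: a site of degree `d`, with `d - 1`
ingoing legs, whose outgoing leg is followed by a chain of `g` sites of degree `2`. -/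
noncomputable def cellTransfer (d g : ℕ) (M : Matrix (Fin (d - 1) → Fin 2) (Fin (d - 1) → Fin 2) ℂ) :
    Matrix (Fin 2) (Fin 2) ℂ :=
  Nat.iterate chainTransfer g (siteTransfer (d - 1) M)

/-- The image of the product boundary condition `(𝟙 + x · σ) ^ {⊗ (d - 1)}` under the transfer operator
of the cell, normalized to have the trace `2` of `𝟙`. -/
noncomputable def normalizedCellImage (d g : ℕ) (x : EuclideanSpace ℝ (Fin 3)) :
    Matrix (Fin 2) (Fin 2) ℂ :=
  (2 / (cellTransfer d g (productBoundary (d - 1) x)).trace) •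
    cellTransfer d g (productBoundary (d - 1) x)

/-- The transfer function `F_{d,g}` of the cell: minus the distance, in the operator norm, of `𝟙` and
the normalized image of the boundary condition `(𝟙 + x · σ) ^ {⊗ (d - 1)}`. -/
noncomputable def cellTransferFunction (d g : ℕ) (x : EuclideanSpace ℝ (Fin 3)) : ℝ :=
  -‖Matrix.toEuclideanCLM (n := Fin 2) (𝕜 := ℂ) (normalizedCellImage d g x - 1)‖

/-- The function `F_d(t) = -(d coth (d artanh t) - 1 / t) / (d + 1)` on `[0, 1]`, written as a rational
function of `t`; the value at `t = 0` is the limit `0`, by the convention `0 / 0 = 0`. -/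
noncomputable def transferF (d : ℕ) (t : ℝ) : ℝ :=
  -(((d + 1) * t * ((1 + t) ^ d + (1 - t) ^ d) - ((1 + t) ^ (d + 1) - (1 - t) ^ (d + 1))) /
    ((d + 1) * t * ((1 + t) ^ d - (1 - t) ^ d)))

/-! A spin n/2 is represented by the polynomials of degree at most n in one variable, whose exponent
counts the up bosons. On a bond, the square of the total spin is J(J+1) - D*D, where D annihilates a
singlet. So the bond projection kills exactly the range of D*, which consists of the polynomials
divisible by X_x - X_y. Distinct edges give coprime linear forms, hence the ground states of a
region are the polynomials divisible by the product of these forms over all its edges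
(`akltHamiltonian_mulVec_eq_zero_iff_prod_dvd`). At an interior site this product already has the
maximal degree: a ground state has freedom only at the boundary.

Expectations are linear functionals of a polynomial in ket and bra variables. Give each leg that
leaves the region a 2 × 2 matrix as boundary condition. On a tree, tracing out a leaf turns the
matrices on its outer legs into one matrix on its edge to the rest (`stateFun_vbsPoly_insert`), so
boundary conditions travel inwards as messages. For messages 1 + r·σ the outgoing message is, up to
a positive factor, 1 - (N/D)·σ. The density D and the moment N satisfy recursions in the set of legs
(`siteDensity_insert`, `siteMoment_eq`), which come from a Wick theorem for the trace over a
symmetric tensor power; the minus sign is the antiferromagnetism. For equal messages the recursions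
have a closed solution, which is F_d, and a site of degree 2 multiplies r by -1/3; this is claim 1.
To first order in r a cell multiplies the length of r by (d-1)/3^(g+1), whence the threshold.

Above the threshold, zero is unstable, while messages of length at most 1 keep length at most 1. The
intermediate value theorem gives a nonzero length that a cell preserves (`exists_equalLegs_eq`).
Alternating its sign with the sublattice gives a family of messages preserved by every site, hence
an infinite-volume ground state with staggered magnetization bounded below. The opposite family
gives a second one.

Below the threshold, `norm_siteMoment_le` shows that a cell contracts messages at least by the
linear factor, so the influence of a distant product boundary condition decays geometrically. A
general ground state on a ball does not have a product boundary condition. But the trace over the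
outermost layer is a positive average over coherent states, and fixing coherent states there leaves
a valence bond state with a product boundary condition (`isCloseTo_doubled_polyOf`). Hence all
expectations converge to those of the state whose messages are all 1, and that state has no
magnetization. -/

/-! ### Schwinger bosons for a single spin -/

/-- The annihilator of an up boson of spin `n / 2`, as an operator with values in the first `n` basis
vectors. -/
noncomputable def bosonUp (n : ℕ) : Matrix (Fin (n + 1)) (Fin (n + 1)) ℂ :=
  Matrix.of fun i j => if (j : ℕ) = i + 1 then ((Real.sqrt (j : ℝ) : ℝ) : ℂ) else 0

/-- The annihilator of a down boson of spin `n / 2`, as an operator with values in the first `n` basis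
vectors. -/
noncomputable def bosonDown (n : ℕ) : Matrix (Fin (n + 1)) (Fin (n + 1)) ℂ :=
  Matrix.diagonal fun k => ((Real.sqrt ((n : ℝ) - k) : ℝ) : ℂ)

theorem fin_cast_sub_nonneg {n : ℕ} (k : Fin (n + 1)) : (0 : ℝ) ≤ (n : ℝ) - k := by
  have := Fin.is_le k
  have h : ((k : ℕ) : ℝ) ≤ n := by exact_mod_cast this
  linarith

theorem ofReal_sqrt_mul_self {x : ℝ} (h : 0 ≤ x) :
    ((Real.sqrt x : ℝ) : ℂ) * ((Real.sqrt x : ℝ) : ℂ) = x := by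
  rw [← Complex.ofReal_mul, Real.mul_self_sqrt h]

theorem bosonUp_conjTranspose_mul (n : ℕ) :
    (bosonUp n)ᴴ * bosonUp n = (n / 2 : ℂ) • 1 + spinMatrix n 2 := by
  ext i j
  have : ∀ k : Fin (n + 1), (bosonUp n)ᴴ i k * bosonUp n k j =
      if (i : ℕ) = k + 1 ∧ i = j then (i : ℂ) else 0 := by
    intro k
    simp only [bosonUp, Matrix.conjTranspose_apply, Matrix.of_apply]
    by_cases h1 : (i : ℕ) = k + 1 <;> by_cases h2 : i = j
    · subst h2
      rw [if_pos h1, if_pos ⟨h1, rfl⟩, Complex.star_def, Complex.conj_ofReal,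
        ofReal_sqrt_mul_self (by positivity)]
      simp
    · rw [if_neg (show ¬ ((j : ℕ) = k + 1) from fun h => h2 (Fin.ext (by omega)))]
      simp [h2]
    · simp [h1]
    · simp [h1]
  rw [Matrix.mul_apply]
  simp_rw [this]
  simp only [spinMatrix, Matrix.add_apply, Matrix.smul_apply, Matrix.one_apply, smul_eq_mul,
    Matrix.cons_val, Matrix.diagonal_apply]
  by_cases h2 : i = j
  · subst h2
    simp only [and_true, if_true, mul_one]
    rcases Nat.eq_zero_or_pos (i : ℕ) with h0 | h0
    · simp [h0]
    · rw [Finset.sum_eq_single (⟨i - 1, by omega⟩ : Fin (n + 1))]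
      · rw [if_pos (by simp; omega)]; ring
      · intro b _ hb
        rw [if_neg]
        intro h
        exact hb (Fin.ext (by simp; omega))
      · simp
  · simp [h2]

theorem bosonDown_conjTranspose (n : ℕ) : (bosonDown n)ᴴ = bosonDown n := by
  rw [bosonDown, Matrix.diagonal_conjTranspose]
  congr 1
  ext k
  simp

theorem bosonDown_conjTranspose_mul (n : ℕ) :
    (bosonDown n)ᴴ * bosonDown n = (n / 2 : ℂ) • 1 - spinMatrix n 2 := by
  rw [bosonDown_conjTranspose, bosonDown, Matrix.diagonal_mul_diagonal]
  ext i j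
  simp only [spinMatrix, Matrix.sub_apply, Matrix.smul_apply, Matrix.one_apply, smul_eq_mul,
    Matrix.cons_val, Matrix.diagonal_apply]
  split_ifs
  · rw [ofReal_sqrt_mul_self (fin_cast_sub_nonneg i)]
    push_cast; ring
  · simp

theorem bosonUp_conjTranspose_mul_bosonDown (n : ℕ) :
    (bosonUp n)ᴴ * bosonDown n = spinRaise n := by
  ext i j
  rw [bosonDown, Matrix.mul_diagonal]
  simp only [bosonUp, spinRaise, Matrix.conjTranspose_apply, Matrix.of_apply]
  split_ifs with h
  · rw [Complex.star_def, Complex.conj_ofReal, ← Complex.ofReal_mul, h,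
      Real.sqrt_mul (by positivity)]
    push_cast; rfl
  · simp

theorem bosonDown_conjTranspose_mul_bosonUp (n : ℕ) :
    (bosonDown n)ᴴ * bosonUp n = (spinRaise n)ᴴ := by
  rw [← bosonUp_conjTranspose_mul_bosonDown, Matrix.conjTranspose_mul,
    Matrix.conjTranspose_conjTranspose]

theorem spinRaise_mul_conjTranspose (n : ℕ) :
    spinRaise n * (spinRaise n)ᴴ = Matrix.diagonal fun k : Fin (n + 1) => (k : ℂ) * (n - k + 1) := by
  ext i j
  have : ∀ k : Fin (n + 1), spinRaise n i k * (spinRaise n)ᴴ k j =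
      if (i : ℕ) = k + 1 ∧ i = j then (i : ℂ) * (n - i + 1) else 0 := by
    intro k
    simp only [spinRaise, Matrix.conjTranspose_apply, Matrix.of_apply]
    by_cases h1 : (i : ℕ) = k + 1 <;> by_cases h2 : i = j
    · subst h2
      rw [if_pos h1, if_pos ⟨h1, rfl⟩, Complex.star_def, Complex.conj_ofReal,
        ofReal_sqrt_mul_self (mul_nonneg (by positivity) (fin_cast_sub_nonneg k)), h1]
      push_cast; ring
    · rw [if_neg (show ¬ ((j : ℕ) = k + 1) from fun h => h2 (Fin.ext (by omega)))]
      simp [h2]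
    · simp [h1]
    · simp [h1]
  rw [Matrix.mul_apply]
  simp_rw [this]
  rw [Matrix.diagonal_apply]
  by_cases h2 : i = j
  · subst h2
    simp only [and_true, if_true]
    rcases Nat.eq_zero_or_pos (i : ℕ) with h0 | h0
    · simp [h0]
    · rw [Finset.sum_eq_single (⟨i - 1, by omega⟩ : Fin (n + 1))]
      · rw [if_pos (by simp; omega)]
      · intro b _ hb
        rw [if_neg]
        intro h
        exact hb (Fin.ext (by simp; omega))
      · simp
  · simp [h2]

theorem spinRaise_conjTranspose_mul (n : ℕ) :
    (spinRaise n)ᴴ * spinRaise n = Matrix.diagonal fun k : Fin (n + 1) => ((k : ℂ) + 1) * (n - k) := by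
  ext i j
  have : ∀ k : Fin (n + 1), (spinRaise n)ᴴ i k * spinRaise n k j =
      if (k : ℕ) = i + 1 ∧ i = j then ((i : ℂ) + 1) * (n - i) else 0 := by
    intro k
    simp only [spinRaise, Matrix.conjTranspose_apply, Matrix.of_apply]
    by_cases h1 : (k : ℕ) = i + 1 <;> by_cases h2 : i = j
    · subst h2
      rw [if_pos h1, if_pos ⟨h1, rfl⟩, Complex.star_def, Complex.conj_ofReal,
        ofReal_sqrt_mul_self (mul_nonneg (by positivity) (fin_cast_sub_nonneg i))]
      push_cast; ring
    · rw [if_neg (show ¬ ((k : ℕ) = j + 1) from fun h => h2 (Fin.ext (by omega)))]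
      simp [h2]
    · simp [h1]
    · simp [h1]
  rw [Matrix.mul_apply]
  simp_rw [this]
  rw [Matrix.diagonal_apply]
  by_cases h2 : i = j
  · subst h2
    simp only [and_true, if_true]
    by_cases h0 : (i : ℕ) = n
    · simp only [h0, sub_self, mul_zero, ite_self, Finset.sum_const_zero]
    · have hi := i.is_lt
      rw [Finset.sum_eq_single (⟨i + 1, by omega⟩ : Fin (n + 1))]
      · rw [if_pos rfl]
      · intro b _ hb
        rw [if_neg]
        intro h
        exact hb (Fin.ext (by simp; omega))
      · simp
  · simp [h2]

theorem sum_spinMatrix_mul_self (n : ℕ) :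
    ∑ α, spinMatrix n α * spinMatrix n α = ((n / 2 : ℂ) * (n / 2 + 1)) • 1 := by
  have h12 : spinMatrix n 0 * spinMatrix n 0 + spinMatrix n 1 * spinMatrix n 1 =
      (1 / 2 : ℂ) • (spinRaise n * (spinRaise n)ᴴ + (spinRaise n)ᴴ * spinRaise n) := by
    simp only [spinMatrix, Matrix.cons_val, smul_mul_smul_comm, mul_add, add_mul, mul_sub, sub_mul]
    have : -Complex.I / 2 * (-Complex.I / 2) = (-1 / 4 : ℂ) := by
      linear_combination (1 / 4 : ℂ) * Complex.I_mul_I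
    rw [this]
    module
  rw [Fin.sum_univ_three, h12, spinRaise_mul_conjTranspose, spinRaise_conjTranspose_mul]
  ext i j
  simp only [spinMatrix, Matrix.add_apply, Matrix.smul_apply, Matrix.one_apply, smul_eq_mul,
    Matrix.cons_val, Matrix.diagonal_apply, Matrix.diagonal_mul_diagonal]
  split_ifs
  · ring
  · simp

/-- The scalar product of two vectors of spin operators, in terms of ladder operators. -/
theorem sum_spinMatrix_mul {R : Type*} [Ring R] [Algebra ℂ R] {m n : ℕ}
    (f : Matrix (Fin (m + 1)) (Fin (m + 1)) ℂ →ₗ[ℂ] R)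
    (g : Matrix (Fin (n + 1)) (Fin (n + 1)) ℂ →ₗ[ℂ] R) :
    ∑ α, f (spinMatrix m α) * g (spinMatrix n α) =
      f (spinMatrix m 2) * g (spinMatrix n 2) + (1 / 2 : ℂ) •
        (f (spinRaise m) * g (spinRaise n)ᴴ + f (spinRaise m)ᴴ * g (spinRaise n)) := by
  rw [Fin.sum_univ_three, add_comm]
  congr 1
  simp only [spinMatrix, Matrix.cons_val, map_smul, map_add, map_sub, smul_mul_smul_comm, mul_add,
    add_mul, mul_sub, sub_mul]
  have : -Complex.I / 2 * (-Complex.I / 2) = (-1 / 4 : ℂ) := by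
    linear_combination (1 / 4 : ℂ) * Complex.I_mul_I
  rw [this]
  module


/-! ### Operators on single sites and the Casimir identity on a bond -/

section SiteOperators

open scoped Classical ComplexOrder

variable {W : Type*} {G : SimpleGraph W} [G.LocallyFinite] {Λ : Finset W}

theorem siteOp_mulVec (x : Λ) (A : Matrix (Fin (G.degree x + 1)) (Fin (G.degree x + 1)) ℂ)
    (v : Config G Λ → ℂ) (σ : Config G Λ) :
    (siteOp G x A *ᵥ v) σ = ∑ k, A (σ x) k * v (Function.update σ x k) := by
  simp only [Matrix.mulVec, dotProduct, siteOp, Matrix.of_apply, ite_mul, zero_mul]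
  rw [← Finset.sum_filter]
  refine Finset.sum_nbij' (fun τ => τ x) (fun k => Function.update σ x k) (by simp) ?_ ?_ (by simp) ?_
  · intro k _
    simp only [Finset.mem_filter, Finset.mem_univ, true_and]
    intro y hy
    rw [Function.update_of_ne hy]
  · intro τ hτ
    simp only [Finset.mem_filter, Finset.mem_univ, true_and] at hτ
    funext y
    by_cases hy : y = x
    · subst hy; simp
    · rw [Function.update_of_ne hy, hτ y hy]
  · intro τ hτ
    simp only [Finset.mem_filter, Finset.mem_univ, true_and] at hτ
    congr 2
    funext y
    by_cases hy : y = x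
    · subst hy; simp
    · rw [Function.update_of_ne hy, hτ y hy]

theorem Matrix.ext_of_forall_mulVec {n : Type*} [Fintype n] {A B : Matrix n n ℂ}
    (h : ∀ v, A *ᵥ v = B *ᵥ v) : A = B := by
  ext i j
  have := congrFun (h (Pi.single j 1)) i
  simpa using this

/-- `siteOp` as a linear map. -/
noncomputable def siteOpLin (x : Λ) :
    Matrix (Fin (G.degree x + 1)) (Fin (G.degree x + 1)) ℂ →ₗ[ℂ] LocalOp G Λ where
  toFun := siteOp G x
  map_add' A B := by
    ext σ τ
    simp only [siteOp, Matrix.of_apply, Matrix.add_apply]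
    split_ifs <;> simp
  map_smul' c A := by
    ext σ τ
    simp only [siteOp, Matrix.of_apply, Matrix.smul_apply, RingHom.id_apply]
    split_ifs <;> simp

theorem siteOpLin_apply (x : Λ) (A : Matrix (Fin (G.degree x + 1)) (Fin (G.degree x + 1)) ℂ) :
    siteOpLin x A = siteOp G x A := rfl

theorem siteOp_mul (x : Λ) (A B : Matrix (Fin (G.degree x + 1)) (Fin (G.degree x + 1)) ℂ) :
    siteOp G x (A * B) = siteOp G x A * siteOp G x B := by
  refine Matrix.ext_of_forall_mulVec fun v => ?_
  rw [← Matrix.mulVec_mulVec]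
  funext σ
  simp only [siteOp_mulVec, Matrix.mul_apply, Function.update_self, Function.update_idem,
    Finset.sum_mul, Finset.mul_sum]
  rw [Finset.sum_comm]
  simp only [mul_assoc]

theorem siteOp_one (x : Λ) : siteOp G x 1 = (1 : LocalOp G Λ) := by
  refine Matrix.ext_of_forall_mulVec fun v => ?_
  funext σ
  simp [siteOp_mulVec, Matrix.one_apply]

theorem siteOp_conjTranspose (x : Λ) (A : Matrix (Fin (G.degree x + 1)) (Fin (G.degree x + 1)) ℂ) :
    (siteOp G x A)ᴴ = siteOp G x Aᴴ := by
  ext σ τ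
  simp only [siteOp, Matrix.conjTranspose_apply, Matrix.of_apply, eq_comm (a := τ _)]
  split_ifs <;> simp

theorem siteOp_comm {x y : Λ} (hxy : x ≠ y)
    (A : Matrix (Fin (G.degree x + 1)) (Fin (G.degree x + 1)) ℂ)
    (B : Matrix (Fin (G.degree y + 1)) (Fin (G.degree y + 1)) ℂ) :
    siteOp G x A * siteOp G y B = siteOp G y B * siteOp G x A := by
  refine Matrix.ext_of_forall_mulVec fun v => ?_
  rw [← Matrix.mulVec_mulVec, ← Matrix.mulVec_mulVec]
  funext σ
  simp only [siteOp_mulVec, Finset.mul_sum, Function.update_of_ne hxy, Function.update_of_ne hxy.symm]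
  rw [Finset.sum_comm]
  refine Finset.sum_congr rfl fun k _ => Finset.sum_congr rfl fun l _ => ?_
  rw [Function.update_comm hxy]
  ring

/-- The annihilator of a singlet on the sites `x` and `y`. -/
noncomputable def singletAnnihilator (x y : Λ) : LocalOp G Λ :=
  siteOp G x (bosonUp _) * siteOp G y (bosonDown _) - siteOp G x (bosonDown _) * siteOp G y (bosonUp _)

/-- The spin at `x` and `y` differs from its maximal value by the number of singlets. -/
theorem totalSpinSq_eq {x y : Λ} (hxy : x ≠ y) :
    totalSpinSq G x y = (maxSpin G x y * (maxSpin G x y + 1)) • 1 -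
      (singletAnnihilator x y)ᴴ * singletAnnihilator x y := by
  set m : ℂ := (G.degree x : ℂ) with hm
  set n : ℂ := (G.degree y : ℂ) with hn
  have key : ∀ (A A' : Matrix (Fin (G.degree x + 1)) (Fin (G.degree x + 1)) ℂ)
      (B B' : Matrix (Fin (G.degree y + 1)) (Fin (G.degree y + 1)) ℂ),
      siteOp G y B * siteOp G x A * (siteOp G x A' * siteOp G y B') =
        siteOp G x (A * A') * siteOp G y (B * B') := by
    intro A A' B B'
    rw [siteOp_mul, siteOp_mul, ← siteOp_comm hxy, mul_assoc, mul_assoc, ← mul_assoc (siteOp G y B),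
      ← siteOp_comm hxy A' B]
    simp only [mul_assoc]
  -- At one site a creator times an annihilator is a spin operator, up to a scalar. So D*D becomes
  -- bilinear in the two spins, namely mn/2 - 2 S_x·S_y, and its scalar product is the cross term of
  -- the total spin squared.
  have hD : (singletAnnihilator x y)ᴴ * singletAnnihilator x y =
      (m * n / 2) • (1 : LocalOp G Λ) -
        (2 : ℂ) • ∑ α, siteOp G x (spinMatrix _ α) * siteOp G y (spinMatrix _ α) := by
    have := sum_spinMatrix_mul (siteOpLin (G := G) x) (siteOpLin (G := G) y)
    simp only [siteOpLin_apply] at this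
    rw [this, singletAnnihilator]
    simp only [Matrix.conjTranspose_sub, Matrix.conjTranspose_mul, siteOp_conjTranspose, sub_mul,
      mul_sub, key, bosonUp_conjTranspose_mul, bosonDown_conjTranspose_mul,
      bosonUp_conjTranspose_mul_bosonDown, bosonDown_conjTranspose_mul_bosonUp]
    simp only [← siteOpLin_apply, map_add, map_sub, map_smul]
    simp only [siteOpLin_apply, siteOp_one, ← hm, ← hn, add_mul, mul_sub, sub_mul, mul_add,
      smul_mul_smul_comm, one_mul, mul_one, Matrix.smul_mul, Matrix.mul_smul]
    module
  have hsq : ∀ α, (siteOp G x (spinMatrix _ α) + siteOp G y (spinMatrix _ α)) ^ 2 =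
      siteOp G x (spinMatrix _ α * spinMatrix _ α) + siteOp G y (spinMatrix _ α * spinMatrix _ α) +
        (2 : ℂ) • (siteOp G x (spinMatrix _ α) * siteOp G y (spinMatrix _ α)) := by
    intro α
    rw [sq, add_mul, mul_add, mul_add, ← siteOp_comm hxy, siteOp_mul, siteOp_mul, two_smul]
    abel
  have hx : ∑ α, siteOp G x (spinMatrix _ α * spinMatrix _ α) = ((m / 2) * (m / 2 + 1)) • 1 := by
    simp only [← siteOpLin_apply, ← map_sum, sum_spinMatrix_mul_self, map_smul]
    rw [siteOpLin_apply, siteOp_one]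
  have hy : ∑ α, siteOp G y (spinMatrix _ α * spinMatrix _ α) = ((n / 2) * (n / 2 + 1)) • 1 := by
    simp only [← siteOpLin_apply, ← map_sum, sum_spinMatrix_mul_self, map_smul]
    rw [siteOpLin_apply, siteOp_one]
  rw [totalSpinSq, hD]
  simp only [hsq, Finset.sum_add_distrib, hx, hy, ← Finset.smul_sum]
  rw [maxSpin, ← hm, ← hn]
  module

end SiteOperators


/-! ### Polynomials instead of vectors, and the kernel of a bond projection -/

section BondProjection

open scoped Classical ComplexOrder

variable {W : Type*} {G : SimpleGraph W} [G.LocallyFinite] {Λ : Finset W}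

/-- The exponent vector of a configuration: the number of up bosons at every site. -/
noncomputable def expo (σ : Config G Λ) : W →₀ ℕ := Finsupp.indicator Λ fun x hx => (σ ⟨x, hx⟩ : ℕ)

theorem expo_apply (σ : Config G Λ) (x : Λ) : expo σ x = σ x := by
  rw [expo, Finsupp.indicator_of_mem x.2]

theorem expo_apply_of_notMem (σ : Config G Λ) {x : W} (hx : x ∉ Λ) : expo σ x = 0 := by
  rw [expo, Finsupp.indicator_of_notMem hx]

theorem expo_injective : Function.Injective (expo : Config G Λ → W →₀ ℕ) := by
  intro σ τ h
  funext x
  refine Fin.ext ?_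
  rw [← expo_apply, ← expo_apply, h]

/-- The norm factor which relates monomials and the orthonormal product basis. -/
noncomputable def configNorm (σ : Config G Λ) : ℝ :=
  ∏ x : Λ, Real.sqrt ((G.degree x).choose (σ x) : ℝ)

theorem configNorm_pos (σ : Config G Λ) : 0 < configNorm σ := by
  refine Finset.prod_pos fun x _ => Real.sqrt_pos.mpr ?_
  exact_mod_cast Nat.choose_pos (Fin.is_le _)

theorem configNorm_ne_zero (σ : Config G Λ) : (configNorm σ : ℂ) ≠ 0 := by
  exact_mod_cast (configNorm_pos σ).ne'

/-- The largest degree, in the variable of the site `x`, of the polynomial of a vector. -/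
noncomputable def capDegree (G : SimpleGraph W) [G.LocallyFinite] (Λ : Finset W) (x : W) : ℕ :=
  if x ∈ Λ then G.degree x else 0

/-- The polynomial (in the variables of the up bosons) of a vector. -/
noncomputable def polyOf : (Config G Λ → ℂ) →ₗ[ℂ] MvPolynomial W ℂ where
  toFun ψ := ∑ σ, MvPolynomial.monomial (expo σ) (ψ σ * configNorm σ)
  map_add' ψ φ := by simp [add_mul, Finset.sum_add_distrib]
  map_smul' c ψ := by simp [mul_assoc, Finset.smul_sum, MvPolynomial.smul_monomial]

theorem polyOf_apply (ψ : Config G Λ → ℂ) :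
    polyOf ψ = ∑ σ, MvPolynomial.monomial (expo σ) (ψ σ * configNorm σ) := rfl

/-- The vector of a polynomial. -/
noncomputable def vecOf (p : MvPolynomial W ℂ) (σ : Config G Λ) : ℂ :=
  MvPolynomial.coeff (expo σ) p / configNorm σ

theorem coeff_polyOf (ψ : Config G Λ → ℂ) (σ : Config G Λ) :
    MvPolynomial.coeff (expo σ) (polyOf ψ) = ψ σ * configNorm σ := by
  rw [polyOf_apply, MvPolynomial.coeff_sum, Finset.sum_eq_single σ]
  · simp
  · intro τ _ hτ
    rw [MvPolynomial.coeff_monomial, if_neg fun h => hτ (expo_injective h)]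
  · simp

theorem vecOf_polyOf (ψ : Config G Λ → ℂ) : vecOf (polyOf ψ) = ψ := by
  funext σ
  rw [vecOf, coeff_polyOf, mul_div_cancel_right₀ _ (configNorm_ne_zero σ)]

theorem exists_eq_expo {e : W →₀ ℕ} (he : ∀ x, e x ≤ capDegree G Λ x) :
    ∃ σ : Config G Λ, e = expo σ := by
  refine ⟨fun x => ⟨e x, ?_⟩, ?_⟩
  · have := he x
    rw [capDegree, if_pos x.2] at this
    omega
  · ext x
    by_cases hx : x ∈ Λ
    · rw [expo, Finsupp.indicator_of_mem hx]
    · rw [expo_apply_of_notMem _ hx]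
      have := he x
      rw [capDegree, if_neg hx] at this
      omega

/-- The degree bounds cut out exactly the range of `polyOf`: under them every exponent vector in the
support of p is the exponent vector of a configuration. -/
theorem polyOf_vecOf {p : MvPolynomial W ℂ} (hp : ∀ x, p.degreeOf x ≤ capDegree G Λ x) :
    polyOf (vecOf p : Config G Λ → ℂ) = p := by
  ext e
  by_cases he : ∃ σ : Config G Λ, e = expo σ
  · obtain ⟨σ, rfl⟩ := he
    rw [coeff_polyOf, vecOf, div_mul_cancel₀ _ (configNorm_ne_zero σ)]
  · have h1 : MvPolynomial.coeff e p = 0 := by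
      by_contra hne
      refine he (exists_eq_expo fun x => ?_)
      exact (MvPolynomial.degreeOf_le_iff.mp (hp x)) e (MvPolynomial.mem_support_iff.mpr hne)
    rw [h1, polyOf_apply, MvPolynomial.coeff_sum]
    refine Finset.sum_eq_zero fun σ _ => ?_
    rw [MvPolynomial.coeff_monomial, if_neg fun h => he ⟨σ, h.symm⟩]

theorem degreeOf_polyOf_le (ψ : Config G Λ → ℂ) (x : W) :
    (polyOf ψ).degreeOf x ≤ capDegree G Λ x := by
  rw [MvPolynomial.degreeOf_le_iff]
  intro e he
  rw [MvPolynomial.mem_support_iff, polyOf_apply, MvPolynomial.coeff_sum] at he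
  obtain ⟨σ, _, hσ⟩ := Finset.exists_ne_zero_of_sum_ne_zero he
  rw [MvPolynomial.coeff_monomial] at hσ
  have : expo σ = e := by
    by_contra h
    exact hσ (if_neg h)
  rw [← this, capDegree]
  split_ifs with hx
  · rw [expo_apply (Λ := Λ) σ ⟨x, hx⟩]
    exact Fin.is_le (σ ⟨x, hx⟩)
  · rw [expo_apply_of_notMem _ hx]

theorem polyOf_single (σ : Config G Λ) (c : ℂ) :
    polyOf (Pi.single σ c) = MvPolynomial.monomial (expo σ) (c * configNorm σ) := by
  rw [polyOf_apply, Finset.sum_eq_single σ]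
  · simp
  · intro τ _ hτ
    simp [Pi.single_eq_of_ne hτ]
  · simp

theorem siteOp_mulVec_single (x : Λ) (A : Matrix (Fin (G.degree x + 1)) (Fin (G.degree x + 1)) ℂ)
    (σ : Config G Λ) (c : ℂ) :
    siteOp G x A *ᵥ Pi.single σ c =
      ∑ k, Pi.single (Function.update σ x k) (A k (σ x) * c) := by
  funext τ
  rw [siteOp_mulVec, Finset.sum_apply]
  by_cases h : τ = Function.update σ x (τ x)
  · rw [Finset.sum_eq_single (σ x), Finset.sum_eq_single (τ x)]
    · rw [← h, Pi.single_eq_same, h]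
      simp
    · intro k _ hk
      rw [Pi.single_eq_of_ne]
      intro h'
      exact hk (by rw [h']; simp)
    · simp
    · intro k _ hk
      rw [Pi.single_eq_of_ne, mul_zero]
      intro h'
      exact hk (by rw [← h']; simp)
    · simp
  · rw [Finset.sum_eq_zero, Finset.sum_eq_zero]
    · intro k _
      rw [Pi.single_eq_of_ne]
      rintro rfl
      simp at h
    · intro k _
      rw [Pi.single_eq_of_ne, mul_zero]
      rintro rfl
      simp at h

theorem siteOp_bosonDown_mulVec (x : Λ) (ψ : Config G Λ → ℂ) (σ : Config G Λ) :
    (siteOp G x (bosonDown _) *ᵥ ψ) σ =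
      ((Real.sqrt ((G.degree x : ℝ) - σ x) : ℝ) : ℂ) * ψ σ := by
  rw [siteOp_mulVec, Finset.sum_eq_single (σ x)]
  · simp [bosonDown]
  · intro k _ hk
    rw [bosonDown, Matrix.diagonal_apply_ne _ hk.symm, zero_mul]
  · simp

theorem configNorm_update (σ : Config G Λ) (x : Λ) (k : Fin (G.degree x + 1)) :
    configNorm (Function.update σ x k) * Real.sqrt ((G.degree x).choose (σ x) : ℝ) =
      configNorm σ * Real.sqrt ((G.degree x).choose k : ℝ) := by
  rw [configNorm, configNorm, ← Finset.mul_prod_erase _ _ (Finset.mem_univ x),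
    ← Finset.mul_prod_erase (a := x) _ (fun z : Λ => Real.sqrt ((G.degree z).choose (σ z) : ℝ))
      (Finset.mem_univ x), Function.update_self]
  rw [Finset.prod_congr rfl (g := fun y : Λ => Real.sqrt ((G.degree y).choose (σ y) : ℝ))]
  · ring
  · intro y hy
    rw [Function.update_of_ne (Finset.ne_of_mem_erase hy)]

theorem expo_update (σ : Config G Λ) (x : Λ) (k : Fin (G.degree x + 1)) (hk : (k : ℕ) = σ x + 1) :
    expo (Function.update σ x k) = Finsupp.single (x : W) 1 + expo σ := by
  ext y
  by_cases hy : y ∈ Λ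
  · rw [Finsupp.add_apply, expo_apply _ ⟨y, hy⟩, expo_apply _ ⟨y, hy⟩]
    by_cases hxy : (⟨y, hy⟩ : Λ) = x
    · subst hxy
      simp [hk, add_comm]
    · rw [Function.update_of_ne hxy, Finsupp.single_apply, if_neg, zero_add]
      intro h
      exact hxy (Subtype.ext h.symm)
  · rw [Finsupp.add_apply, expo_apply_of_notMem _ hy, expo_apply_of_notMem _ hy,
      Finsupp.single_apply, if_neg]
    rintro rfl
    exact hy x.2

/-- The binomial weights in `configNorm` are chosen for this: (k+1)·C(n,k+1) = (n-k)·C(n,k) turns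
the matrix element √(k+1) of the creator into √(n-k), that of the down annihilator. At k = n both
sides vanish. -/
theorem polyOf_siteOp_bosonUp (x : Λ) (ψ : Config G Λ → ℂ) :
    polyOf (siteOp G x (bosonUp _)ᴴ *ᵥ ψ) =
      MvPolynomial.X (x : W) * polyOf (siteOp G x (bosonDown _) *ᵥ ψ) := by
  have : polyOf ∘ₗ Matrix.mulVecLin (siteOp G x (bosonUp _)ᴴ) =
      LinearMap.mulLeft ℂ (MvPolynomial.X (x : W)) ∘ₗ polyOf ∘ₗ
        Matrix.mulVecLin (siteOp G x (bosonDown _)) := by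
    refine LinearMap.pi_ext fun σ c => ?_
    simp only [LinearMap.comp_apply, Matrix.mulVecLin_apply, LinearMap.mulLeft_apply]
    have hdown : siteOp G x (bosonDown _) *ᵥ Pi.single σ c =
        Pi.single σ (((Real.sqrt ((G.degree x : ℝ) - σ x) : ℝ) : ℂ) * c) := by
      funext τ
      rw [siteOp_bosonDown_mulVec]
      by_cases h : τ = σ
      · subst h; simp
      · simp [Pi.single_eq_of_ne h]
    rw [siteOp_mulVec_single, map_sum, hdown, polyOf_single]
    simp only [polyOf_single, bosonUp, Matrix.conjTranspose_apply, Matrix.of_apply]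
    have hX : (MvPolynomial.X (x : W) : MvPolynomial W ℂ) =
      MvPolynomial.monomial (Finsupp.single (x : W) 1) 1 := rfl
    rw [hX, MvPolynomial.monomial_mul, one_mul]
    have hle := Fin.is_le (σ x)
    by_cases hk : (σ x : ℕ) = G.degree x
    · rw [hk, sub_self, Real.sqrt_zero]
      simp only [Complex.ofReal_zero, zero_mul, map_zero]
      refine Finset.sum_eq_zero fun k _ => ?_
      rw [if_neg]
      · simp
      · have := Fin.is_le k; omega
    · set k : Fin (G.degree x + 1) := ⟨σ x + 1, by omega⟩ with hkdef
      have hkv : (k : ℕ) = σ x + 1 := rfl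
      rw [Finset.sum_eq_single k]
      · rw [if_pos hkv, expo_update σ x k hkv]
        congr 1
        have hreal : Real.sqrt (k : ℝ) * configNorm (Function.update σ x k) =
            Real.sqrt ((G.degree x : ℝ) - σ x) * configNorm σ := by
          have hb : (0 : ℝ) < (G.degree x).choose (σ x) := by
            exact_mod_cast Nat.choose_pos hle
          have h1 := configNorm_update σ x k
          have h2 : Real.sqrt (k : ℝ) * Real.sqrt ((G.degree x).choose k : ℝ) =
              Real.sqrt ((G.degree x : ℝ) - σ x) * Real.sqrt ((G.degree x).choose (σ x) : ℝ) := by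
            rw [← Real.sqrt_mul (by positivity), ← Real.sqrt_mul (fin_cast_sub_nonneg _)]
            congr 1
            have := Nat.choose_succ_right_eq (G.degree x) (σ x)
            have h3 : (((G.degree x).choose (σ x + 1) * (σ x + 1) : ℕ) : ℝ) =
                (((G.degree x).choose (σ x) * (G.degree x - σ x) : ℕ) : ℝ) := by rw [this]
            rw [hkv]
            push_cast [Nat.cast_sub hle] at h3 ⊢
            linarith
          refine mul_right_cancel₀ (Real.sqrt_pos.mpr hb).ne' ?_
          calc _ = Real.sqrt (k : ℝ) * (configNorm (Function.update σ x k) *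
                Real.sqrt ((G.degree x).choose (σ x) : ℝ)) := by ring
            _ = configNorm σ * (Real.sqrt (k : ℝ) * Real.sqrt ((G.degree x).choose k : ℝ)) := by
                rw [h1]; ring
            _ = _ := by rw [h2]; ring
        have := congrArg (fun r : ℝ => (r : ℂ)) hreal
        simp only [Complex.ofReal_mul] at this
        rw [Complex.star_def, Complex.conj_ofReal, mul_right_comm, this]
        ring
      · intro l _ hl
        rw [if_neg]
        · simp
        · intro h
          exact hl (Fin.ext h)
      · simp
  exact LinearMap.congr_fun this ψ

theorem polyOf_singletAnnihilator {x y : Λ} (hxy : x ≠ y) (ψ : Config G Λ → ℂ) :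
    polyOf ((singletAnnihilator x y)ᴴ *ᵥ ψ) =
      (MvPolynomial.X (x : W) - MvPolynomial.X (y : W)) *
        polyOf (siteOp G x (bosonDown _) *ᵥ (siteOp G y (bosonDown _) *ᵥ ψ)) := by
  rw [singletAnnihilator, Matrix.conjTranspose_sub, Matrix.conjTranspose_mul,
    Matrix.conjTranspose_mul, siteOp_conjTranspose, siteOp_conjTranspose, siteOp_conjTranspose,
    siteOp_conjTranspose, bosonDown_conjTranspose, bosonDown_conjTranspose, Matrix.sub_mulVec, map_sub,
    ← siteOp_comm hxy, ← Matrix.mulVec_mulVec, ← Matrix.mulVec_mulVec, polyOf_siteOp_bosonUp,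
    polyOf_siteOp_bosonUp, sub_mul, Matrix.mulVec_mulVec _ (siteOp G y _), ← siteOp_comm hxy,
    ← Matrix.mulVec_mulVec]

theorem one_le_degreeOf_X_sub_X {x y : W} (hxy : x ≠ y) :
    1 ≤ (MvPolynomial.X x - MvPolynomial.X y : MvPolynomial W ℂ).degreeOf x := by
  have hs : Finsupp.single x 1 ∈ (MvPolynomial.X x - MvPolynomial.X y : MvPolynomial W ℂ).support := by
    rw [MvPolynomial.mem_support_iff, MvPolynomial.coeff_sub, MvPolynomial.coeff_X,
      MvPolynomial.coeff_X, if_pos rfl, if_neg, sub_zero]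
    · exact one_ne_zero
    · intro h
      exact hxy ((Finsupp.single_left_injective one_ne_zero h).symm)
  have := MvPolynomial.monomial_le_degreeOf x hs
  simpa using this

theorem X_sub_X_ne_zero {x y : W} (hxy : x ≠ y) :
    (MvPolynomial.X x - MvPolynomial.X y : MvPolynomial W ℂ) ≠ 0 := by
  rw [sub_ne_zero]
  intro h
  exact hxy (MvPolynomial.X_injective h)

theorem polyOf_eq_zero_iff (ψ : Config G Λ → ℂ) : polyOf ψ = 0 ↔ ψ = 0 := by
  constructor
  · intro h
    rw [← vecOf_polyOf ψ, h]
    funext σ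
    simp [vecOf]
  · rintro rfl
    simp

/-- For the converse, degrees add in a product, so the quotient q has degree at most deg x - 1 in
X_x and deg y - 1 in X_y. On its support the factors √(deg - σ) of the down annihilators are
therefore nonzero and can be divided out. Additivity needs q ≠ 0, hence the separate case ψ = 0. -/
theorem mem_range_singletAnnihilator_iff {x y : Λ} (hxy : x ≠ y) (ψ : Config G Λ → ℂ) :
    (∃ φ, (singletAnnihilator x y)ᴴ *ᵥ φ = ψ) ↔
      (MvPolynomial.X (x : W) - MvPolynomial.X (y : W)) ∣ polyOf ψ := by
  constructor
  · rintro ⟨φ, rfl⟩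
    rw [polyOf_singletAnnihilator hxy]
    exact dvd_mul_right _ _
  · rintro ⟨q, hq⟩
    have hxy' : (x : W) ≠ y := fun h => hxy (Subtype.ext h)
    by_cases hψ : ψ = 0
    · exact ⟨0, by rw [hψ, Matrix.mulVec_zero]⟩
    have hq0 : q ≠ 0 := by
      rintro rfl
      rw [mul_zero, polyOf_eq_zero_iff] at hq
      exact hψ hq
    have hdeg : ∀ z, (MvPolynomial.X (x : W) - MvPolynomial.X (y : W) :
        MvPolynomial W ℂ).degreeOf z + q.degreeOf z ≤ capDegree G Λ z := by
      intro z
      rw [← MvPolynomial.degreeOf_mul_eq (X_sub_X_ne_zero hxy') hq0, ← hq]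
      exact degreeOf_polyOf_le ψ z
    have hx1 := one_le_degreeOf_X_sub_X hxy'
    have hy1 := one_le_degreeOf_X_sub_X hxy'.symm
    rw [← neg_sub, MvPolynomial.degreeOf_neg] at hy1
    have hx2 := hdeg x
    have hy2 := hdeg y
    rw [capDegree, if_pos x.2] at hx2
    rw [capDegree, if_pos y.2] at hy2
    refine ⟨fun σ => vecOf q σ / ((Real.sqrt ((G.degree x : ℝ) - σ x) : ℝ) : ℂ) /
      ((Real.sqrt ((G.degree y : ℝ) - σ y) : ℝ) : ℂ), ?_⟩
    rw [← vecOf_polyOf ψ, ← vecOf_polyOf (_ *ᵥ _), polyOf_singletAnnihilator hxy, hq]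
    congr 2
    rw [← polyOf_vecOf (G := G) (Λ := Λ) (p := q) fun z => le_trans (Nat.le_add_left _ _) (hdeg z)]
    congr 1
    funext σ
    rw [siteOp_bosonDown_mulVec, siteOp_bosonDown_mulVec, polyOf_vecOf]
    swap
    · exact fun z => le_trans (Nat.le_add_left _ _) (hdeg z)
    by_cases h0 : MvPolynomial.coeff (expo σ) q = 0
    · simp [vecOf, h0]
    · have hs := MvPolynomial.mem_support_iff.mpr h0
      have hxs := MvPolynomial.monomial_le_degreeOf (x : W) hs
      have hys := MvPolynomial.monomial_le_degreeOf (y : W) hs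
      rw [expo_apply] at hxs hys
      have h1 : ((Real.sqrt ((G.degree x : ℝ) - σ x) : ℝ) : ℂ) ≠ 0 := by
        have : (0 : ℝ) < (G.degree x : ℝ) - σ x := by
          have : (σ x : ℕ) < G.degree x := by omega
          rw [sub_pos]
          exact_mod_cast this
        exact_mod_cast (Real.sqrt_pos.mpr this).ne'
      have h2 : ((Real.sqrt ((G.degree y : ℝ) - σ y) : ℝ) : ℂ) ≠ 0 := by
        have : (0 : ℝ) < (G.degree y : ℝ) - σ y := by
          have : (σ y : ℕ) < G.degree y := by omega
          rw [sub_pos]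
          exact_mod_cast this
        exact_mod_cast (Real.sqrt_pos.mpr this).ne'
      field_simp

theorem toEuclideanCLM_apply_eq_zero_iff {n : Type*} [Fintype n] [DecidableEq n] (A : Matrix n n ℂ) (v : n → ℂ) :
    Matrix.toEuclideanCLM (n := n) (𝕜 := ℂ) A (WithLp.toLp 2 v) = 0 ↔ A *ᵥ v = 0 := by
  rw [Matrix.toEuclideanCLM_toLp]
  constructor
  · intro h
    simpa using congrArg WithLp.ofLp h
  · intro h
    rw [h]; rfl

/-- By the Casimir identity the top eigenspace is ker D*D = ker D. The kernel of the projection onto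
it is the orthogonal complement, which is the range of D*. -/
theorem bondProjection_mulVec_eq_zero_iff {x y : Λ} (hxy : x ≠ y) (ψ : Config G Λ → ℂ) :
    bondProjection G x y *ᵥ ψ = 0 ↔
      (MvPolynomial.X (x : W) - MvPolynomial.X (y : W)) ∣ polyOf ψ := by
  rw [← mem_range_singletAnnihilator_iff hxy, ← toEuclideanCLM_apply_eq_zero_iff, bondProjection,
    StarAlgEquiv.apply_symm_apply, Submodule.starProjection_apply_eq_zero_iff]
  have hker : Module.End.eigenspace (Matrix.toEuclideanLin (totalSpinSq G x y))
      (maxSpin G x y * (maxSpin G x y + 1)) =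
      LinearMap.ker (Matrix.toEuclideanLin (singletAnnihilator x y)) := by
    ext v
    rw [Module.End.mem_eigenspace_iff, LinearMap.mem_ker, totalSpinSq_eq hxy]
    simp only [Matrix.toLpLin_apply, Matrix.sub_mulVec, Matrix.smul_mulVec, Matrix.one_mulVec]
    have : ∀ (a b : Config G Λ → ℂ), (WithLp.toLp 2 (a - b) = WithLp.toLp 2 a) ↔ b = 0 := by
      intro a b
      rw [(WithLp.toLp_injective 2).eq_iff, sub_eq_self]
    have h2 : ∀ a : Config G Λ → ℂ, WithLp.toLp 2 a = 0 ↔ a = 0 := by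
      intro a
      rw [← WithLp.toLp_zero, (WithLp.toLp_injective 2).eq_iff]
    rw [h2, ← Matrix.conjTranspose_mul_self_mulVec_eq_zero, ← this]
    rfl
  rw [hker, LinearMap.orthogonal_ker, ← Matrix.toEuclideanLin_conjTranspose_eq_adjoint,
    LinearMap.mem_range]
  constructor
  · rintro ⟨φ, hφ⟩
    exact ⟨WithLp.ofLp φ, by simpa using congrArg WithLp.ofLp hφ⟩
  · rintro ⟨φ, hφ⟩
    exact ⟨WithLp.toLp 2 φ, by rw [Matrix.toLpLin_apply]; simp [hφ]⟩

end BondProjection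


/-! ### The kernel of the Hamiltonian: divisibility by all singlet polynomials -/

section Hamiltonian

open scoped Classical ComplexOrder

variable {W : Type*} {G : SimpleGraph W} [G.LocallyFinite] {Λ : Finset W}

theorem toEuclideanCLM_symm_conjTranspose_mul_self {n : Type*} [Fintype n] [DecidableEq n]
    {P : EuclideanSpace ℂ n →L[ℂ] EuclideanSpace ℂ n} (h : IsStarProjection P) :
    ((Matrix.toEuclideanCLM (n := n) (𝕜 := ℂ)).symm P)ᴴ *
      (Matrix.toEuclideanCLM (n := n) (𝕜 := ℂ)).symm P =
      (Matrix.toEuclideanCLM (n := n) (𝕜 := ℂ)).symm P := by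
  have h1 : star ((Matrix.toEuclideanCLM (n := n) (𝕜 := ℂ)).symm P) =
      (Matrix.toEuclideanCLM (n := n) (𝕜 := ℂ)).symm P :=
    ((Matrix.toEuclideanCLM (n := n) (𝕜 := ℂ)).symm.map_star' P).symm.trans
      (congrArg _ h.isSelfAdjoint.star_eq)
  rw [← Matrix.star_eq_conjTranspose, h1]
  exact ((Matrix.toEuclideanCLM (n := n) (𝕜 := ℂ)).symm.map_mul' P P).symm.trans
    (congrArg _ h.isIdempotentElem.eq)

theorem bondProjection_conjTranspose_mul_self (x y : Λ) :
    (bondProjection G x y)ᴴ * bondProjection G x y = bondProjection G x y :=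
  toEuclideanCLM_symm_conjTranspose_mul_self isStarProjection_starProjection

/-- The Hamiltonian is a sum of projections, so its quadratic form at ψ is a sum of squared norms,
and it vanishes only if every term does. -/
theorem akltHamiltonian_mulVec_eq_zero_iff (ψ : Config G Λ → ℂ) :
    akltHamiltonian G Λ *ᵥ ψ = 0 ↔
      ∀ x ∈ Λ, ∀ y ∈ Λ, G.Adj x y → (MvPolynomial.X x - MvPolynomial.X y) ∣ polyOf ψ := by
  have key : (∀ x ∈ Λ, ∀ y ∈ Λ, G.Adj x y → (MvPolynomial.X x - MvPolynomial.X y) ∣ polyOf ψ) ↔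
      ∀ x y : Λ, G.Adj x y → bondProjection G x y *ᵥ ψ = 0 := by
    constructor
    · intro h x y hxy
      exact (bondProjection_mulVec_eq_zero_iff (fun e => hxy.ne (congrArg _ e)) ψ).mpr
        (h x x.2 y y.2 hxy)
    · intro h x hx y hy hxy
      exact (bondProjection_mulVec_eq_zero_iff (x := ⟨x, hx⟩) (y := ⟨y, hy⟩)
        (fun e => hxy.ne (congrArg Subtype.val e)) ψ).mp (h ⟨x, hx⟩ ⟨y, hy⟩ hxy)
  have hmul : akltHamiltonian G Λ *ᵥ ψ = (1 / 2 : ℂ) •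
      ∑ x : Λ, ∑ y : Λ, if G.Adj x y then bondProjection G x y *ᵥ ψ else 0 := by
    rw [akltHamiltonian, Matrix.smul_mulVec, Matrix.sum_mulVec]
    congr 1
    refine Finset.sum_congr rfl fun x _ => ?_
    rw [Matrix.sum_mulVec]
    refine Finset.sum_congr rfl fun y _ => ?_
    split_ifs
    · rfl
    · exact Matrix.zero_mulVec _
  rw [key, hmul]
  constructor
  · intro h
    have h1 := congrArg (fun v => star ψ ⬝ᵥ v) h
    simp only [dotProduct_smul, dotProduct_sum, dotProduct_zero, smul_eq_zero] at h1
    have h2 := h1.resolve_left (by norm_num)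
    have hterm : ∀ x y : Λ, (star ψ ⬝ᵥ if G.Adj x y then bondProjection G x y *ᵥ ψ else 0) =
        if G.Adj x y then star (bondProjection G x y *ᵥ ψ) ⬝ᵥ (bondProjection G x y *ᵥ ψ) else 0 := by
      intro x y
      split_ifs
      · rw [Matrix.star_mulVec, ← Matrix.dotProduct_mulVec, Matrix.mulVec_mulVec,
          bondProjection_conjTranspose_mul_self]
      · simp
    simp only [hterm] at h2
    have hnn : ∀ x y : Λ, (0 : ℂ) ≤
        if G.Adj x y then star (bondProjection G x y *ᵥ ψ) ⬝ᵥ (bondProjection G x y *ᵥ ψ) else 0 := by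
      intro x y
      split_ifs
      · exact dotProduct_star_self_nonneg _
      · exact le_rfl
    rw [Finset.sum_eq_zero_iff_of_nonneg fun x _ => Finset.sum_nonneg fun y _ => hnn x y] at h2
    intro x y hxy
    have h3 := h2 x (Finset.mem_univ x)
    rw [Finset.sum_eq_zero_iff_of_nonneg fun y _ => hnn x y] at h3
    have h4 := h3 y (Finset.mem_univ y)
    rw [if_pos hxy] at h4
    exact dotProduct_star_self_eq_zero.mp h4
  · intro h
    rw [Finset.sum_eq_zero, smul_zero]
    intro x _
    refine Finset.sum_eq_zero fun y _ => ?_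
    split_ifs with hxy
    · exact h x y hxy
    · rfl

/-- The edges with both ends in `Λ`. -/
noncomputable def edgesIn (G : SimpleGraph W) (Λ : Finset W) : Finset (Sym2 W) :=
  Λ.sym2.filter (· ∈ G.edgeSet)

theorem mk_mem_edgesIn {x y : W} : s(x, y) ∈ edgesIn G Λ ↔ (x ∈ Λ ∧ y ∈ Λ) ∧ G.Adj x y := by
  rw [edgesIn, Finset.mem_filter, Finset.mk_mem_sym2_iff, SimpleGraph.mem_edgeSet]

/-- The polynomial of a singlet on the edge `e`. -/
noncomputable def edgePoly (e : Sym2 W) : MvPolynomial W ℂ :=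
  MvPolynomial.X (Quot.out e).1 - MvPolynomial.X (Quot.out e).2

theorem edgePoly_mk (x y : W) :
    edgePoly s(x, y) = MvPolynomial.X x - MvPolynomial.X y ∨
      edgePoly s(x, y) = -(MvPolynomial.X x - MvPolynomial.X y) := by
  have h : s((Quot.out s(x, y)).1, (Quot.out s(x, y)).2) = s(x, y) := Quot.out_eq _
  rw [Sym2.eq_iff] at h
  rcases h with ⟨h1, h2⟩ | ⟨h1, h2⟩
  · left; rw [edgePoly, h1, h2]
  · right; rw [edgePoly, h1, h2, neg_sub]

theorem edgePoly_dvd_iff (x y : W) (p : MvPolynomial W ℂ) :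
    edgePoly s(x, y) ∣ p ↔ (MvPolynomial.X x - MvPolynomial.X y) ∣ p := by
  rcases edgePoly_mk x y with h | h
  · rw [h]
  · rw [h, neg_dvd]

theorem X_sub_X_dvd_sub_rename (x y : W) (p : MvPolynomial W ℂ) :
    (MvPolynomial.X x - MvPolynomial.X y) ∣ p - MvPolynomial.rename (Function.update id x y) p := by
  induction p using MvPolynomial.induction_on with
  | C a => simp
  | add p q hp hq =>
    rw [map_add, add_sub_add_comm]
    exact dvd_add hp hq
  | mul_X p i hp =>
    rw [map_mul, MvPolynomial.rename_X]
    have : p * MvPolynomial.X i - MvPolynomial.rename (Function.update id x y) p *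
        MvPolynomial.X (Function.update id x y i) =
        (p - MvPolynomial.rename (Function.update id x y) p) * MvPolynomial.X i +
          MvPolynomial.rename (Function.update id x y) p *
            (MvPolynomial.X i - MvPolynomial.X (Function.update id x y i)) := by ring
    rw [this]
    refine dvd_add (hp.mul_right _) (Dvd.dvd.mul_left ?_ _)
    by_cases hi : i = x
    · subst hi; simp
    · rw [Function.update_of_ne hi]; simp

/-- Coprimality by substitution: putting X_x = X_y kills every multiple of X_x - X_y but none of the
forms of the other edges. Polynomials form a domain, so the remaining quotient q is killed, and q
differs from its substituted version by a multiple of X_x - X_y. -/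
theorem prod_edgePoly_dvd {s : Finset (Sym2 W)} (hs : ∀ e ∈ s, ¬ e.IsDiag) {p : MvPolynomial W ℂ}
    (h : ∀ e ∈ s, edgePoly e ∣ p) : ∏ e ∈ s, edgePoly e ∣ p := by
  induction s using Finset.induction_on with
  | empty => simp
  | insert e s he ih =>
    rw [Finset.prod_insert he]
    obtain ⟨q, hq⟩ := ih (fun f hf => hs f (Finset.mem_insert_of_mem hf))
      (fun f hf => h f (Finset.mem_insert_of_mem hf))
    rw [hq, mul_comm (edgePoly e)]
    refine mul_dvd_mul_left _ ?_
    have he1 := h e (Finset.mem_insert_self e s)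
    have hed := hs e (Finset.mem_insert_self e s)
    rw [hq] at he1
    induction e using Sym2.inductionOn with
    | hf x y =>
    rw [edgePoly_dvd_iff] at he1 ⊢
    rw [Sym2.mk_isDiag_iff] at hed
    set φ : W → W := Function.update id x y with hφ
    have hφx : φ x = y := by simp [hφ]
    have hφo : ∀ z, z ≠ x → φ z = z := fun z hz => by simp [hφ, Function.update_of_ne hz]
    have hzero : MvPolynomial.rename φ (∏ f ∈ s, edgePoly f) * MvPolynomial.rename φ q = 0 := by
      rw [← map_mul]
      obtain ⟨r, hr⟩ := he1
      rw [hr, map_mul, map_sub, MvPolynomial.rename_X, MvPolynomial.rename_X, hφx,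
        hφo y (Ne.symm hed), sub_self, zero_mul]
    have hne : MvPolynomial.rename φ (∏ f ∈ s, edgePoly f) ≠ 0 := by
      rw [map_prod, Finset.prod_ne_zero_iff]
      intro f hf
      have hfe : f ≠ s(x, y) := fun e => he (e ▸ hf)
      have hfd := hs f (Finset.mem_insert_of_mem hf)
      induction f using Sym2.inductionOn with
      | hf a b =>
      rw [Sym2.mk_isDiag_iff] at hfd
      have hab : φ a ≠ φ b := by
        intro hab
        rcases eq_or_ne a x with ha | ha <;> rcases eq_or_ne b x with hb | hb
        · exact hfd (ha.trans hb.symm)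
        · rw [ha, hφx, hφo b hb] at hab
          exact hfe (by rw [ha, hab])
        · rw [hb, hφx, hφo a ha] at hab
          exact hfe (by rw [hb, hab, Sym2.eq_swap])
        · rw [hφo a ha, hφo b hb] at hab
          exact hfd hab
      rcases edgePoly_mk a b with h1 | h1
      · rw [h1, map_sub, MvPolynomial.rename_X, MvPolynomial.rename_X]
        exact X_sub_X_ne_zero hab
      · rw [h1, map_neg, neg_ne_zero, map_sub, MvPolynomial.rename_X, MvPolynomial.rename_X]
        exact X_sub_X_ne_zero hab
    have hq0 := (mul_eq_zero.mp hzero).resolve_left hne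
    have := X_sub_X_dvd_sub_rename x y q
    rwa [← hφ, hq0, sub_zero] at this

theorem not_isDiag_of_mem_edgesIn {e : Sym2 W} (he : e ∈ edgesIn G Λ) : ¬ e.IsDiag :=
  G.not_isDiag_of_mem_edgeSet (Finset.mem_filter.mp he).2

theorem akltHamiltonian_mulVec_eq_zero_iff_prod_dvd (ψ : Config G Λ → ℂ) :
    akltHamiltonian G Λ *ᵥ ψ = 0 ↔ ∏ e ∈ edgesIn G Λ, edgePoly e ∣ polyOf ψ := by
  rw [akltHamiltonian_mulVec_eq_zero_iff]
  constructor
  · intro h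
    refine prod_edgePoly_dvd (fun e he => not_isDiag_of_mem_edgesIn he) fun e he => ?_
    induction e using Sym2.inductionOn with
    | hf x y =>
    rw [mk_mem_edgesIn] at he
    rw [edgePoly_dvd_iff]
    exact h x he.1.1 y he.1.2 he.2
  · intro h x hx y hy hxy
    rw [← edgePoly_dvd_iff]
    exact (Finset.dvd_prod_of_mem _ (mk_mem_edgesIn.mpr ⟨⟨hx, hy⟩, hxy⟩)).trans h

end Hamiltonian


/-! ### Expectations as functionals of polynomials in ket and bra variables -/

section StateFunctional

open scoped Classical ComplexOrder

variable {W : Type*} {G : SimpleGraph W} [G.LocallyFinite] {Λ : Finset W}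

/-- The exponent vector of a matrix unit, in the ket variables `Sum.inl x` and the bra variables
`Sum.inr x`. -/
noncomputable def expo₂ (σ τ : Config G Λ) : W ⊕ W →₀ ℕ := Finsupp.sumElim (expo σ) (expo τ)

/-- The expectation of the observable `A`, as a functional of a polynomial in ket and bra variables. -/
noncomputable def stateFun (A : LocalOp G Λ) : MvPolynomial (W ⊕ W) ℂ →ₗ[ℂ] ℂ where
  toFun P := ∑ σ, ∑ τ, A τ σ * (MvPolynomial.coeff (expo₂ σ τ) P / (configNorm σ * configNorm τ))
  map_add' P Q := by
    simp only [MvPolynomial.coeff_add, add_div, mul_add, Finset.sum_add_distrib]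
  map_smul' c P := by
    simp only [MvPolynomial.coeff_smul, smul_eq_mul, Finset.mul_sum, RingHom.id_apply]
    refine Finset.sum_congr rfl fun σ _ => Finset.sum_congr rfl fun τ _ => ?_
    ring

theorem stateFun_apply (A : LocalOp G Λ) (P : MvPolynomial (W ⊕ W) ℂ) : stateFun A P =
    ∑ σ, ∑ τ, A τ σ * (MvPolynomial.coeff (expo₂ σ τ) P / (configNorm σ * configNorm τ)) := rfl

/-- The polynomial `p(X) * conj p(Y)` in ket and bra variables. -/
noncomputable def doubled (p : MvPolynomial W ℂ) : MvPolynomial (W ⊕ W) ℂ :=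
  MvPolynomial.rename Sum.inl p *
    MvPolynomial.rename Sum.inr (MvPolynomial.map (starRingEnd ℂ) p)

theorem doubled_mul (p q : MvPolynomial W ℂ) : doubled (p * q) = doubled p * doubled q := by
  simp only [doubled, map_mul]
  ring

theorem doubled_one : doubled (1 : MvPolynomial W ℂ) = 1 := by simp [doubled]

theorem doubled_prod {ι : Type*} (s : Finset ι) (f : ι → MvPolynomial W ℂ) :
    doubled (∏ i ∈ s, f i) = ∏ i ∈ s, doubled (f i) := by
  induction s using Finset.induction_on with
  | empty => simp [doubled_one]
  | insert a s ha ih => rw [Finset.prod_insert ha, Finset.prod_insert ha, doubled_mul, ih]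

theorem doubled_neg (p : MvPolynomial W ℂ) : doubled (-p) = doubled p := by
  simp [doubled]

theorem doubled_C (c : ℂ) : doubled (MvPolynomial.C c : MvPolynomial W ℂ) =
    MvPolynomial.C (c * (starRingEnd ℂ) c) := by
  simp [doubled]

theorem doubled_X (x : W) : doubled (MvPolynomial.X x : MvPolynomial W ℂ) =
    MvPolynomial.X (Sum.inl x) * MvPolynomial.X (Sum.inr x) := by
  simp [doubled]

theorem sumElim_eq_mapDomain_add (e f : W →₀ ℕ) :
    Finsupp.sumElim e f = e.mapDomain Sum.inl + f.mapDomain Sum.inr := by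
  ext z
  rcases z with x | x
  · rw [Finsupp.sumElim_inl, Finsupp.add_apply, Finsupp.mapDomain_apply Sum.inl_injective,
      Finsupp.mapDomain_of_notMem_range _ _ (by simp), add_zero]
  · rw [Finsupp.sumElim_inr, Finsupp.add_apply, Finsupp.mapDomain_apply Sum.inr_injective,
      Finsupp.mapDomain_of_notMem_range _ _ (by simp), zero_add]

theorem sumElim_inj {e f e' f' : W →₀ ℕ} :
    Finsupp.sumElim e f = Finsupp.sumElim e' f' ↔ e = e' ∧ f = f' := by
  constructor
  · intro h
    constructor
    · ext x
      simpa using DFunLike.congr_fun h (Sum.inl x)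
    · ext x
      simpa using DFunLike.congr_fun h (Sum.inr x)
  · rintro ⟨rfl, rfl⟩
    rfl

theorem coeff_rename_inl_mul_rename_inr (p q : MvPolynomial W ℂ) (e f : W →₀ ℕ) :
    MvPolynomial.coeff (Finsupp.sumElim e f)
      (MvPolynomial.rename Sum.inl p * MvPolynomial.rename Sum.inr q) =
      MvPolynomial.coeff e p * MvPolynomial.coeff f q := by
  induction p using MvPolynomial.induction_on' with
  | add p p' hp hp' => simp only [map_add, add_mul, MvPolynomial.coeff_add, hp, hp']
  | monomial a r =>
    induction q using MvPolynomial.induction_on' with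
    | add p p' hp hp' => simp only [map_add, mul_add, MvPolynomial.coeff_add, hp, hp']
    | monomial b s =>
      rw [MvPolynomial.rename_monomial, MvPolynomial.rename_monomial, MvPolynomial.monomial_mul,
        ← sumElim_eq_mapDomain_add, MvPolynomial.coeff_monomial, MvPolynomial.coeff_monomial,
        MvPolynomial.coeff_monomial]
      by_cases ha : a = e <;> by_cases hb : b = f <;> simp [sumElim_inj, ha, hb]

/-- The configuration which extends `σ` by the value `k` at the new site `y`. -/
noncomputable def consConfig (y : W) (σ : Config G Λ) (k : Fin (G.degree y + 1)) :
    Config G (insert y Λ) := fun z =>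
  if h : (z : W) = y then ⟨k, by rw [h]; exact k.is_lt⟩
  else σ ⟨z, (Finset.mem_insert.mp z.2).resolve_left h⟩

theorem consConfig_self (y : W) (σ : Config G Λ) (k : Fin (G.degree y + 1)) :
    consConfig y σ k ⟨y, Finset.mem_insert_self y Λ⟩ = k := by
  simp [consConfig]

theorem consConfig_of_mem {y : W} (hy : y ∉ Λ) (σ : Config G Λ) (k : Fin (G.degree y + 1)) (x : Λ) :
    consConfig y σ k ⟨x, Finset.mem_insert_of_mem x.2⟩ = σ x := by
  have : (x : W) ≠ y := fun h => hy (h ▸ x.2)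
  simp [consConfig, this]

/-- Configurations on `insert y Λ` are pairs of a configuration on `Λ` and a value at `y`. -/
noncomputable def consConfigEquiv {y : W} (hy : y ∉ Λ) :
    Config G Λ × Fin (G.degree y + 1) ≃ Config G (insert y Λ) where
  toFun p := consConfig y p.1 p.2
  invFun σ := (fun x => σ ⟨x, Finset.mem_insert_of_mem x.2⟩, σ ⟨y, Finset.mem_insert_self y Λ⟩)
  left_inv p := by
    refine Prod.ext ?_ (consConfig_self y p.1 p.2)
    funext x
    exact consConfig_of_mem hy p.1 p.2 x
  right_inv σ := by
    funext ⟨z, hz⟩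
    by_cases h : z = y
    · subst h
      exact consConfig_self _ _ _
    · have hz' : z ∈ Λ := (Finset.mem_insert.mp hz).resolve_left h
      exact consConfig_of_mem hy _ _ ⟨z, hz'⟩

theorem expo_consConfig {y : W} (hy : y ∉ Λ) (σ : Config G Λ) (k : Fin (G.degree y + 1)) :
    expo (consConfig y σ k) = Finsupp.single y (k : ℕ) + expo σ := by
  ext z
  rw [Finsupp.add_apply]
  by_cases h : z = y
  · subst h
    rw [expo_apply (consConfig z σ k) ⟨z, Finset.mem_insert_self z Λ⟩, consConfig_self,
      expo_apply_of_notMem _ hy]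
    simp
  · rw [Finsupp.single_apply, if_neg (Ne.symm h), zero_add]
    by_cases hz : z ∈ Λ
    · rw [expo_apply (consConfig y σ k) ⟨z, Finset.mem_insert_of_mem hz⟩, expo_apply σ ⟨z, hz⟩]
      exact congrArg Fin.val (consConfig_of_mem hy σ k ⟨z, hz⟩)
    · rw [expo_apply_of_notMem _ hz, expo_apply_of_notMem]
      simp [h, hz]

theorem configNorm_consConfig {y : W} (hy : y ∉ Λ) (σ : Config G Λ) (k : Fin (G.degree y + 1)) :
    configNorm (consConfig y σ k) = Real.sqrt ((G.degree y).choose k : ℝ) * configNorm σ := by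
  have h1 : ∀ (Λ' : Finset W) (ρ : Config G Λ'), configNorm ρ =
      ∏ x ∈ Λ', Real.sqrt ((G.degree x).choose (expo ρ x) : ℝ) := by
    intro Λ' ρ
    rw [configNorm, ← Finset.prod_coe_sort Λ'
      (fun x => Real.sqrt ((G.degree x).choose (expo ρ x) : ℝ))]
    refine Finset.prod_congr rfl fun x _ => ?_
    rw [expo_apply]
  rw [h1, h1, Finset.prod_insert hy, expo_consConfig hy]
  congr 1
  · simp [expo_apply_of_notMem σ hy]
  · refine Finset.prod_congr rfl fun x hx => ?_
    have : y ≠ x := fun h => hy (h ▸ hx)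
    simp [this]

theorem extendOp_consConfig {y : W} (hy : y ∉ Λ) (A : LocalOp G Λ) (σ τ : Config G Λ)
    (k l : Fin (G.degree y + 1)) :
    extendOp G (Finset.subset_insert y Λ) A (consConfig y σ k) (consConfig y τ l) =
      if k = l then A σ τ else 0 := by
  simp only [extendOp, Matrix.of_apply, consConfig_of_mem hy]
  congr 1
  rw [eq_iff_iff]
  constructor
  · intro h
    have := h ⟨y, Finset.mem_insert_self y Λ⟩ hy
    simpa [consConfig_self] using this
  · rintro rfl ⟨z, hz⟩ hzΛ
    have hzy : z = y := (Finset.mem_insert.mp hz).resolve_right hzΛ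
    subst hzy
    rw [consConfig_self, consConfig_self]

/-- The exponent vector of `X_y ^ k * Y_y ^ l`. -/
noncomputable def siteExpo (y : W) (k l : ℕ) : W ⊕ W →₀ ℕ :=
  Finsupp.single (Sum.inl y) k + Finsupp.single (Sum.inr y) l

theorem expo₂_consConfig {y : W} (hy : y ∉ Λ) (σ τ : Config G Λ) (k l : Fin (G.degree y + 1)) :
    expo₂ (consConfig y σ k) (consConfig y τ l) = siteExpo y k l + expo₂ σ τ := by
  rw [expo₂, expo₂, siteExpo, expo_consConfig hy, expo_consConfig hy, sumElim_eq_mapDomain_add,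
    sumElim_eq_mapDomain_add, Finsupp.mapDomain_add, Finsupp.mapDomain_add, Finsupp.mapDomain_single,
    Finsupp.mapDomain_single]
  abel

/-- Tracing out the site `y`. -/
theorem stateFun_extendOp_insert {y : W} (hy : y ∉ Λ) (A : LocalOp G Λ)
    (P : MvPolynomial (W ⊕ W) ℂ) :
    stateFun (extendOp G (Finset.subset_insert y Λ) A) P =
      ∑ k ∈ Finset.range (G.degree y + 1), ((G.degree y).choose k : ℂ)⁻¹ *
        stateFun A (P.divMonomial (siteExpo y k k)) := by
  rw [Finset.sum_range (fun k => ((G.degree y).choose k : ℂ)⁻¹ *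
        stateFun A (P.divMonomial (siteExpo y k k))), stateFun_apply,
    ← (consConfigEquiv (G := G) hy).sum_comp, Fintype.sum_prod_type_right]
  refine Finset.sum_congr rfl fun k _ => ?_
  rw [stateFun_apply, Finset.mul_sum]
  refine Finset.sum_congr rfl fun σ _ => ?_
  rw [← (consConfigEquiv (G := G) hy).sum_comp, Fintype.sum_prod_type, Finset.mul_sum]
  refine Finset.sum_congr rfl fun τ _ => ?_
  simp only [consConfigEquiv, Equiv.coe_fn_mk, extendOp_consConfig hy, expo₂_consConfig hy,
    configNorm_consConfig hy, ite_mul, zero_mul]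
  rw [Finset.sum_ite_eq' Finset.univ k, if_pos (Finset.mem_univ k), MvPolynomial.coeff_divMonomial]
  have h1 := configNorm_ne_zero σ
  have h2 := configNorm_ne_zero τ
  have h3 : ((G.degree y).choose k : ℂ) =
      ((Real.sqrt ((G.degree y).choose k : ℝ) : ℝ) : ℂ) *
        ((Real.sqrt ((G.degree y).choose k : ℝ) : ℝ) : ℂ) := by
    rw [ofReal_sqrt_mul_self (by positivity)]
    simp
  rw [h3]
  push_cast
  rw [mul_inv]
  field_simp

theorem extendOp_extendOp {Λ₀ Λ₁ Λ₂ : Finset W} (h₀ : Λ₀ ⊆ Λ₁) (h₁ : Λ₁ ⊆ Λ₂) (A : LocalOp G Λ₀) :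
    extendOp G h₁ (extendOp G h₀ A) = extendOp G (h₀.trans h₁) A := by
  ext σ τ
  simp only [extendOp, Matrix.of_apply]
  by_cases h : ∀ y : Λ₂, (y : W) ∉ Λ₀ → σ y = τ y
  · rw [if_pos h, if_pos fun y hy => h y fun hy' => hy (h₀ hy'), if_pos]
    intro y hy
    exact h ⟨y, h₁ y.2⟩ hy
  · rw [if_neg h]
    split_ifs with h2 h3
    · exfalso
      refine h fun y hy => ?_
      by_cases hy1 : (y : W) ∈ Λ₁
      · exact h3 ⟨y, hy1⟩ hy
      · exact h2 y hy1
    · rfl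
    · rfl

theorem extendOp_self (A : LocalOp G Λ) : extendOp G (subset_refl Λ) A = A := by
  ext σ τ
  simp only [extendOp, Matrix.of_apply]
  rw [if_pos fun y hy => absurd y.2 hy]

theorem extendOp_one {Λ' : Finset W} (h : Λ ⊆ Λ') : extendOp G h (1 : LocalOp G Λ) = 1 := by
  ext σ τ
  simp only [extendOp, Matrix.of_apply, Matrix.one_apply]
  by_cases hst : σ = τ
  · subst hst; simp
  · rw [if_neg hst]
    split_ifs with h1 h2
    · exfalso
      refine hst (funext fun y => ?_)
      by_cases hy : (y : W) ∈ Λ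
      · exact congrFun h2 ⟨y, hy⟩
      · exact h1 y hy
    · rfl
    · rfl

end StateFunctional


/-! ### A single site with product boundary conditions -/

/-- The exponent vector of `X ^ k * Y ^ l`. -/
noncomputable def pairExpo (k l : ℕ) : Fin 2 →₀ ℕ := Finsupp.single 0 k + Finsupp.single 1 l

theorem pairExpo_apply_zero (k l : ℕ) : pairExpo k l 0 = k := by simp [pairExpo]

theorem pairExpo_apply_one (k l : ℕ) : pairExpo k l 1 = l := by simp [pairExpo]

theorem eq_pairExpo (e : Fin 2 →₀ ℕ) : e = pairExpo (e 0) (e 1) := by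
  ext i
  fin_cases i
  · exact (pairExpo_apply_zero _ _).symm
  · exact (pairExpo_apply_one _ _).symm

theorem pairExpo_inj {k l k' l' : ℕ} : pairExpo k l = pairExpo k' l' ↔ k = k' ∧ l = l' := by
  constructor
  · intro h
    have h0 := DFunLike.congr_fun h 0
    have h1 := DFunLike.congr_fun h 1
    rw [pairExpo_apply_zero, pairExpo_apply_zero] at h0
    rw [pairExpo_apply_one, pairExpo_apply_one] at h1
    exact ⟨h0, h1⟩
  · rintro ⟨rfl, rfl⟩
    rfl

/-- The trace of a spin `m / 2`, as a functional of polynomials in a ket variable `X 0` and a bra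
variable `X 1`. -/
noncomputable def siteFun (m : ℕ) : MvPolynomial (Fin 2) ℂ →ₗ[ℂ] ℂ where
  toFun h := ∑ k ∈ Finset.range (m + 1), (m.choose k : ℂ)⁻¹ * MvPolynomial.coeff (pairExpo k k) h
  map_add' p q := by simp only [MvPolynomial.coeff_add, mul_add, Finset.sum_add_distrib]
  map_smul' c p := by
    simp only [MvPolynomial.coeff_smul, smul_eq_mul, Finset.mul_sum, RingHom.id_apply]
    refine Finset.sum_congr rfl fun k _ => ?_
    ring

theorem siteFun_apply (m : ℕ) (h : MvPolynomial (Fin 2) ℂ) : siteFun m h =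
    ∑ k ∈ Finset.range (m + 1), (m.choose k : ℂ)⁻¹ * MvPolynomial.coeff (pairExpo k k) h := rfl

/-- The polynomial of a leg with the boundary condition `Q`. -/
noncomputable def legPoly (Q : Matrix (Fin 2) (Fin 2) ℂ) : MvPolynomial (Fin 2) ℂ :=
  MvPolynomial.C (Q 0 0) - MvPolynomial.C (Q 0 1) * MvPolynomial.X 1 -
    MvPolynomial.C (Q 1 0) * MvPolynomial.X 0 +
    MvPolynomial.C (Q 1 1) * (MvPolynomial.X 0 * MvPolynomial.X 1)

theorem legPoly_add (Q R : Matrix (Fin 2) (Fin 2) ℂ) : legPoly (Q + R) = legPoly Q + legPoly R := by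
  simp only [legPoly, Matrix.add_apply, map_add]
  ring

theorem legPoly_smul (c : ℂ) (Q : Matrix (Fin 2) (Fin 2) ℂ) :
    legPoly (c • Q) = MvPolynomial.C c * legPoly Q := by
  simp only [legPoly, Matrix.smul_apply, smul_eq_mul, map_mul]
  ring

/-- The unnormalized outgoing boundary condition of a site of degree `m`, with the product `h` of the
polynomials of its other legs. -/
noncomputable def outgoing (m : ℕ) (h : MvPolynomial (Fin 2) ℂ) : Matrix (Fin 2) (Fin 2) ℂ :=
  !![siteFun m (MvPolynomial.X 0 * MvPolynomial.X 1 * h), siteFun m (MvPolynomial.X 0 * h);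
    siteFun m (MvPolynomial.X 1 * h), siteFun m h]

/-! ### Valence bond states and the trace over a leaf -/

section Peel

open scoped Classical ComplexOrder

variable {W : Type*} {G : SimpleGraph W} [G.LocallyFinite] {Λ : Finset W}

/-- The polynomial `h`, in the ket and bra variables of the site `y`. -/
noncomputable def atSite (y : W) : MvPolynomial (Fin 2) ℂ →ₐ[ℂ] MvPolynomial (W ⊕ W) ℂ :=
  MvPolynomial.rename ![Sum.inl y, Sum.inr y]

theorem atSite_monomial (y : W) (d : Fin 2 →₀ ℕ) (r : ℂ) :
    atSite y (MvPolynomial.monomial d r) = MvPolynomial.monomial (siteExpo y (d 0) (d 1)) r := by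
  rw [atSite, MvPolynomial.rename_monomial]
  congr 1
  conv_lhs => rw [eq_pairExpo d]
  rw [pairExpo, Finsupp.mapDomain_add, Finsupp.mapDomain_single, Finsupp.mapDomain_single]
  rfl

theorem atSite_C (y : W) (c : ℂ) : atSite y (MvPolynomial.C c) = MvPolynomial.C c :=
  MvPolynomial.rename_C _ _

theorem atSite_X_zero (y : W) : atSite y (MvPolynomial.X 0) = MvPolynomial.X (Sum.inl y) :=
  MvPolynomial.rename_X _ _

theorem atSite_X_one (y : W) : atSite y (MvPolynomial.X 1) = MvPolynomial.X (Sum.inr y) :=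
  MvPolynomial.rename_X _ _

/-- The variables other than those of the site `y`. -/
def varsAway (y : W) : Set (W ⊕ W) := {z | z ≠ Sum.inl y ∧ z ≠ Sum.inr y}

theorem coeff_eq_zero_of_mem_supported {y : W} {F : MvPolynomial (W ⊕ W) ℂ}
    (hF : F ∈ MvPolynomial.supported ℂ (varsAway y)) {e : W ⊕ W →₀ ℕ}
    (he : e (Sum.inl y) ≠ 0 ∨ e (Sum.inr y) ≠ 0) : MvPolynomial.coeff e F = 0 := by
  by_contra hne
  rw [MvPolynomial.mem_supported] at hF
  rcases he with he | he
  · exact (hF (Finset.mem_coe.mpr ((MvPolynomial.mem_vars_iff_mem_support _).mpr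
      ⟨e, MvPolynomial.mem_support_iff.mpr hne, Finsupp.mem_support_iff.mpr he⟩))).1 rfl
  · exact (hF (Finset.mem_coe.mpr ((MvPolynomial.mem_vars_iff_mem_support _).mpr
      ⟨e, MvPolynomial.mem_support_iff.mpr hne, Finsupp.mem_support_iff.mpr he⟩))).2 rfl

theorem siteExpo_apply_inl (y : W) (k l : ℕ) : siteExpo y k l (Sum.inl y) = k := by
  simp [siteExpo]

theorem siteExpo_apply_inr (y : W) (k l : ℕ) : siteExpo y k l (Sum.inr y) = l := by
  simp [siteExpo]

theorem coeff_mul_atSite {y : W} {F : MvPolynomial (W ⊕ W) ℂ}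
    (hF : F ∈ MvPolynomial.supported ℂ (varsAway y)) (h : MvPolynomial (Fin 2) ℂ)
    {e : W ⊕ W →₀ ℕ} (he : e (Sum.inl y) = 0 ∧ e (Sum.inr y) = 0) (k l : ℕ) :
    MvPolynomial.coeff (siteExpo y k l + e) (F * atSite y h) =
      MvPolynomial.coeff e F * MvPolynomial.coeff (pairExpo k l) h := by
  induction h using MvPolynomial.induction_on' with
  | add p q hp hq => rw [map_add, mul_add, MvPolynomial.coeff_add, hp, hq, MvPolynomial.coeff_add,
      mul_add]
  | monomial d r =>
    rw [atSite_monomial, MvPolynomial.coeff_mul_monomial', MvPolynomial.coeff_monomial]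
    by_cases hd : d = pairExpo k l
    · rw [if_pos hd, hd, pairExpo_apply_zero, pairExpo_apply_one, if_pos le_self_add,
        add_tsub_cancel_left]
    · rw [if_neg hd, mul_zero]
      split_ifs with hle
      · rw [coeff_eq_zero_of_mem_supported hF, zero_mul]
        by_contra hcon
        push Not at hcon
        have h0 := hle (Sum.inl y)
        have h1 := hle (Sum.inr y)
        simp only [Finsupp.tsub_apply, Finsupp.add_apply, siteExpo_apply_inl, siteExpo_apply_inr,
          he.1, he.2, add_zero] at hcon h0 h1
        refine hd ?_
        rw [eq_pairExpo d, pairExpo_inj]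
        omega
      · rfl

theorem expo₂_apply_notMem {y : W} (hy : y ∉ Λ) (σ τ : Config G Λ) :
    expo₂ σ τ (Sum.inl y) = 0 ∧ expo₂ σ τ (Sum.inr y) = 0 := by
  rw [expo₂, Finsupp.sumElim_inl, Finsupp.sumElim_inr, expo_apply_of_notMem _ hy,
    expo_apply_of_notMem _ hy]
  exact ⟨rfl, rfl⟩

/-- The factor F does not contain the variables of y, so coefficients of the product factorize, and
the sum over the states of y acts on h alone. -/
theorem stateFun_insert_mul_atSite {y : W} (hy : y ∉ Λ) (A : LocalOp G Λ)
    {F : MvPolynomial (W ⊕ W) ℂ} (hF : F ∈ MvPolynomial.supported ℂ (varsAway y))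
    (h : MvPolynomial (Fin 2) ℂ) :
    stateFun (extendOp G (Finset.subset_insert y Λ) A) (F * atSite y h) =
      stateFun A F * siteFun (G.degree y) h := by
  rw [stateFun_extendOp_insert hy, siteFun_apply, Finset.mul_sum]
  refine Finset.sum_congr rfl fun k _ => ?_
  simp only [stateFun_apply, MvPolynomial.coeff_divMonomial,
    coeff_mul_atSite hF h (expo₂_apply_notMem hy _ _), Finset.mul_sum, Finset.sum_mul]
  refine Finset.sum_congr rfl fun σ _ => Finset.sum_congr rfl fun τ _ => ?_
  ring

/-- The product of the polynomials of the legs which leave `Λ`; the leg from `x ∈ Λ` to `y ∉ Λ` has the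
boundary condition `Q y x`. -/
noncomputable def legProduct (G : SimpleGraph W) [G.LocallyFinite] (Λ : Finset W)
    (Q : W → W → Matrix (Fin 2) (Fin 2) ℂ) : MvPolynomial (W ⊕ W) ℂ :=
  ∏ x ∈ Λ, ∏ y ∈ G.neighborFinset x \ Λ, atSite x (legPoly (Q y x))

/-- The polynomial of the valence bond state on `Λ` with the boundary condition `Q`. -/
noncomputable def vbsPoly (G : SimpleGraph W) [G.LocallyFinite] (Λ : Finset W)
    (Q : W → W → Matrix (Fin 2) (Fin 2) ℂ) : MvPolynomial (W ⊕ W) ℂ :=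
  doubled (∏ e ∈ edgesIn G Λ, edgePoly e) * legProduct G Λ Q

theorem doubled_edgePoly (x y : W) : doubled (edgePoly s(x, y)) =
    (MvPolynomial.X (Sum.inl x) - MvPolynomial.X (Sum.inl y)) *
      (MvPolynomial.X (Sum.inr x) - MvPolynomial.X (Sum.inr y)) := by
  rcases edgePoly_mk x y with h | h
  · rw [h]; simp [doubled]
  · rw [h, doubled_neg]; simp [doubled]

theorem X_mem_varsAway {x y : W} (h : x ≠ y) :
    (MvPolynomial.X (Sum.inl x) : MvPolynomial (W ⊕ W) ℂ) ∈ MvPolynomial.supported ℂ (varsAway y) ∧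
      (MvPolynomial.X (Sum.inr x) : MvPolynomial (W ⊕ W) ℂ) ∈
        MvPolynomial.supported ℂ (varsAway y) := by
  constructor
  · rw [MvPolynomial.X_mem_supported]
    exact ⟨fun h' => h (Sum.inl_injective h'), Sum.inl_ne_inr⟩
  · rw [MvPolynomial.X_mem_supported]
    exact ⟨Sum.inr_ne_inl, fun h' => h (Sum.inr_injective h')⟩

theorem atSite_mem_supported {x y : W} (h : x ≠ y) (p : MvPolynomial (Fin 2) ℂ) :
    atSite x p ∈ MvPolynomial.supported ℂ (varsAway y) := by
  induction p using MvPolynomial.induction_on with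
  | C a =>
    rw [atSite_C]
    exact Subalgebra.algebraMap_mem _ a
  | add p q hp hq =>
    rw [map_add]
    exact add_mem hp hq
  | mul_X p i hp =>
    rw [map_mul]
    refine mul_mem hp ?_
    fin_cases i
    · exact (atSite_X_zero x).symm ▸ (X_mem_varsAway h).1
    · exact (atSite_X_one x).symm ▸ (X_mem_varsAway h).2

theorem doubled_prod_edgePoly_mem_supported {y : W} (hy : y ∉ Λ) :
    doubled (∏ e ∈ edgesIn G Λ, edgePoly e) ∈ MvPolynomial.supported ℂ (varsAway y) := by
  rw [doubled_prod]
  refine prod_mem fun e he => ?_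
  induction e using Sym2.inductionOn with
  | hf a b =>
  rw [mk_mem_edgesIn] at he
  have ha : a ≠ y := fun h => hy (h ▸ he.1.1)
  have hb : b ≠ y := fun h => hy (h ▸ he.1.2)
  rw [doubled_edgePoly]
  exact mul_mem (sub_mem (X_mem_varsAway ha).1 (X_mem_varsAway hb).1)
    (sub_mem (X_mem_varsAway ha).2 (X_mem_varsAway hb).2)

theorem edgesIn_insert {x y : W} (hy : y ∉ Λ) (hx : x ∈ Λ) (hxy : G.Adj x y)
    (huniq : ∀ z ∈ Λ, G.Adj z y → z = x) :
    edgesIn G (insert y Λ) = insert s(x, y) (edgesIn G Λ) := by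
  ext e
  induction e using Sym2.inductionOn with
  | hf a b =>
  simp only [mk_mem_edgesIn, Finset.mem_insert, Sym2.eq_iff]
  constructor
  · rintro ⟨⟨rfl | ha, rfl | hb⟩, hab⟩
    · exact absurd rfl hab.ne
    · exact Or.inl (Or.inr ⟨rfl, huniq b hb hab.symm⟩)
    · exact Or.inl (Or.inl ⟨huniq a ha hab, rfl⟩)
    · exact Or.inr ⟨⟨ha, hb⟩, hab⟩
  · rintro ((⟨rfl, rfl⟩ | ⟨rfl, rfl⟩) | ⟨⟨ha, hb⟩, hab⟩)
    · exact ⟨⟨Or.inr hx, Or.inl rfl⟩, hxy⟩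
    · exact ⟨⟨Or.inl rfl, Or.inr hx⟩, hxy.symm⟩
    · exact ⟨⟨Or.inr ha, Or.inr hb⟩, hab⟩

/-- The partial trace of a valence bond state over a leaf is a valence bond state. -/
theorem stateFun_vbsPoly_insert {x y : W} (hy : y ∉ Λ) (hx : x ∈ Λ) (hxy : G.Adj x y)
    (huniq : ∀ z ∈ Λ, G.Adj z y → z = x) {Q : W → W → Matrix (Fin 2) (Fin 2) ℂ} {c : ℂ}
    (hQ : outgoing (G.degree y) (∏ z ∈ (G.neighborFinset y).erase x, legPoly (Q z y)) = c • Q y x)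
    (A : LocalOp G Λ) :
    stateFun (extendOp G (Finset.subset_insert y Λ) A) (vbsPoly G (insert y Λ) Q) =
      c * stateFun A (vbsPoly G Λ Q) := by
  obtain ⟨h, hh⟩ : ∃ h, h = ∏ z ∈ (G.neighborFinset y).erase x, legPoly (Q z y) := ⟨_, rfl⟩
  obtain ⟨F, hFdef⟩ : ∃ F, F = doubled (∏ e ∈ edgesIn G Λ, edgePoly e) *
    ∏ z ∈ Λ, ∏ w ∈ G.neighborFinset z \ insert y Λ, atSite z (legPoly (Q w z)) := ⟨_, rfl⟩
  rw [← hh] at hQ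
  have hxy' : x ≠ y := hxy.ne
  have hF : F ∈ MvPolynomial.supported ℂ (varsAway y) := by
    rw [hFdef]
    refine mul_mem (doubled_prod_edgePoly_mem_supported hy) (prod_mem fun z hz => prod_mem fun w _ => ?_)
    have hzy : z ≠ y := fun e => hy (e ▸ hz)
    exact atSite_mem_supported hzy _
  have h1 : vbsPoly G (insert y Λ) Q = F *
      ((MvPolynomial.X (Sum.inl x) - MvPolynomial.X (Sum.inl y)) *
      (MvPolynomial.X (Sum.inr x) - MvPolynomial.X (Sum.inr y))) * atSite y h := by
    have hnot : s(x, y) ∉ edgesIn G Λ := fun hmem => hy (mk_mem_edgesIn.mp hmem).1.2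
    have hset : G.neighborFinset y \ insert y Λ = (G.neighborFinset y).erase x := by
      ext z
      simp only [Finset.mem_sdiff, SimpleGraph.mem_neighborFinset, Finset.mem_insert, not_or,
        Finset.mem_erase]
      constructor
      · rintro ⟨hz, -, hz'⟩
        exact ⟨fun e => hz' (e ▸ hx), hz⟩
      · rintro ⟨hz, hz'⟩
        exact ⟨hz', hz'.ne', fun hmem => hz (huniq z hmem hz'.symm)⟩
    rw [vbsPoly, edgesIn_insert hy hx hxy huniq, Finset.prod_insert hnot, doubled_mul,
      doubled_edgePoly, legProduct, Finset.prod_insert hy, hset, hFdef, hh, map_prod]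
    generalize doubled (∏ e ∈ edgesIn G Λ, edgePoly e) = E
    ring
  have h2 : vbsPoly G Λ Q = F * atSite x (legPoly (Q y x)) := by
    rw [vbsPoly, hFdef, mul_assoc]
    congr 1
    have hset : G.neighborFinset x \ Λ = insert y (G.neighborFinset x \ insert y Λ) := by
      ext z
      simp only [Finset.mem_sdiff, SimpleGraph.mem_neighborFinset, Finset.mem_insert, not_or]
      constructor
      · rintro ⟨hz, hz'⟩
        by_cases hzy : z = y
        · exact Or.inl hzy
        · exact Or.inr ⟨hz, hzy, hz'⟩
      · rintro (rfl | ⟨hz, -, hz'⟩)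
        · exact ⟨hxy, hy⟩
        · exact ⟨hz, hz'⟩
    have hrest : ∏ z ∈ Λ.erase x, ∏ w ∈ G.neighborFinset z \ Λ, atSite z (legPoly (Q w z)) =
        ∏ z ∈ Λ.erase x, ∏ w ∈ G.neighborFinset z \ insert y Λ, atSite z (legPoly (Q w z)) := by
      refine Finset.prod_congr rfl fun z hz => Finset.prod_congr ?_ fun _ _ => rfl
      ext w
      simp only [Finset.mem_sdiff, SimpleGraph.mem_neighborFinset, Finset.mem_insert, not_or]
      refine and_congr_right fun hzw => ⟨fun hw => ⟨?_, hw⟩, And.right⟩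
      rintro rfl
      exact (Finset.mem_erase.mp hz).1 (huniq z (Finset.mem_erase.mp hz).2 hzw)
    rw [legProduct, ← Finset.prod_erase_mul _ _ hx, ← Finset.prod_erase_mul Λ (fun z =>
      ∏ w ∈ G.neighborFinset z \ insert y Λ, atSite z (legPoly (Q w z))) hx, hrest, hset,
      Finset.prod_insert (by simp), mul_assoc, mul_comm (atSite x (legPoly (Q y x)))]
  have hprod := fun (F' : MvPolynomial (W ⊕ W) ℂ) (hF' : F' ∈ MvPolynomial.supported ℂ (varsAway y))
    h' => stateFun_insert_mul_atSite hy A hF' h'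
  have hxX := (X_mem_varsAway hxy').1
  have hxY := (X_mem_varsAway hxy').2
  -- Expanding the form of the edge xy separates the variables of x from those of y. The four terms,
  -- with their signs, correspond to the four entries of `outgoing` as they enter `legPoly` at x.
  have h3 : vbsPoly G (insert y Λ) Q =
      F * (MvPolynomial.X (Sum.inl x) * MvPolynomial.X (Sum.inr x)) * atSite y h
      - F * MvPolynomial.X (Sum.inr x) * atSite y (MvPolynomial.X 0 * h)
      - F * MvPolynomial.X (Sum.inl x) * atSite y (MvPolynomial.X 1 * h)
      + F * atSite y (MvPolynomial.X 0 * MvPolynomial.X 1 * h) := by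
    rw [h1]
    simp only [map_mul, atSite_X_zero, atSite_X_one]
    ring
  have h4 : c • vbsPoly G Λ Q = F * atSite x (legPoly (c • Q y x)) := by
    rw [h2, legPoly_smul, map_mul, atSite_C, MvPolynomial.smul_eq_C_mul]
    ring
  rw [← smul_eq_mul, ← map_smul, h4, ← hQ, h3, map_add, map_sub, map_sub,
    hprod _ (mul_mem hF (mul_mem hxX hxY)), hprod _ (mul_mem hF hxY), hprod _ (mul_mem hF hxX),
    hprod _ hF]
  simp only [legPoly, outgoing, Matrix.of_apply, Matrix.cons_val', Matrix.cons_val_zero,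
    Matrix.cons_val_one, Matrix.cons_val_fin_one, map_add, map_sub, map_mul, atSite_C, atSite_X_zero,
    atSite_X_one, mul_add, mul_sub]
  have hC : ∀ (r : ℂ) (P : MvPolynomial (W ⊕ W) ℂ),
      stateFun A (F * (MvPolynomial.C r * P)) = r * stateFun A (F * P) := by
    intro r P
    rw [mul_left_comm, ← MvPolynomial.smul_eq_C_mul, map_smul, smul_eq_mul]
  have hC' : ∀ r : ℂ, stateFun A (F * MvPolynomial.C r) = r * stateFun A F := by
    intro r
    rw [mul_comm, ← MvPolynomial.smul_eq_C_mul, map_smul, smul_eq_mul]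
  simp only [hC, hC']
  ring

end Peel


/-! ### Recursions for the trace over one spin -/

section SiteMoments

open scoped Classical

theorem siteFun_monomial (m : ℕ) (d : Fin 2 →₀ ℕ) (r : ℂ) :
    siteFun m (MvPolynomial.monomial d r) =
      if d 0 = d 1 ∧ d 0 ≤ m then (m.choose (d 0) : ℂ)⁻¹ * r else 0 := by
  rw [siteFun_apply]
  split_ifs with h
  · rw [Finset.sum_eq_single (d 0)]
    · rw [MvPolynomial.coeff_monomial, if_pos]
      conv_lhs => rw [eq_pairExpo d, ← h.1]
    · intro k _ hk
      rw [MvPolynomial.coeff_monomial, if_neg, mul_zero]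
      intro h'
      rw [eq_pairExpo d, pairExpo_inj] at h'
      exact hk h'.1.symm
    · intro h'
      exact absurd (Finset.mem_range.mpr (by omega)) h'
  · refine Finset.sum_eq_zero fun k hk => ?_
    rw [MvPolynomial.coeff_monomial, if_neg, mul_zero]
    intro h'
    rw [eq_pairExpo d, pairExpo_inj] at h'
    rw [Finset.mem_range] at hk
    exact h ⟨by omega, by omega⟩

theorem succ_mul_choose_inv {n j : ℕ} (hj : j ≤ n) :
    ((n : ℂ) + 1) * (((n + 1).choose (j + 1) : ℕ) : ℂ)⁻¹ =
      ((n.choose j : ℕ) : ℂ)⁻¹ * ((j : ℂ) + 1) := by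
  have h := Nat.add_one_mul_choose_eq n j
  have h1 : ((n : ℂ) + 1) * (n.choose j : ℂ) = ((n + 1).choose (j + 1) : ℂ) * ((j : ℂ) + 1) := by
    exact_mod_cast h
  have h2 : (n.choose j : ℂ) ≠ 0 := by exact_mod_cast (Nat.choose_pos hj).ne'
  have h3 : (((n + 1).choose (j + 1) : ℕ) : ℂ) ≠ 0 := by
    exact_mod_cast (Nat.choose_pos (by omega)).ne'
  field_simp
  linear_combination h1

theorem succ_mul_choose_inv' {n j : ℕ} (hj : j ≤ n) :
    ((n : ℂ) + 1) * (((n + 1).choose j : ℕ) : ℂ)⁻¹ =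
      ((n.choose j : ℕ) : ℂ)⁻¹ * ((n : ℂ) + 1 - j) := by
  have h := succ_mul_choose_inv (n := n) (j := n - j) (by omega)
  rw [Nat.choose_symm hj] at h
  have : (n + 1).choose (n - j + 1) = (n + 1).choose j := by
    rw [← Nat.choose_symm (show j ≤ n + 1 by omega)]
    congr 1
    omega
  rw [this, Nat.cast_sub hj] at h
  rw [h]
  ring

theorem monomial_mul_X (d : Fin 2 →₀ ℕ) (r : ℂ) (i : Fin 2) :
    MvPolynomial.X i * MvPolynomial.monomial d r =
      (MvPolynomial.monomial (Finsupp.single i 1 + d) r : MvPolynomial (Fin 2) ℂ) := by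
  rw [MvPolynomial.X, MvPolynomial.monomial_mul, one_mul]

/-- This and the next three identities compare spin (n+1)/2 with spin n/2, for the four monomials of
which a leg polynomial consists. On monomials they are relations between C(n+1,·)⁻¹ and C(n,·)⁻¹,
with X∂ reading off the exponent. -/
theorem siteFun_succ_X_mul_X (n : ℕ) (P : MvPolynomial (Fin 2) ℂ) :
    ((n : ℂ) + 1) * siteFun (n + 1) (MvPolynomial.X 0 * (MvPolynomial.X 1 * P)) =
      siteFun n P + siteFun n (MvPolynomial.X 0 * MvPolynomial.pderiv 0 P) := by
  induction P using MvPolynomial.induction_on' with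
  | add p q hp hq =>
    simp only [mul_add, map_add] at hp hq ⊢
    linear_combination hp + hq
  | monomial d r =>
    rw [MvPolynomial.X_mul_pderiv_monomial, map_nsmul, monomial_mul_X, monomial_mul_X,
      siteFun_monomial, siteFun_monomial]
    simp only [Finsupp.add_apply, Finsupp.single_apply]
    by_cases h : d 0 = d 1 ∧ d 0 ≤ n
    · have h' : 1 + (0 + d 0) = 0 + (1 + d 1) ∧ 1 + (0 + d 0) ≤ n + 1 := by omega
      simp only [reduceIte, zero_ne_one, one_ne_zero]
      rw [if_pos h', if_pos h, ← mul_assoc, show 1 + (0 + d 0) = d 0 + 1 by omega,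
        succ_mul_choose_inv h.2, nsmul_eq_mul]
      ring
    · have h' : ¬ (1 + (0 + d 0) = 0 + (1 + d 1) ∧ 1 + (0 + d 0) ≤ n + 1) := by omega
      simp only [reduceIte, zero_ne_one, one_ne_zero]
      rw [if_neg h', if_neg h]
      simp

/-- The last term corrects for the exponent n + 1, which spin n/2 does not see. It vanishes when P
is a product of n legs. -/
theorem siteFun_succ (n : ℕ) (P : MvPolynomial (Fin 2) ℂ) :
    ((n : ℂ) + 1) * siteFun (n + 1) P =
      ((n : ℂ) + 1) * siteFun n P - siteFun n (MvPolynomial.X 0 * MvPolynomial.pderiv 0 P) +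
        ((n : ℂ) + 1) * MvPolynomial.coeff (pairExpo (n + 1) (n + 1)) P := by
  induction P using MvPolynomial.induction_on' with
  | add p q hp hq =>
    simp only [mul_add, map_add, MvPolynomial.coeff_add] at hp hq ⊢
    linear_combination hp + hq
  | monomial d r =>
    rw [MvPolynomial.X_mul_pderiv_monomial, map_nsmul, siteFun_monomial, siteFun_monomial,
      MvPolynomial.coeff_monomial]
    by_cases h : d 0 = d 1 ∧ d 0 ≤ n
    · have h' : d 0 = d 1 ∧ d 0 ≤ n + 1 := by omega
      have h2 : ¬ d = pairExpo (n + 1) (n + 1) := by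
        intro e
        rw [e, pairExpo_apply_zero, pairExpo_apply_one] at h
        omega
      rw [if_pos h', if_pos h, if_neg h2, ← mul_assoc, succ_mul_choose_inv' h.2, nsmul_eq_mul]
      ring
    · by_cases h2 : d = pairExpo (n + 1) (n + 1)
      · rw [if_neg h, if_pos h2, h2, pairExpo_apply_zero, pairExpo_apply_one]
        simp
      · have h' : ¬ (d 0 = d 1 ∧ d 0 ≤ n + 1) := by
          rintro ⟨e, hle⟩
          refine h2 ?_
          rw [eq_pairExpo d, pairExpo_inj]
          omega
        rw [if_neg h', if_neg h, if_neg h2]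
        simp

theorem siteFun_succ_X_one (n : ℕ) (P : MvPolynomial (Fin 2) ℂ) :
    ((n : ℂ) + 1) * siteFun (n + 1) (MvPolynomial.X 1 * P) =
      siteFun n (MvPolynomial.pderiv 0 P) := by
  induction P using MvPolynomial.induction_on' with
  | add p q hp hq =>
    simp only [mul_add, map_add] at hp hq ⊢
    linear_combination hp + hq
  | monomial d r =>
    rw [MvPolynomial.pderiv_monomial, monomial_mul_X, siteFun_monomial, siteFun_monomial]
    simp only [Finsupp.add_apply, Finsupp.single_apply, Finsupp.tsub_apply, reduceIte, zero_ne_one,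
      one_ne_zero, zero_add, tsub_zero]
    by_cases h : d 0 = 1 + d 1 ∧ d 0 ≤ n + 1
    · have h' : d 0 - 1 = d 1 ∧ d 0 - 1 ≤ n := by omega
      have h0 : d 0 = d 1 + 1 := by omega
      have hc := succ_mul_choose_inv (n := n) (j := d 1) (by omega)
      rw [if_pos h, if_pos h', h'.1, h0, ← mul_assoc, hc]
      push_cast
      ring
    · rw [if_neg h, mul_zero]
      split_ifs with h'
      · have : d 0 = 0 := by omega
        rw [this]; simp
      · rfl

theorem siteFun_succ_X_zero (n : ℕ) (P : MvPolynomial (Fin 2) ℂ) :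
    ((n : ℂ) + 1) * siteFun (n + 1) (MvPolynomial.X 0 * P) =
      (n : ℂ) * siteFun n (MvPolynomial.X 0 * P) -
        siteFun n (MvPolynomial.X 0 * (MvPolynomial.X 0 * MvPolynomial.pderiv 0 P)) +
        ((n : ℂ) + 1) * MvPolynomial.coeff (pairExpo n (n + 1)) P := by
  induction P using MvPolynomial.induction_on' with
  | add p q hp hq =>
    simp only [mul_add, map_add, MvPolynomial.coeff_add] at hp hq ⊢
    linear_combination hp + hq
  | monomial d r =>
    rw [MvPolynomial.X_mul_pderiv_monomial, mul_smul_comm, map_nsmul, monomial_mul_X,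
      siteFun_monomial, siteFun_monomial, MvPolynomial.coeff_monomial]
    simp only [Finsupp.add_apply, Finsupp.single_apply, reduceIte, zero_ne_one, zero_add]
    by_cases h : 1 + d 0 = d 1 ∧ 1 + d 0 ≤ n
    · have h' : 1 + d 0 = d 1 ∧ 1 + d 0 ≤ n + 1 := by omega
      have h2 : ¬ d = pairExpo n (n + 1) := by
        intro e
        rw [e, pairExpo_apply_zero, pairExpo_apply_one] at h
        omega
      rw [if_pos h', if_pos h, if_neg h2, ← mul_assoc, succ_mul_choose_inv' h.2, nsmul_eq_mul]
      push_cast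
      ring
    · by_cases h2 : d = pairExpo n (n + 1)
      · have hc := succ_mul_choose_inv (n := n) (j := n) le_rfl
        rw [if_neg h, if_pos h2, h2, pairExpo_apply_zero, pairExpo_apply_one, if_pos (by omega),
          ← mul_assoc, add_comm 1 n, hc]
        simp
      · have h' : ¬ (1 + d 0 = d 1 ∧ 1 + d 0 ≤ n + 1) := by
          rintro ⟨e, hle⟩
          refine h2 ?_
          rw [eq_pairExpo d, pairExpo_inj]
          omega
        rw [if_neg h', if_neg h, if_neg h2]
        simp

/-- Exchange of ket and bra. -/
noncomputable def swapVars : MvPolynomial (Fin 2) ℂ →ₐ[ℂ] MvPolynomial (Fin 2) ℂ :=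
  MvPolynomial.rename (Equiv.swap 0 1)

theorem siteFun_swapVars (m : ℕ) (P : MvPolynomial (Fin 2) ℂ) :
    siteFun m (swapVars P) = siteFun m P := by
  induction P using MvPolynomial.induction_on' with
  | add p q hp hq => rw [map_add, map_add, map_add, hp, hq]
  | monomial d r =>
    rw [swapVars, MvPolynomial.rename_monomial, siteFun_monomial, siteFun_monomial]
    have h0 : (d.mapDomain (Equiv.swap (0 : Fin 2) 1)) 0 = d 1 := by
      have := Finsupp.mapDomain_apply (Equiv.swap (0 : Fin 2) 1).injective d 1
      simpa using this
    have h1 : (d.mapDomain (Equiv.swap (0 : Fin 2) 1)) 1 = d 0 := by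
      have := Finsupp.mapDomain_apply (Equiv.swap (0 : Fin 2) 1).injective d 0
      simpa using this
    rw [h0, h1]
    by_cases h : d 0 = d 1
    · simp [h]
    · rw [if_neg fun h' => h h'.1.symm, if_neg fun h' => h h'.1]

theorem swapVars_legPoly (Q : Matrix (Fin 2) (Fin 2) ℂ) : swapVars (legPoly Q) = legPoly Qᵀ := by
  simp only [legPoly, swapVars, map_add, map_sub, map_mul, MvPolynomial.rename_C,
    MvPolynomial.rename_X, Equiv.swap_apply_left, Equiv.swap_apply_right, Matrix.transpose_apply]
  ring

variable {ι : Type*}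

theorem pderiv_prod_eq (s : Finset ι) (f : ι → MvPolynomial (Fin 2) ℂ) :
    MvPolynomial.pderiv 0 (∏ i ∈ s, f i) =
      ∑ i ∈ s, MvPolynomial.pderiv 0 (f i) * ∏ j ∈ s.erase i, f j := by
  induction s using Finset.induction_on with
  | empty => simp
  | insert a s ha ih =>
    rw [Finset.prod_insert ha, MvPolynomial.pderiv_mul, ih, Finset.sum_insert ha,
      Finset.erase_insert ha, Finset.mul_sum]
    congr 1
    refine Finset.sum_congr rfl fun i hi => ?_
    have hne : a ≠ i := fun e => ha (e ▸ hi)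
    rw [Finset.erase_insert_of_ne hne, Finset.prod_insert (fun h => ha (Finset.mem_of_mem_erase h))]
    ring

theorem degreeOf_legPoly_le (Q : Matrix (Fin 2) (Fin 2) ℂ) (i : Fin 2) :
    (legPoly Q).degreeOf i ≤ 1 := by
  have hC : ∀ c : ℂ, (MvPolynomial.C c : MvPolynomial (Fin 2) ℂ).degreeOf i ≤ 1 := fun c => by
    rw [MvPolynomial.degreeOf_C]; exact Nat.zero_le _
  have hX : ∀ (c : ℂ) (j : Fin 2),
      (MvPolynomial.C c * MvPolynomial.X j : MvPolynomial (Fin 2) ℂ).degreeOf i ≤ 1 := fun c j => by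
    refine (MvPolynomial.degreeOf_mul_le _ _ _).trans ?_
    rw [MvPolynomial.degreeOf_C, MvPolynomial.degreeOf_X]
    split_ifs <;> simp
  refine (MvPolynomial.degreeOf_add_le _ _ _).trans (max_le ?_ ?_)
  · refine (MvPolynomial.degreeOf_sub_le _ _ _).trans (max_le ?_ (hX _ _))
    exact (MvPolynomial.degreeOf_sub_le _ _ _).trans (max_le (hC _) (hX _ _))
  · refine (MvPolynomial.degreeOf_mul_le _ _ _).trans ?_
    rw [MvPolynomial.degreeOf_C, zero_add]
    refine (MvPolynomial.degreeOf_mul_le _ _ _).trans ?_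
    rw [MvPolynomial.degreeOf_X, MvPolynomial.degreeOf_X]
    fin_cases i <;> simp

/-- A leg polynomial has degree at most 1 in each variable. This removes the correction terms of the
recursions. -/
theorem coeff_prod_legPoly (s : Finset ι) (Q : ι → Matrix (Fin 2) (Fin 2) ℂ) {k l : ℕ}
    (h : s.card < l) : MvPolynomial.coeff (pairExpo k l) (∏ i ∈ s, legPoly (Q i)) = 0 := by
  by_contra hne
  have h1 := MvPolynomial.monomial_le_degreeOf 1 (MvPolynomial.mem_support_iff.mpr hne)
  have h2 := (MvPolynomial.degreeOf_prod_le (1 : Fin 2) s fun i => legPoly (Q i)).trans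
    (Finset.sum_le_sum fun i _ => degreeOf_legPoly_le (Q i) 1)
  rw [pairExpo_apply_one] at h1
  simp only [Finset.sum_const, smul_eq_mul, mul_one] at h2
  omega

/-- Wick's theorem for one leg. -/
theorem siteFun_legPoly_mul (s : Finset ι) (Q : ι → Matrix (Fin 2) (Fin 2) ℂ)
    (Z : Matrix (Fin 2) (Fin 2) ℂ) :
    ((s.card : ℂ) + 1) * siteFun (s.card + 1) (legPoly Z * ∏ i ∈ s, legPoly (Q i)) =
      Z.trace * siteFun s.card (∏ i ∈ s, legPoly (Q i)) +
        ∑ i ∈ s, siteFun s.card (legPoly (Z * Q i) * ∏ j ∈ s.erase i, legPoly (Q j)) := by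
  obtain ⟨P, hP⟩ : ∃ P, P = ∏ i ∈ s, legPoly (Q i) := ⟨_, rfl⟩
  obtain ⟨n, hn⟩ : ∃ n, n = s.card := ⟨_, rfl⟩
  have hc1 : MvPolynomial.coeff (pairExpo (n + 1) (n + 1)) P = 0 := by
    rw [hP]; exact coeff_prod_legPoly s Q (by omega)
  have hc2 : MvPolynomial.coeff (pairExpo n (n + 1)) P = 0 := by
    rw [hP]; exact coeff_prod_legPoly s Q (by omega)
  have hcard : (n : MvPolynomial (Fin 2) ℂ) * P =
      ∑ i ∈ s, legPoly (Q i) * ∏ j ∈ s.erase i, legPoly (Q j) := by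
    rw [Finset.sum_congr rfl fun i hi => Finset.mul_prod_erase s (fun j => legPoly (Q j)) hi,
      Finset.sum_const, nsmul_eq_mul, hn, hP]
  have hder : MvPolynomial.pderiv 0 P =
      ∑ i ∈ s, MvPolynomial.pderiv 0 (legPoly (Q i)) * ∏ j ∈ s.erase i, legPoly (Q j) := by
    rw [hP, pderiv_prod_eq]
  -- Left multiplication by Z acts on the ket index only. A leg is affine in X, so p - X∂p and ∂p
  -- isolate its two rows (the second with sign reversed), and Z mixes them. Summed over the legs,
  -- the product rule turns this into a first-order operator acting on the whole product.
  have hleg : ∀ i, legPoly (Z * Q i) =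
      (MvPolynomial.C (Z 0 0) - MvPolynomial.C (Z 1 0) * MvPolynomial.X 0) *
        (legPoly (Q i) - MvPolynomial.X 0 * MvPolynomial.pderiv 0 (legPoly (Q i))) +
      (MvPolynomial.C (Z 1 1) * MvPolynomial.X 0 - MvPolynomial.C (Z 0 1)) *
        MvPolynomial.pderiv 0 (legPoly (Q i)) := by
    intro i
    have hd : MvPolynomial.pderiv 0 (legPoly (Q i)) =
        - MvPolynomial.C (Q i 1 0) + MvPolynomial.C (Q i 1 1) * MvPolynomial.X 1 := by
      have h01 : MvPolynomial.pderiv (0 : Fin 2) (MvPolynomial.X 1 : MvPolynomial (Fin 2) ℂ) = 0 :=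
        MvPolynomial.pderiv_X_of_ne (by decide)
      have h00 : MvPolynomial.pderiv (0 : Fin 2) (MvPolynomial.X 0 : MvPolynomial (Fin 2) ℂ) = 1 :=
        MvPolynomial.pderiv_X_self 0
      simp only [legPoly, map_add, map_sub, MvPolynomial.pderiv_mul, MvPolynomial.pderiv_C, h01, h00]
      ring
    rw [hd]
    simp only [legPoly, Matrix.mul_apply, Fin.sum_univ_two, map_add, map_mul]
    ring
  have hsum : ∑ i ∈ s, legPoly (Z * Q i) * ∏ j ∈ s.erase i, legPoly (Q j) =
      (MvPolynomial.C (Z 0 0) - MvPolynomial.C (Z 1 0) * MvPolynomial.X 0) *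
        ((n : MvPolynomial (Fin 2) ℂ) * P - MvPolynomial.X 0 * MvPolynomial.pderiv 0 P) +
      (MvPolynomial.C (Z 1 1) * MvPolynomial.X 0 - MvPolynomial.C (Z 0 1)) *
        MvPolynomial.pderiv 0 P := by
    rw [hcard, hder]
    simp only [Finset.mul_sum, ← Finset.sum_sub_distrib, ← Finset.sum_add_distrib]
    refine Finset.sum_congr rfl fun i _ => ?_
    rw [hleg]
    ring
  rw [← map_sum, hsum, ← hP, ← hn]
  have e1 := siteFun_succ_X_mul_X n P
  have e2 := siteFun_succ n P
  have e3 := siteFun_succ_X_one n P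
  have e4 := siteFun_succ_X_zero n P
  rw [hc1] at e2
  rw [hc2] at e4
  have hC : ∀ (m : ℕ) (r : ℂ) (p : MvPolynomial (Fin 2) ℂ),
      siteFun m (MvPolynomial.C r * p) = r * siteFun m p := by
    intro m r p
    rw [← MvPolynomial.smul_eq_C_mul, map_smul, smul_eq_mul]
  have hl : legPoly Z * P = MvPolynomial.C (Z 0 0) * P -
      MvPolynomial.C (Z 0 1) * (MvPolynomial.X 1 * P) - MvPolynomial.C (Z 1 0) * (MvPolynomial.X 0 * P) +
      MvPolynomial.C (Z 1 1) * (MvPolynomial.X 0 * (MvPolynomial.X 1 * P)) := by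
    rw [legPoly]; ring
  have hr : (MvPolynomial.C (Z 0 0) - MvPolynomial.C (Z 1 0) * MvPolynomial.X 0) *
        ((n : MvPolynomial (Fin 2) ℂ) * P - MvPolynomial.X 0 * MvPolynomial.pderiv 0 P) +
      (MvPolynomial.C (Z 1 1) * MvPolynomial.X 0 - MvPolynomial.C (Z 0 1)) *
        MvPolynomial.pderiv 0 P =
      MvPolynomial.C (Z 0 0) * (MvPolynomial.C (n : ℂ) * P) -
      MvPolynomial.C (Z 0 0) * (MvPolynomial.X 0 * MvPolynomial.pderiv 0 P) -
      MvPolynomial.C (Z 1 0) * (MvPolynomial.C (n : ℂ) * (MvPolynomial.X 0 * P)) +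
      MvPolynomial.C (Z 1 0) * (MvPolynomial.X 0 * (MvPolynomial.X 0 * MvPolynomial.pderiv 0 P)) +
      MvPolynomial.C (Z 1 1) * (MvPolynomial.X 0 * MvPolynomial.pderiv 0 P) -
      MvPolynomial.C (Z 0 1) * MvPolynomial.pderiv 0 P := by
    rw [show (MvPolynomial.C (n : ℂ) : MvPolynomial (Fin 2) ℂ) = n from map_natCast _ n]
    ring
  rw [hl, hr]
  simp only [map_add, map_sub, hC, Matrix.trace_fin_two]
  linear_combination (Z 0 0) * e2 - (Z 0 1) * e3 - (Z 1 0) * e4 + (Z 1 1) * e1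

/-- Wick's theorem for one leg, with the bra contracted. -/
theorem siteFun_legPoly_mul' (s : Finset ι) (Q : ι → Matrix (Fin 2) (Fin 2) ℂ)
    (Z : Matrix (Fin 2) (Fin 2) ℂ) :
    ((s.card : ℂ) + 1) * siteFun (s.card + 1) (legPoly Z * ∏ i ∈ s, legPoly (Q i)) =
      Z.trace * siteFun s.card (∏ i ∈ s, legPoly (Q i)) +
        ∑ i ∈ s, siteFun s.card (legPoly (Q i * Z) * ∏ j ∈ s.erase i, legPoly (Q j)) := by
  have h := siteFun_legPoly_mul s (fun i => (Q i)ᵀ) Zᵀ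
  rw [Matrix.trace_transpose] at h
  simp only [← Matrix.transpose_mul, ← swapVars_legPoly, ← map_prod, ← map_mul,
    siteFun_swapVars] at h
  exact h

end SiteMoments


/-! ### The density and the magnetization of a site with product boundary conditions -/

section BlochMoments

open scoped Classical ComplexOrder

variable {ι : Type*}

/-- The vectors which parametrize the boundary conditions `𝟙 + r · σ`. -/
abbrev BlochVector : Type := EuclideanSpace ℝ (Fin 3)

/-- The product of the polynomials of legs with the boundary conditions `𝟙 + r i · σ`. -/
noncomputable def legsPoly (s : Finset ι) (r : ι → BlochVector) : MvPolynomial (Fin 2) ℂ :=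
  ∏ i ∈ s, legPoly (blochMatrix (r i))

theorem blochMatrix_eq (r : BlochVector) : blochMatrix r =
    !![1 + (r 2 : ℂ), r 0 - r 1 * Complex.I; r 0 + r 1 * Complex.I, 1 - (r 2 : ℂ)] := by
  ext i j
  fin_cases i <;> fin_cases j <;> simp [blochMatrix, pauli, Fin.sum_univ_three] <;> ring

theorem pauli_mul_blochMatrix_add (a : Fin 3) (r : BlochVector) :
    pauli a * blochMatrix r + blochMatrix r * pauli a =
      (2 : ℂ) • pauli a + (2 * (r a : ℂ)) • (1 : Matrix (Fin 2) (Fin 2) ℂ) := by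
  have hI := Complex.I_mul_I
  rw [blochMatrix_eq]
  ext i j
  fin_cases a <;> fin_cases i <;> fin_cases j <;>
    simp [pauli] <;>
    first | ring1 | linear_combination (-2 * (r 1 : ℂ)) * hI

theorem trace_pauli (a : Fin 3) : (pauli a).trace = 0 := by
  fin_cases a <;> simp [pauli, Matrix.trace_fin_two]

theorem siteFun_C_mul (m : ℕ) (c : ℂ) (P : MvPolynomial (Fin 2) ℂ) :
    siteFun m (MvPolynomial.C c * P) = c * siteFun m P := by
  rw [← MvPolynomial.smul_eq_C_mul, map_smul, smul_eq_mul]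

theorem siteFun_legPoly_one_mul (s : Finset ι) (r : ι → BlochVector) :
    ((s.card : ℂ) + 1) * siteFun (s.card + 1) (legPoly 1 * legsPoly s r) =
      ((s.card : ℂ) + 2) * siteFun s.card (legsPoly s r) := by
  have h := siteFun_legPoly_mul s (fun i => blochMatrix (r i)) 1
  simp only [one_mul] at h
  rw [Finset.sum_congr rfl fun i hi => by
    rw [Finset.mul_prod_erase s (fun j => legPoly (blochMatrix (r j))) hi], Finset.sum_const,
    nsmul_eq_mul] at h
  rw [legsPoly, h, Matrix.trace_one, Fintype.card_fin]
  push_cast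
  ring

/-- The mean of the two forms of Wick's theorem contains only the anticommutator of σ_a with 1 +
r·σ, so no cross products appear and the density and the moment form a closed system. -/
theorem siteFun_legPoly_pauli_mul (s : Finset ι) (r : ι → BlochVector) (a : Fin 3) :
    ((s.card : ℂ) + 1) * siteFun (s.card + 1) (legPoly (pauli a) * legsPoly s r) =
      ∑ i ∈ s, (siteFun s.card (legPoly (pauli a) * legsPoly (s.erase i) r) +
        (r i a : ℂ) * siteFun s.card (legPoly 1 * legsPoly (s.erase i) r)) := by
  have h1 := siteFun_legPoly_mul s (fun i => blochMatrix (r i)) (pauli a)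
  have h2 := siteFun_legPoly_mul' s (fun i => blochMatrix (r i)) (pauli a)
  rw [trace_pauli, zero_mul, zero_add] at h1 h2
  have h3 : ∀ i, siteFun s.card (legPoly (pauli a * blochMatrix (r i)) *
      ∏ j ∈ s.erase i, legPoly (blochMatrix (r j))) +
      siteFun s.card (legPoly (blochMatrix (r i) * pauli a) *
      ∏ j ∈ s.erase i, legPoly (blochMatrix (r j))) =
      2 * (siteFun s.card (legPoly (pauli a) * legsPoly (s.erase i) r) +
        (r i a : ℂ) * siteFun s.card (legPoly 1 * legsPoly (s.erase i) r)) := by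
    intro i
    rw [← map_add, ← add_mul, ← legPoly_add, pauli_mul_blochMatrix_add, legPoly_add, legPoly_smul,
      legPoly_smul, add_mul, mul_assoc, mul_assoc, map_add, siteFun_C_mul, siteFun_C_mul, legsPoly]
    ring
  have h4 := congrArg₂ (· + ·) h1 h2
  simp only [← Finset.sum_add_distrib, h3, ← Finset.mul_sum] at h4
  rw [legsPoly]
  linear_combination h4 / 2

theorem legPoly_blochMatrix (r : BlochVector) : legPoly (blochMatrix r) =
    legPoly 1 + ∑ a, MvPolynomial.C (r a : ℂ) * legPoly (pauli a) := by
  simp only [blochMatrix, legPoly_add, Fin.sum_univ_three, legPoly_smul]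

/-- The normalization of the state of a site with the boundary conditions `𝟙 + r i · σ`, `i ∈ s`, as a
complex number. -/
noncomputable def siteDensityAux (s : Finset ι) (r : ι → BlochVector) : ℂ :=
  siteFun s.card (legsPoly s r) / (s.card + 1)

/-- The magnetization seen by a further leg of a site, as a complex number. -/
noncomputable def siteMomentAux (s : Finset ι) (r : ι → BlochVector) (a : Fin 3) : ℂ :=
  siteFun (s.card + 1) (legPoly (pauli a) * legsPoly s r) / (s.card + 2)

theorem natCast_add_one_ne_zero' (n : ℕ) : (n : ℂ) + 1 ≠ 0 := Nat.cast_add_one_ne_zero n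

theorem natCast_add_two_ne_zero (n : ℕ) : (n : ℂ) + 2 ≠ 0 := by
  have := Nat.cast_add_one_ne_zero (R := ℂ) (n + 1)
  push_cast at this
  convert this using 1
  ring

theorem siteFun_legPoly_one_mul' (s : Finset ι) (r : ι → BlochVector) :
    siteFun (s.card + 1) (legPoly 1 * legsPoly s r) = ((s.card : ℂ) + 2) * siteDensityAux s r := by
  rw [siteDensityAux]
  have := natCast_add_one_ne_zero' s.card
  field_simp
  linear_combination siteFun_legPoly_one_mul s r

theorem siteFun_legsPoly (s : Finset ι) (r : ι → BlochVector) :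
    siteFun s.card (legsPoly s r) = ((s.card : ℂ) + 1) * siteDensityAux s r := by
  rw [siteDensityAux, mul_div_cancel₀ _ (natCast_add_one_ne_zero' _)]

theorem siteFun_legPoly_pauli (s : Finset ι) (r : ι → BlochVector) (a : Fin 3) :
    siteFun (s.card + 1) (legPoly (pauli a) * legsPoly s r) =
      ((s.card : ℂ) + 2) * siteMomentAux s r a := by
  rw [siteMomentAux, mul_div_cancel₀ _ (natCast_add_two_ne_zero _)]

theorem siteDensityAux_insert {s : Finset ι} {i : ι} (hi : i ∉ s) (r : ι → BlochVector) :
    siteDensityAux (insert i s) r = siteDensityAux s r + ∑ a, (r i a : ℂ) * siteMomentAux s r a := by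
  have h : legsPoly (insert i s) r = legPoly 1 * legsPoly s r +
      ∑ a, MvPolynomial.C (r i a : ℂ) * (legPoly (pauli a) * legsPoly s r) := by
    rw [legsPoly, Finset.prod_insert hi, legPoly_blochMatrix, add_mul, Finset.sum_mul, legsPoly]
    simp only [mul_assoc]
  rw [siteDensityAux, Finset.card_insert_of_notMem hi, h, map_add, map_sum,
    siteFun_legPoly_one_mul']
  simp only [siteFun_C_mul, siteFun_legPoly_pauli]
  have := natCast_add_two_ne_zero s.card
  rw [Finset.sum_congr rfl fun a _ => mul_left_comm (r i a : ℂ) _ _, ← Finset.mul_sum, ← mul_add]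
  push_cast
  rw [show (s.card : ℂ) + 1 + 1 = s.card + 2 by ring, mul_div_cancel_left₀ _ this]

theorem siteMomentAux_eq (s : Finset ι) (r : ι → BlochVector) (a : Fin 3) :
    ((s.card : ℂ) + 2) * siteMomentAux s r a =
      ∑ i ∈ s, (siteMomentAux (s.erase i) r a + (r i a : ℂ) * siteDensityAux (s.erase i) r) := by
  have h := siteFun_legPoly_pauli_mul s r a
  rw [siteFun_legPoly_pauli] at h
  have h1 : ∀ i ∈ s, siteFun s.card (legPoly (pauli a) * legsPoly (s.erase i) r) +
        (r i a : ℂ) * siteFun s.card (legPoly 1 * legsPoly (s.erase i) r) = ((s.card : ℂ) + 1) *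
        (siteMomentAux (s.erase i) r a + (r i a : ℂ) * siteDensityAux (s.erase i) r) := by
    intro i hi
    have h2 := siteFun_legPoly_pauli (s.erase i) r a
    have h3 := siteFun_legPoly_one_mul' (s.erase i) r
    have h4 : (s.erase i).card + 1 = s.card := Finset.card_erase_add_one hi
    have h5 : ((s.erase i).card : ℂ) + 1 = s.card := by exact_mod_cast h4
    rw [h4] at h2 h3
    rw [h2, h3, ← h5]
    ring
  rw [Finset.sum_congr rfl h1, ← Finset.mul_sum] at h
  exact mul_left_cancel₀ (natCast_add_one_ne_zero' s.card) h

/-- The recursions have real coefficients and start from 1, so nothing is lost by taking real parts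
in the definitions that follow. -/
theorem siteMoments_im (s : Finset ι) (r : ι → BlochVector) :
    (siteDensityAux s r).im = 0 ∧ ∀ a, (siteMomentAux s r a).im = 0 := by
  induction s using Finset.strongInduction with
  | H s ih =>
  have hN : ∀ a, (siteMomentAux s r a).im = 0 := by
    intro a
    have h := congrArg Complex.im (siteMomentAux_eq s r a)
    rw [Complex.im_sum, Finset.sum_eq_zero] at h
    · have h1 : (((s.card : ℂ) + 2) * siteMomentAux s r a).im =
          ((s.card : ℝ) + 2) * (siteMomentAux s r a).im := by
        rw [show ((s.card : ℂ) + 2) = (((s.card : ℝ) + 2 : ℝ) : ℂ) by push_cast; ring,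
          Complex.im_ofReal_mul]
      rw [h1] at h
      exact (mul_eq_zero.mp h).resolve_left (by positivity)
    · intro i hi
      obtain ⟨h1, h2⟩ := ih _ (Finset.erase_ssubset hi)
      rw [Complex.add_im, h2, Complex.im_ofReal_mul, h1, mul_zero, add_zero]
  refine ⟨?_, hN⟩
  rcases s.eq_empty_or_nonempty with rfl | ⟨i, hi⟩
  · simp [siteDensityAux, legsPoly, siteFun_apply, MvPolynomial.coeff_one, pairExpo]
  · obtain ⟨h1, h2⟩ := ih _ (Finset.erase_ssubset hi)
    rw [← Finset.insert_erase hi, siteDensityAux_insert (Finset.notMem_erase i s), Complex.add_im,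
      h1, Complex.im_sum, zero_add]
    refine Finset.sum_eq_zero fun a _ => ?_
    rw [Complex.im_ofReal_mul, h2, mul_zero]

/-- The normalization of the state of a site with the boundary conditions `𝟙 + r i · σ`, `i ∈ s`. -/
noncomputable def siteDensity (s : Finset ι) (r : ι → BlochVector) : ℝ := (siteDensityAux s r).re

/-- The magnetization seen by a further leg of a site with the boundary conditions `𝟙 + r i · σ`. -/
noncomputable def siteMoment (s : Finset ι) (r : ι → BlochVector) : BlochVector :=
  WithLp.toLp 2 fun a => (siteMomentAux s r a).re

theorem siteDensityAux_eq (s : Finset ι) (r : ι → BlochVector) :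
    siteDensityAux s r = siteDensity s r :=
  Complex.ext rfl (by rw [(siteMoments_im s r).1, Complex.ofReal_im])

theorem siteMomentAux_eq_siteMoment (s : Finset ι) (r : ι → BlochVector) (a : Fin 3) :
    siteMomentAux s r a = siteMoment s r a :=
  Complex.ext rfl (by rw [(siteMoments_im s r).2, Complex.ofReal_im])

theorem siteFun_legsPoly_eq (s : Finset ι) (r : ι → BlochVector) :
    siteFun s.card (legsPoly s r) = ((s.card : ℂ) + 1) * siteDensity s r := by
  rw [siteFun_legsPoly, siteDensityAux_eq]

theorem siteFun_legPoly_pauli_eq (s : Finset ι) (r : ι → BlochVector) (a : Fin 3) :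
    siteFun (s.card + 1) (legPoly (pauli a) * legsPoly s r) =
      ((s.card : ℂ) + 2) * siteMoment s r a := by
  rw [siteFun_legPoly_pauli, siteMomentAux_eq_siteMoment]

theorem siteDensity_empty (r : ι → BlochVector) : siteDensity ∅ r = 1 := by
  simp [siteDensity, siteDensityAux, legsPoly, siteFun_apply, MvPolynomial.coeff_one, pairExpo]

theorem siteDensity_insert {s : Finset ι} {i : ι} (hi : i ∉ s) (r : ι → BlochVector) :
    siteDensity (insert i s) r = siteDensity s r + inner ℝ (r i) (siteMoment s r) := by
  have h := siteDensityAux_insert hi r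
  simp only [siteDensityAux_eq, siteMomentAux_eq_siteMoment] at h
  rw [PiLp.inner_apply]
  simp only [RCLike.inner_apply, conj_trivial]
  apply Complex.ofReal_injective
  push_cast
  rw [h]
  congr 1
  exact Finset.sum_congr rfl fun a _ => mul_comm _ _

theorem siteMoment_eq (s : Finset ι) (r : ι → BlochVector) :
    ((s.card : ℝ) + 2) • siteMoment s r =
      ∑ i ∈ s, (siteMoment (s.erase i) r + siteDensity (s.erase i) r • r i) := by
  ext a
  have h := siteMomentAux_eq s r a
  simp only [siteDensityAux_eq, siteMomentAux_eq_siteMoment] at h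
  simp only [PiLp.smul_apply, smul_eq_mul, WithLp.ofLp_sum, Finset.sum_apply, PiLp.add_apply]
  apply Complex.ofReal_injective
  push_cast
  rw [h]
  exact Finset.sum_congr rfl fun i _ => by ring

theorem siteMoments_congr {s : Finset ι} {r r' : ι → BlochVector} (h : ∀ i ∈ s, r i = r' i) :
    siteDensity s r = siteDensity s r' ∧ siteMoment s r = siteMoment s r' := by
  have : legsPoly s r = legsPoly s r' := Finset.prod_congr rfl fun i hi => by rw [h i hi]
  constructor
  · rw [siteDensity, siteDensity, siteDensityAux, siteDensityAux, this]
  · rw [siteMoment, siteMoment]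
    simp only [siteMomentAux, this]

/-- Inserting the test legs 1, σ₁, σ₂, σ₃ determines the four entries. The singlet on the outgoing
edge reverses the spin, hence the minus sign. -/
theorem outgoing_legsPoly (s : Finset ι) (r : ι → BlochVector) :
    outgoing (s.card + 1) (legsPoly s r) = (((s.card : ℂ) + 2) / 2) •
      ((siteDensity s r : ℂ) • 1 - ∑ a, (siteMoment s r a : ℂ) • pauli a) := by
  obtain ⟨P, hP⟩ : ∃ P, P = legsPoly s r := ⟨_, rfl⟩
  obtain ⟨n, hn⟩ : ∃ n, n = s.card := ⟨_, rfl⟩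
  have h0 := siteFun_legPoly_one_mul' s r
  rw [siteDensityAux_eq] at h0
  have h1 := siteFun_legPoly_pauli_eq s r 0
  have h2 := siteFun_legPoly_pauli_eq s r 1
  have h3 := siteFun_legPoly_pauli_eq s r 2
  rw [← hP, ← hn] at h0 h1 h2 h3 ⊢
  have e0 : legPoly 1 * P = P + MvPolynomial.X 0 * MvPolynomial.X 1 * P := by
    simp [legPoly]; ring
  have e1 : legPoly (pauli 0) * P = - (MvPolynomial.X 1 * P) - MvPolynomial.X 0 * P := by
    simp [legPoly, pauli]; ring
  have e2 : legPoly (pauli 1) * P = MvPolynomial.C Complex.I * (MvPolynomial.X 1 * P) -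
      MvPolynomial.C Complex.I * (MvPolynomial.X 0 * P) := by
    simp [legPoly, pauli]; ring
  have e3 : legPoly (pauli 2) * P = P - MvPolynomial.X 0 * MvPolynomial.X 1 * P := by
    simp [legPoly, pauli]; ring
  rw [e0, map_add] at h0
  rw [e1, map_sub, map_neg] at h1
  rw [e2, map_sub, siteFun_C_mul, siteFun_C_mul] at h2
  rw [e3, map_sub] at h3
  have hI := Complex.I_mul_I
  ext i j
  fin_cases i <;> fin_cases j <;>
    simp [outgoing, Fin.sum_univ_three, pauli]
  · linear_combination (h0 - h3) / 2
  · linear_combination (-h1 + Complex.I * h2) / 2 - hI / 2 * (siteFun (n + 1) (MvPolynomial.X 1 * P) - siteFun (n + 1) (MvPolynomial.X 0 * P))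
  · linear_combination (-h1 - Complex.I * h2) / 2 + hI / 2 * (siteFun (n + 1) (MvPolynomial.X 1 * P) - siteFun (n + 1) (MvPolynomial.X 0 * P))
  · linear_combination (h0 + h3) / 2

end BlochMoments


/-! ### Positivity of the density and contraction of the messages -/

section Positivity

open scoped Classical ComplexOrder

variable {ι : Type*}

theorem coeff_aeval_X_mul_aeval_X (p q : Polynomial ℂ) (k l : ℕ) :
    MvPolynomial.coeff (pairExpo k l) (Polynomial.aeval (MvPolynomial.X 0) p *
      Polynomial.aeval (MvPolynomial.X 1) q : MvPolynomial (Fin 2) ℂ) = p.coeff k * q.coeff l := by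
  induction p using Polynomial.induction_on' with
  | add p p' hp hp' => rw [map_add, add_mul, MvPolynomial.coeff_add, hp, hp', Polynomial.coeff_add,
      add_mul]
  | monomial m a =>
    induction q using Polynomial.induction_on' with
    | add q q' hq hq' => rw [map_add, mul_add, MvPolynomial.coeff_add, hq, hq', Polynomial.coeff_add,
        mul_add]
    | monomial n b =>
      rw [Polynomial.aeval_monomial, Polynomial.aeval_monomial, MvPolynomial.algebraMap_eq,
        mul_mul_mul_comm, ← map_mul, MvPolynomial.X_pow_eq_monomial, MvPolynomial.X_pow_eq_monomial,
        MvPolynomial.monomial_mul, one_mul, MvPolynomial.C_mul_monomial, mul_one,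
        MvPolynomial.coeff_monomial, Polynomial.coeff_monomial, Polynomial.coeff_monomial]
      have h : Finsupp.single (0 : Fin 2) m + Finsupp.single 1 n = pairExpo k l ↔ m = k ∧ n = l :=
        pairExpo_inj
      simp only [h]
      by_cases h1 : m = k <;> by_cases h2 : n = l <;> simp [h1, h2]

/-- For a unit vector u the matrix 1 + u·σ has rank one. Written as v v* with v = (a, b), its leg
polynomial splits into a - bX for the ket and the conjugate for the bra. -/
theorem exists_legPoly_blochMatrix_eq {u : BlochVector} (hu : ‖u‖ = 1) :
    ∃ p : Polynomial ℂ, p ≠ 0 ∧ p.natDegree ≤ 1 ∧ legPoly (blochMatrix u) =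
      Polynomial.aeval (MvPolynomial.X 0) p *
        Polynomial.aeval (MvPolynomial.X 1) (p.map (starRingEnd ℂ)) := by
  have hsq : u 0 ^ 2 + u 1 ^ 2 + u 2 ^ 2 = 1 := by
    have h := EuclideanSpace.norm_sq_eq u
    rw [hu, Fin.sum_univ_three] at h
    simpa using h.symm
  have key : ∀ a b : ℂ, (a ≠ 0 ∨ b ≠ 0) → a * star a = 1 + u 2 → a * star b = u 0 - u 1 * Complex.I →
      b * star a = u 0 + u 1 * Complex.I → b * star b = 1 - u 2 →
      ∃ p : Polynomial ℂ, p ≠ 0 ∧ p.natDegree ≤ 1 ∧ legPoly (blochMatrix u) =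
        Polynomial.aeval (MvPolynomial.X 0) p *
          Polynomial.aeval (MvPolynomial.X 1) (p.map (starRingEnd ℂ)) := by
    intro a b h0 h1 h2 h3 h4
    refine ⟨Polynomial.C a - Polynomial.C b * Polynomial.X, ?_, ?_, ?_⟩
    · intro h
      have e0 := congrArg (fun q => Polynomial.coeff q 0) h
      have e1 := congrArg (fun q => Polynomial.coeff q 1) h
      simp [Polynomial.coeff_C] at e0 e1
      exact h0.elim (fun h' => h' e0) fun h' => h' e1
    · refine (Polynomial.natDegree_sub_le _ _).trans (max_le (by simp) ?_)
      exact (Polynomial.natDegree_C_mul_le _ _).trans Polynomial.natDegree_X_le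
    · rw [blochMatrix_eq, ← h1, ← h2, ← h3, ← h4]
      simp [legPoly, MvPolynomial.algebraMap_eq]
      ring
  have hI := Complex.I_mul_I
  -- At the south pole the generic choice a = √(1 + u₃) vanishes and cannot be a denominator for b;
  -- there v = (0, √2).
  by_cases hz : u 2 = -1
  · have h0 : u 0 = 0 := by nlinarith
    have h1 : u 1 = 0 := by nlinarith
    have h2 : ((Real.sqrt 2 : ℝ) : ℂ) * (Real.sqrt 2 : ℝ) = 2 := ofReal_sqrt_mul_self (by norm_num)|>.trans (by norm_num)
    refine key 0 (Real.sqrt 2 : ℝ) (Or.inr (by simp)) ?_ ?_ ?_ ?_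
    · simp [hz]
    · simp [h0, h1]
    · simp [h0, h1]
    · rw [Complex.star_def, Complex.conj_ofReal, h2, hz]; norm_num
  · have hpos : 0 < 1 + u 2 := by
      have : -1 ≤ u 2 := by nlinarith [sq_nonneg (u 0), sq_nonneg (u 1)]
      rcases this.lt_or_eq with h | h
      · linarith
      · exact absurd h.symm hz
    have h2 : ((Real.sqrt (1 + u 2) : ℝ) : ℂ) * (Real.sqrt (1 + u 2) : ℝ) = 1 + u 2 := by
      rw [ofReal_sqrt_mul_self hpos.le]; push_cast; ring
    have hne : ((Real.sqrt (1 + u 2) : ℝ) : ℂ) ≠ 0 := by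
      rw [Complex.ofReal_ne_zero]; exact (Real.sqrt_pos.mpr hpos).ne'
    generalize Real.sqrt (1 + u 2) = q at h2 hne
    have hsq' : (u 0 : ℂ) ^ 2 + (u 1 : ℂ) ^ 2 + (u 2 : ℂ) ^ 2 = 1 := by
      rw [← Complex.ofReal_one, ← hsq]; push_cast; rfl
    refine key q ((u 0 + u 1 * Complex.I) / q) (Or.inl hne) ?_ ?_ ?_ ?_
    · rw [Complex.star_def, Complex.conj_ofReal, h2]
    · simp only [Complex.star_def, map_div₀, map_add, map_mul, Complex.conj_ofReal, Complex.conj_I]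
      field_simp
      ring
    · simp only [Complex.star_def, Complex.conj_ofReal]
      field_simp
    · simp only [Complex.star_def, map_div₀, map_add, map_mul, Complex.conj_ofReal, Complex.conj_I]
      have hne2 : (1 : ℂ) + u 2 ≠ 0 := by rw [← h2]; exact mul_ne_zero hne hne
      rw [div_mul_div_comm, h2, div_eq_iff hne2]
      linear_combination hsq' - (u 1 : ℂ) ^ 2 * hI

/-- With pure boundary conditions the product of the legs is P(X) times its conjugate in Y, and the
trace is the weighted sum of the |P_k|². The leading coefficient of P is nonzero, and its index does
not exceed the number of legs. -/
theorem siteDensity_pos_of_norm_eq_one {s : Finset ι} {r : ι → BlochVector}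
    (hr : ∀ i ∈ s, ‖r i‖ = 1) : 0 < siteDensity s r := by
  have h : ∀ i, ∃ p : Polynomial ℂ, i ∈ s → p ≠ 0 ∧ p.natDegree ≤ 1 ∧ legPoly (blochMatrix (r i)) =
      Polynomial.aeval (MvPolynomial.X 0) p *
        Polynomial.aeval (MvPolynomial.X 1) (p.map (starRingEnd ℂ)) := by
    intro i
    by_cases hi : i ∈ s
    · obtain ⟨p, hp⟩ := exists_legPoly_blochMatrix_eq (hr i hi)
      exact ⟨p, fun _ => hp⟩
    · exact ⟨0, fun h => absurd h hi⟩
  choose p hp using h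
  obtain ⟨P, hP⟩ : ∃ P, P = ∏ i ∈ s, p i := ⟨_, rfl⟩
  have hP0 : P ≠ 0 := by
    rw [hP]; exact Finset.prod_ne_zero_iff.mpr fun i hi => (hp i hi).1
  have hdeg : P.natDegree ≤ s.card := by
    rw [hP]
    refine (Polynomial.natDegree_prod_le _ _).trans ((Finset.sum_le_sum fun i hi => (hp i hi).2.1).trans ?_)
    simp
  have hlegs : legsPoly s r = Polynomial.aeval (MvPolynomial.X 0) P *
      Polynomial.aeval (MvPolynomial.X 1) (P.map (starRingEnd ℂ)) := by
    rw [legsPoly, Finset.prod_congr rfl fun i hi => (hp i hi).2.2, Finset.prod_mul_distrib, hP,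
      Polynomial.map_prod, map_prod, map_prod]
  have hre : siteFun s.card (legsPoly s r) =
      ((∑ k ∈ Finset.range (s.card + 1), (s.card.choose k : ℝ)⁻¹ * Complex.normSq (P.coeff k) : ℝ) : ℂ) := by
    rw [siteFun_apply, hlegs]
    push_cast
    refine Finset.sum_congr rfl fun k _ => ?_
    rw [coeff_aeval_X_mul_aeval_X, Polynomial.coeff_map, Complex.mul_conj]
  have hsum : 0 < ∑ k ∈ Finset.range (s.card + 1), (s.card.choose k : ℝ)⁻¹ * Complex.normSq (P.coeff k) := by
    refine Finset.sum_pos' (fun k _ => mul_nonneg (by positivity) (Complex.normSq_nonneg _))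
      ⟨P.natDegree, Finset.mem_range.mpr (by omega), mul_pos ?_ ?_⟩
    · have := Nat.choose_pos hdeg
      positivity
    · rw [Complex.normSq_pos]
      exact Polynomial.leadingCoeff_ne_zero.mpr hP0
  rw [siteFun_legsPoly_eq] at hre
  have h2 : ((s.card : ℝ) + 1) * siteDensity s r =
      ∑ k ∈ Finset.range (s.card + 1), (s.card.choose k : ℝ)⁻¹ * Complex.normSq (P.coeff k) := by
    exact_mod_cast hre
  rw [← h2] at hsum
  exact (pos_iff_pos_of_mul_pos hsum).mp (by positivity)

/-- A leg more, with a pure boundary condition. -/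
theorem norm_lt_of_forall_unit {D : ℝ} {N : BlochVector} (h : ∀ u : BlochVector, ‖u‖ = 1 → 0 < D + inner ℝ u N) :
    ‖N‖ < D := by
  by_cases hN : N = 0
  · obtain ⟨u, hu⟩ := exists_norm_eq BlochVector zero_le_one
    have := h u hu
    rw [hN, inner_zero_right] at this
    rw [hN, norm_zero]; linarith
  · have hn : ‖N‖ ≠ 0 := norm_ne_zero_iff.mpr hN
    have := h (-(‖N‖⁻¹ • N)) (by rw [norm_neg, norm_smul, norm_inv, norm_norm, inv_mul_cancel₀ hn])
    rw [inner_neg_left, inner_smul_left, real_inner_self_eq_norm_sq, conj_trivial, sq, ← mul_assoc,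
      inv_mul_cancel₀ hn, one_mul] at this
    linarith

/-- Legs are converted one at a time from mixed to pure. The density is affine in each message: if D
+ u·N > 0 for all unit vectors u, then ‖N‖ < D, and so D + r·N > 0 for every r in the unit ball.
Here s holds the pure legs and t the legs still to be converted. -/
theorem siteDensity_union_pos (t : Finset ι) : ∀ (s : Finset ι) (r : ι → BlochVector),
    Disjoint s t → (∀ i ∈ s, ‖r i‖ = 1) → (∀ i ∈ t, ‖r i‖ ≤ 1) → 0 < siteDensity (s ∪ t) r := by
  induction t using Finset.induction_on with
  | empty =>
    intro s r _ hs _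
    rw [Finset.union_empty]
    exact siteDensity_pos_of_norm_eq_one hs
  | insert i t hi ih =>
    intro s r hd hs ht
    rw [Finset.disjoint_insert_right] at hd
    have hnot : i ∉ s ∪ t := by simp [hi, hd.1]
    have hlt : ‖siteMoment (s ∪ t) r‖ < siteDensity (s ∪ t) r := by
      refine norm_lt_of_forall_unit fun u hu => ?_
      have h1 := ih (insert i s) (Function.update r i u)
        (by rw [Finset.disjoint_insert_left]; exact ⟨hi, hd.2⟩)
        (by
          intro j hj
          by_cases hji : j = i
          · rw [hji, Function.update_self, hu]
          · rw [Function.update_of_ne hji]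
            exact hs j ((Finset.mem_insert.mp hj).resolve_left hji))
        (by
          intro j hj
          rw [Function.update_of_ne (ne_of_mem_of_not_mem hj hi)]
          exact ht j (Finset.mem_insert_of_mem hj))
      rw [Finset.insert_union, siteDensity_insert hnot, Function.update_self] at h1
      have h2 := siteMoments_congr (s := s ∪ t) (r := Function.update r i u) (r' := r) fun j hj =>
        Function.update_of_ne (ne_of_mem_of_not_mem hj hnot) _ _
      rwa [h2.1, h2.2] at h1
    rw [Finset.union_insert, siteDensity_insert hnot]
    have h3 := abs_le.mp (abs_real_inner_le_norm (r i) (siteMoment (s ∪ t) r))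
    have h4 := ht i (Finset.mem_insert_self i t)
    nlinarith [norm_nonneg (siteMoment (s ∪ t) r), h3.1]

theorem siteDensity_pos {s : Finset ι} {r : ι → BlochVector} (hr : ∀ i ∈ s, ‖r i‖ ≤ 1) :
    0 < siteDensity s r := by
  have := siteDensity_union_pos s ∅ r (Finset.disjoint_empty_left s) (by simp) hr
  rwa [Finset.empty_union] at this

theorem norm_siteMoment_lt {s : Finset ι} {r : ι → BlochVector} (hr : ∀ i ∈ s, ‖r i‖ ≤ 1) :
    ‖siteMoment s r‖ < siteDensity s r := by
  obtain ⟨r', hr'⟩ : ∃ r' : Option ι → BlochVector, ∀ i, r' (some i) = r i :=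
    ⟨fun o => o.elim 0 r, fun _ => rfl⟩
  have hmap : ∀ q : Option ι → BlochVector, (∀ i, q (some i) = r i) →
      legsPoly (s.map Function.Embedding.some) q = legsPoly s r := by
    intro q hq
    rw [legsPoly, Finset.prod_map]
    exact Finset.prod_congr rfl fun i _ => by rw [Function.Embedding.some_apply, hq]
  have hm1 : ∀ q : Option ι → BlochVector, (∀ i, q (some i) = r i) →
      siteDensity (s.map Function.Embedding.some) q = siteDensity s r := by
    intro q hq
    rw [siteDensity, siteDensityAux, hmap q hq, Finset.card_map, siteDensity, siteDensityAux]
  have hm2 : ∀ q : Option ι → BlochVector, (∀ i, q (some i) = r i) →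
      siteMoment (s.map Function.Embedding.some) q = siteMoment s r := by
    intro q hq
    simp only [siteMoment, siteMomentAux, hmap q hq, Finset.card_map]
  refine norm_lt_of_forall_unit fun u hu => ?_
  -- The index `none` supplies a fresh leg for the unit vector u even when s exhausts the index
  -- type.
  obtain ⟨q, hq⟩ : ∃ q : Option ι → BlochVector, q = fun o => o.elim u r := ⟨_, rfl⟩
  have hq1 : ∀ i, q (some i) = r i := fun i => by rw [hq]; rfl
  have hnot : (none : Option ι) ∉ s.map Function.Embedding.some := by simp
  have h := siteDensity_insert hnot q
  have h0 : q none = u := by rw [hq]; rfl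
  rw [hm1 q hq1, hm2 q hq1, h0] at h
  rw [← h]
  refine siteDensity_pos fun j hj => ?_
  rcases (@Finset.mem_insert _ (_) _ _ _).mp hj with rfl | hj
  · rw [h0]; exact hu.le
  · obtain ⟨i, hi, rfl⟩ := Finset.mem_map.mp hj
    rw [Function.Embedding.some_apply, hq1]
    exact hr i hi

/-- With p = r·N, the difference of the squares of the two sides is at least 2D(p((μ+t)² - 1) + tμD)
+ ((μ+t)p)². Since |p| ≤ tμD, it is nonnegative as soon as |(μ+t)² - 1| ≤ 1, which is where the
bound 2 comes from. -/
theorem norm_add_smul_le {D μ t : ℝ} {N r : BlochVector} (hμ : 0 ≤ μ) (ht : 0 ≤ t) (hD : 0 ≤ D)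
    (hN : ‖N‖ ≤ μ * D) (hr : ‖r‖ ≤ t) (hu : (μ + t) ^ 2 ≤ 2) (hpos : 0 ≤ D + inner ℝ r N) :
    ‖N + D • r‖ ≤ (μ + t) * (D + inner ℝ r N) := by
  refine abs_le_of_sq_le_sq' ?_ (by positivity) |>.2
  have h1 : ‖N + D • r‖ ^ 2 = ‖N‖ ^ 2 + 2 * D * inner ℝ r N + D ^ 2 * ‖r‖ ^ 2 := by
    rw [norm_add_sq_real, inner_smul_right, norm_smul, Real.norm_of_nonneg hD, real_inner_comm]
    ring
  have h2 : |inner ℝ r N| ≤ t * (μ * D) :=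
    (abs_real_inner_le_norm r N).trans (mul_le_mul hr hN (norm_nonneg _) ht)
  have h3 : ‖N‖ ^ 2 ≤ (μ * D) ^ 2 := pow_le_pow_left₀ (norm_nonneg _) hN 2
  have h4 : ‖r‖ ^ 2 ≤ t ^ 2 := pow_le_pow_left₀ (norm_nonneg _) hr 2
  have h5 : |inner ℝ r N * ((μ + t) ^ 2 - 1)| ≤ t * (μ * D) := by
    rw [abs_mul]
    have : |(μ + t) ^ 2 - 1| ≤ 1 := abs_le.mpr ⟨by nlinarith [sq_nonneg (μ + t)], by linarith⟩
    nlinarith [abs_nonneg (inner ℝ r N), abs_nonneg ((μ + t) ^ 2 - 1)]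
  have h6 := (abs_le.mp h5).1
  rw [h1]
  generalize inner ℝ r N = p at *
  have h7 : D ^ 2 * ‖r‖ ^ 2 ≤ D ^ 2 * t ^ 2 := mul_le_mul_of_nonneg_left h4 (sq_nonneg D)
  have h8 : 0 ≤ 2 * D * (p * ((μ + t) ^ 2 - 1) + t * (μ * D)) :=
    mul_nonneg (by linarith) (by linarith)
  nlinarith [sq_nonneg ((μ + t) * p)]

/-- The contraction of boundary conditions by a site. -/
theorem norm_siteMoment_le {s : Finset ι} {r : ι → BlochVector} {t : ℝ} (ht : 0 ≤ t) (ht1 : t ≤ 1)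
    (hr : ∀ i ∈ s, ‖r i‖ ≤ t) (hu : (((s.card : ℝ) + 2) * t / 3) ^ 2 ≤ 2) :
    ‖siteMoment s r‖ ≤ (s.card : ℝ) * t / 3 * siteDensity s r := by
  induction s using Finset.strongInduction with
  | H s ih =>
  have h1 : ((s.card : ℝ) + 2) * ‖siteMoment s r‖ ≤
      ∑ i ∈ s, ((s.card : ℝ) + 2) * t / 3 * siteDensity s r := by
    rw [← Real.norm_of_nonneg (show (0 : ℝ) ≤ (s.card : ℝ) + 2 by positivity), ← norm_smul,
      siteMoment_eq]
    refine (norm_sum_le _ _).trans (Finset.sum_le_sum fun i hi => ?_)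
    have hcard : ((s.erase i).card : ℝ) + 1 = s.card := by
      exact_mod_cast Finset.card_erase_add_one hi
    have hr' : ∀ j ∈ s.erase i, ‖r j‖ ≤ t := fun j hj => hr j (Finset.mem_of_mem_erase hj)
    have hD' := siteDensity_pos fun j hj => (hr' j hj).trans ht1
    have hDs := siteDensity_pos fun j hj => (hr j hj).trans ht1
    have heq := siteDensity_insert (Finset.notMem_erase i s) r
    rw [Finset.insert_erase hi] at heq
    have hle : ((s.erase i).card : ℝ) + 2 ≤ s.card + 2 := by linarith
    have hih := ih _ (Finset.erase_ssubset hi) hr' (by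
      refine le_trans (pow_le_pow_left₀ (by positivity) ?_ 2) hu
      gcongr)
    -- This closes the induction without loss: each of the |s| terms is at most (|s|+2)t/3 times the
    -- density, and the recursion divides their sum by |s| + 2.
    have h2 : (((s.erase i).card : ℝ) * t / 3 + t) = ((s.card : ℝ) + 2) * t / 3 := by
      rw [← hcard]; ring
    have := norm_add_smul_le (by positivity) ht hD'.le hih (hr i hi) (by rw [h2]; exact hu)
      (by rw [← heq]; exact hDs.le)
    rw [h2, ← heq] at this
    rwa [Real.norm_of_nonneg (show (0 : ℝ) ≤ (s.card : ℝ) + 2 by positivity)]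
  rw [Finset.sum_const, nsmul_eq_mul] at h1
  have h3 : (0 : ℝ) < (s.card : ℝ) + 2 := by positivity
  refine le_of_mul_le_mul_left ?_ h3
  linarith

/-! ### Equal boundary conditions on all legs -/

/-- The normalization and the magnetization of a site with `n` legs which have the same boundary
condition `𝟙 + r · σ`, as functions of `q = ‖r‖ ^ 2`. -/
noncomputable def equalLegs (q : ℝ) : ℕ → ℝ × ℝ
  | 0 => (1, 0)
  | n + 1 => ((equalLegs q n).1 + q * (equalLegs q n).2,
      ((n : ℝ) + 1) * ((equalLegs q n).1 + (equalLegs q n).2) / ((n : ℝ) + 3))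

theorem siteMoments_equal {s : Finset ι} {r : ι → BlochVector} {b : BlochVector}
    (hr : ∀ i ∈ s, r i = b) : siteDensity s r = (equalLegs (‖b‖ ^ 2) s.card).1 ∧
      siteMoment s r = (equalLegs (‖b‖ ^ 2) s.card).2 • b := by
  obtain ⟨n, hn⟩ : ∃ n, n = s.card := ⟨_, rfl⟩
  rw [← hn]
  induction n generalizing s with
  | zero =>
    rw [Finset.card_eq_zero.mp hn.symm, siteDensity_empty]
    refine ⟨rfl, ?_⟩
    have h := siteMoment_eq (∅ : Finset ι) r
    rw [Finset.sum_empty, Finset.card_empty, smul_eq_zero] at h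
    rw [h.resolve_left (by norm_num)]
    exact (zero_smul ℝ b).symm
  | succ n ih =>
    have hcard : ∀ i ∈ s, n = (s.erase i).card := fun i hi => by
      rw [Finset.card_erase_of_mem hi]; omega
    have hih : ∀ i ∈ s, _ := fun i hi =>
      ih (s := s.erase i) (fun j hj => hr j (Finset.mem_of_mem_erase hj)) (hcard i hi)
    constructor
    · obtain ⟨i, hi⟩ := Finset.card_pos.mp (by omega : 0 < s.card)
      rw [← Finset.insert_erase hi, siteDensity_insert (Finset.notMem_erase i s), (hih i hi).1,
        (hih i hi).2, hr i hi, inner_smul_right, real_inner_self_eq_norm_sq, equalLegs, mul_comm]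
    · have h := siteMoment_eq s r
      rw [Finset.sum_congr rfl fun i hi => by
        rw [(hih i hi).1, (hih i hi).2, hr i hi, ← add_smul], Finset.sum_const, ← hn,
        ← Nat.cast_smul_eq_nsmul ℝ, smul_smul] at h
      have h3 : ((n : ℝ) + 3) ≠ 0 := by positivity
      have h4 : siteMoment s r = ((n : ℝ) + 3)⁻¹ • (((n + 1 : ℕ) : ℝ) + 2) • siteMoment s r := by
        rw [smul_smul]
        push_cast
        rw [show (n : ℝ) + 1 + 2 = n + 3 by ring, inv_mul_cancel₀ h3, one_smul]
      rw [h4, h, smul_smul, equalLegs]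
      congr 1
      push_cast
      ring

/-- The two identities are proved together because the recursion couples density and moment.
Clearing the powers of t keeps them valid at t = 0; for t ≠ 0 the density is the mean of (1 + ts)^n
over s in [-1, 1]. -/
theorem equalLegs_closed {t : ℝ} (n : ℕ) :
    2 * ((n : ℝ) + 1) * t * (equalLegs (t ^ 2) n).1 = (1 + t) ^ (n + 1) - (1 - t) ^ (n + 1) ∧
    2 * t ^ 3 * ((n : ℝ) + 1) * ((n : ℝ) + 2) * (equalLegs (t ^ 2) n).2 =
      ((n : ℝ) + 1) * t * ((1 + t) ^ (n + 1) + (1 - t) ^ (n + 1)) -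
        ((1 + t) ^ (n + 1) - (1 - t) ^ (n + 1)) := by
  induction n with
  | zero => constructor <;> simp [equalLegs] <;> ring
  | succ n ih =>
    obtain ⟨h1, h2⟩ := ih
    have hn1 : (n : ℝ) + 1 ≠ 0 := by positivity
    have hn3 : (n : ℝ) + 3 ≠ 0 := by positivity
    constructor
    · rw [equalLegs]
      refine mul_left_cancel₀ hn1 ?_
      push_cast
      rw [pow_succ (1 + t) (n + 1), pow_succ (1 - t) (n + 1)]
      linear_combination ((n : ℝ) + 2) * h1 + h2
    · rw [equalLegs]
      push_cast
      rw [pow_succ (1 + t) (n + 1), pow_succ (1 - t) (n + 1)]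
      have h3 : 2 * t ^ 3 * ((n : ℝ) + 1 + 1) * ((n : ℝ) + 1 + 2) * (((n : ℝ) + 1) *
          ((equalLegs (t ^ 2) n).1 + (equalLegs (t ^ 2) n).2) / ((n : ℝ) + 3)) =
          2 * t ^ 3 * ((n : ℝ) + 1) * ((n : ℝ) + 2) *
          ((equalLegs (t ^ 2) n).1 + (equalLegs (t ^ 2) n).2) := by
        field_simp
        ring
      rw [h3]
      linear_combination h2 + t ^ 2 * ((n : ℝ) + 2) * h1

theorem equalLegs_nonneg {q : ℝ} (hq : 0 ≤ q) (n : ℕ) :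
    0 < (equalLegs q n).1 ∧ 0 ≤ (equalLegs q n).2 := by
  induction n with
  | zero => simp [equalLegs]
  | succ n ih =>
    rw [equalLegs]
    have := ih.1
    have := ih.2
    constructor <;> positivity

theorem equalLegs_snd_pos {q : ℝ} (hq : 0 ≤ q) {n : ℕ} (hn : n ≠ 0) : 0 < (equalLegs q n).2 := by
  obtain ⟨m, rfl⟩ := Nat.exists_eq_succ_of_ne_zero hn
  have h := equalLegs_nonneg hq m
  rw [Nat.succ_eq_add_one, equalLegs]
  have := h.1
  have := h.2
  positivity

theorem equalLegs_zero (n : ℕ) : equalLegs 0 n = (1, (n : ℝ) / 3) := by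
  induction n with
  | zero => simp [equalLegs]
  | succ n ih =>
    rw [equalLegs, ih]
    refine Prod.ext (by simp) ?_
    have hn3 : (n : ℝ) + 3 ≠ 0 := by positivity
    push_cast
    field_simp
    ring

theorem continuous_equalLegs (n : ℕ) : Continuous fun q => equalLegs q n := by
  induction n with
  | zero => exact continuous_const
  | succ n ih =>
    have h1 := continuous_fst.comp ih
    have h2 := continuous_snd.comp ih
    refine Continuous.prodMk (h1.add (continuous_id.mul h2)) ?_
    exact (continuous_const.mul (h1.add h2)).div_const _

theorem mul_equalLegs_lt {b : ℝ} (hb : 0 ≤ b) (hb1 : b ≤ 1) (n : ℕ) :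
    b * (equalLegs (b ^ 2) n).2 < (equalLegs (b ^ 2) n).1 := by
  obtain ⟨v, hv⟩ := exists_norm_eq BlochVector hb
  have h := siteMoments_equal (s := (Finset.univ : Finset (Fin n))) (r := fun _ => v) (b := v)
    fun _ _ => rfl
  have h2 := norm_siteMoment_lt (s := (Finset.univ : Finset (Fin n))) (r := fun _ => v)
    fun _ _ => by rw [hv]; exact hb1
  rw [h.1, h.2, norm_smul, hv, Finset.card_univ, Fintype.card_fin,
    Real.norm_of_nonneg (equalLegs_nonneg (sq_nonneg b) n).2, mul_comm] at h2
  exact h2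

/-- With U and V the two components of `equalLegs`, a site multiplies a message of length b by V/U
in modulus and the chain behind it by c, so U = cV says that a cell preserves the length b. At b = 0
one has U - cV = 1 - cn/3 < 0; at b = c positivity gives bV < U. The bound b ≤ c keeps the length
b/c in front of the chain at most 1. -/
theorem exists_equalLegs_eq {c : ℝ} (hc : 0 < c) (hc1 : c ≤ 1) {n : ℕ} (hn : 3 < c * n) :
    ∃ b, 0 < b ∧ b ≤ c ∧ (equalLegs (b ^ 2) n).1 = c * (equalLegs (b ^ 2) n).2 := by
  have hcont : Continuous fun b : ℝ => (equalLegs (b ^ 2) n).1 - c * (equalLegs (b ^ 2) n).2 := by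
    have h := (continuous_equalLegs n).comp (continuous_pow (M := ℝ) 2)
    exact (continuous_fst.comp h).sub (continuous_const.mul (continuous_snd.comp h))
  have h0 : (equalLegs (0 ^ 2) n).1 - c * (equalLegs (0 ^ 2) n).2 < 0 := by
    rw [zero_pow two_ne_zero, equalLegs_zero]
    simp only
    linarith
  have h1 : 0 ≤ (equalLegs (c ^ 2) n).1 - c * (equalLegs (c ^ 2) n).2 := by
    linarith [mul_equalLegs_lt hc.le hc1 n]
  obtain ⟨b, ⟨hb0, hbc⟩, hb⟩ := intermediate_value_Icc hc.le hcont.continuousOn ⟨h0.le, h1⟩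
  refine ⟨b, hb0.lt_of_ne fun e => ?_, hbc, by simp only at hb; linarith⟩
  rw [← e] at hb
  simp only at hb
  linarith

end Positivity


/-! ### The transfer functions -/

section Transfer

open scoped Classical ComplexOrder

/-- The number of downs of a basis vector. -/
def numDowns {n : ℕ} (a : Fin n → Fin 2) : ℕ := ∑ i, (a i : ℕ)

theorem numUps_add_numDowns {n : ℕ} (a : Fin n → Fin 2) : numUps a + numDowns a = n := by
  have h : numUps a = ∑ i, if a i = 0 then 1 else 0 := by
    rw [numUps, Finset.card_filter]
  rw [h, numDowns, ← Finset.sum_add_distrib, Finset.sum_congr rfl (g := fun _ => 1)]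
  · simp
  · intro i _
    generalize a i = x
    fin_cases x <;> rfl

theorem siteWk_apply (n k : ℕ) (i : Fin 2) (a : Fin n → Fin 2) : siteWk n k i a =
    if numUps a + i = k then (-1) ^ (i : ℕ) * (((Real.sqrt ((n + 1).choose k : ℝ))⁻¹ : ℝ) : ℂ)
      else 0 := by
  fin_cases i <;> simp [siteWk, sitePk, Matrix.mul_apply, Fin.sum_univ_two]

/-- At most one k contributes, since the matrix element fixes the total number of ups of the site.
The two square roots then combine to the inverse binomial of `siteFun`. -/
theorem sum_siteWk_mul (n : ℕ) (i j : Fin 2) (a b : Fin n → Fin 2) :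
    ∑ k ∈ Finset.range (n + 2), siteWk n k i a * star (siteWk n k j b) =
      if numUps a + i = numUps b + j then
        (-1) ^ ((i : ℕ) + j) * (((n + 1).choose (numUps a + i) : ℕ) : ℂ)⁻¹ else 0 := by
  have ha := numUps_add_numDowns a
  have hi : (i : ℕ) < 2 := i.2
  rw [Finset.sum_eq_single (numUps a + i)]
  · rw [siteWk_apply, siteWk_apply, if_pos rfl]
    by_cases h : numUps a + (i : ℕ) = numUps b + j
    · rw [if_pos h, if_pos h.symm, star_mul', Complex.star_def, Complex.conj_ofReal, map_pow,
        map_neg, map_one, pow_add, mul_mul_mul_comm, ← Complex.ofReal_mul, ← mul_inv,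
        Real.mul_self_sqrt (by positivity)]
      push_cast
      rfl
    · rw [if_neg h, if_neg (Ne.symm h), star_zero, mul_zero]
  · intro k _ hk
    rw [siteWk_apply, if_neg hk.symm, zero_mul]
  · intro h
    exact absurd (Finset.mem_range.mpr (by omega)) h

theorem legPoly_eq_sum (Q : Matrix (Fin 2) (Fin 2) ℂ) : legPoly Q = ∑ s, ∑ t,
    MvPolynomial.C (Q s t) * ((-MvPolynomial.X 0) ^ (s : ℕ) * (-MvPolynomial.X 1) ^ (t : ℕ)) := by
  simp [legPoly, Fin.sum_univ_two]
  ring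

theorem prod_legPoly_eq_sum (n : ℕ) (Q : Fin n → Matrix (Fin 2) (Fin 2) ℂ) :
    ∏ i, legPoly (Q i) = ∑ a : Fin n → Fin 2, ∑ b : Fin n → Fin 2,
      MvPolynomial.C (∏ i, Q i (a i) (b i)) *
        ((-MvPolynomial.X 0) ^ numDowns a * (-MvPolynomial.X 1) ^ numDowns b) := by
  simp only [legPoly_eq_sum, Finset.prod_univ_sum, Fintype.piFinset_univ]
  refine Finset.sum_congr rfl fun a _ => Finset.sum_congr rfl fun b _ => ?_
  rw [Finset.prod_mul_distrib, Finset.prod_mul_distrib, map_prod, Finset.prod_pow_eq_pow_sum,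
    Finset.prod_pow_eq_pow_sum]
  rfl

theorem siteFun_pow_mul_pow (n : ℕ) (c : ℂ) {p q p' q' : ℕ} (hp : p' ≤ n + 1) :
    siteFun (n + 1) (MvPolynomial.C c * (MvPolynomial.X 0 ^ p' * MvPolynomial.X 1 ^ q') *
      ((-1) ^ p * (-1) ^ q)) =
      if p' = q' then (-1) ^ (p + q) * c * (((n + 1).choose p' : ℕ) : ℂ)⁻¹ else 0 := by
  have h : (MvPolynomial.C c * (MvPolynomial.X 0 ^ p' * MvPolynomial.X 1 ^ q') *
      ((-1) ^ p * (-1) ^ q) : MvPolynomial (Fin 2) ℂ) =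
      MvPolynomial.monomial (pairExpo p' q') ((-1) ^ (p + q) * c) := by
    rw [MvPolynomial.X_pow_eq_monomial, MvPolynomial.X_pow_eq_monomial, MvPolynomial.monomial_mul,
      MvPolynomial.C_mul_monomial, ← pow_add, mul_one, mul_one, pairExpo, mul_comm,
      show ((-1 : MvPolynomial (Fin 2) ℂ) ^ (p + q)) = MvPolynomial.C ((-1) ^ (p + q)) by simp,
      MvPolynomial.C_mul_monomial]
  rw [h, siteFun_monomial, pairExpo_apply_zero, pairExpo_apply_one]
  by_cases h' : p' = q'
  · rw [if_pos ⟨h', hp⟩, if_pos h']; ring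
  · rw [if_neg fun hh => h' hh.1, if_neg h']

theorem outgoing_apply (m : ℕ) (P : MvPolynomial (Fin 2) ℂ) (i j : Fin 2) : outgoing m P i j =
    siteFun m (MvPolynomial.X 0 ^ (1 - (i : ℕ)) * MvPolynomial.X 1 ^ (1 - (j : ℕ)) * P) := by
  fin_cases i <;> fin_cases j <;> simp [outgoing]

/-- The bridge from the transfer operator to the message formalism. Leg polynomials count downs
while W_k counts ups, so exponents correspond by p ↦ n + 1 - p, under which the binomials are
symmetric; the signs of the singlets have the same parity on both sides. -/
theorem siteTransfer_prod (n : ℕ) (Q : Fin n → Matrix (Fin 2) (Fin 2) ℂ) :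
    siteTransfer n (Matrix.of fun a b => ∏ i, Q i (a i) (b i)) =
      (2 / ((n : ℂ) + 2)) • outgoing (n + 1) (∏ i, legPoly (Q i)) := by
  rw [siteTransfer]
  congr 1
  ext i j
  rw [Matrix.sum_apply, outgoing_apply, prod_legPoly_eq_sum, Finset.mul_sum, map_sum]
  have h1 : ∀ k, (siteWk n k * (Matrix.of fun a b => ∏ i, Q i (a i) (b i) :
      Matrix (Fin n → Fin 2) (Fin n → Fin 2) ℂ) * (siteWk n k)ᴴ) i j =
      ∑ a : Fin n → Fin 2, ∑ b : Fin n → Fin 2,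
        (∏ i, Q i (a i) (b i)) * (siteWk n k i a * star (siteWk n k j b)) := by
    intro k
    rw [Matrix.mul_apply]
    simp only [Matrix.mul_apply, Finset.sum_mul, Matrix.of_apply, Matrix.conjTranspose_apply]
    rw [Finset.sum_comm]
    refine Finset.sum_congr rfl fun a _ => Finset.sum_congr rfl fun b _ => ?_
    ring
  simp only [h1]
  rw [Finset.sum_comm]
  refine Finset.sum_congr rfl fun a _ => ?_
  rw [Finset.sum_comm, Finset.mul_sum, map_sum]
  refine Finset.sum_congr rfl fun b _ => ?_
  rw [← Finset.mul_sum, sum_siteWk_mul]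
  have ha := numUps_add_numDowns a
  have hb := numUps_add_numDowns b
  have hi : (i : ℕ) < 2 := i.2
  have hj : (j : ℕ) < 2 := j.2
  have h2 : (MvPolynomial.X 0 ^ (1 - (i : ℕ)) * MvPolynomial.X 1 ^ (1 - (j : ℕ)) *
      (MvPolynomial.C (∏ i, Q i (a i) (b i)) *
        ((-MvPolynomial.X 0) ^ numDowns a * (-MvPolynomial.X 1) ^ numDowns b)) :
          MvPolynomial (Fin 2) ℂ) = MvPolynomial.C (∏ i, Q i (a i) (b i)) *
      (MvPolynomial.X 0 ^ (1 - (i : ℕ) + numDowns a) * MvPolynomial.X 1 ^ (1 - (j : ℕ) + numDowns b)) *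
      ((-1) ^ numDowns a * (-1) ^ numDowns b) := by
    rw [neg_pow (MvPolynomial.X 0 : MvPolynomial (Fin 2) ℂ), neg_pow (MvPolynomial.X 1 : MvPolynomial (Fin 2) ℂ), pow_add, pow_add]
    ring
  rw [h2, siteFun_pow_mul_pow n _ (by omega)]
  by_cases h : numUps a + (i : ℕ) = numUps b + j
  · rw [if_pos h, if_pos (by omega), ← Nat.choose_symm (show 1 - (i : ℕ) + numDowns a ≤ n + 1 by omega),
      show n + 1 - (1 - (i : ℕ) + numDowns a) = numUps a + i by omega]
    have h3 : ((-1 : ℂ)) ^ ((i : ℕ) + j) = (-1) ^ (numDowns a + numDowns b) := by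
      rw [neg_one_pow_eq_pow_mod_two, neg_one_pow_eq_pow_mod_two (numDowns a + numDowns b)]
      congr 1
      omega
    rw [h3]
    ring
  · rw [if_neg h, if_neg (by omega), mul_zero]

theorem siteTransfer_smul (n : ℕ) (c : ℂ) (M : Matrix (Fin n → Fin 2) (Fin n → Fin 2) ℂ) :
    siteTransfer n (c • M) = c • siteTransfer n M := by
  simp only [siteTransfer, Matrix.mul_smul, Matrix.smul_mul, ← Finset.smul_sum]
  rw [smul_comm]

theorem blochMatrix_smul (c : ℝ) (x : BlochVector) :
    blochMatrix (c • x) = 1 + (c : ℂ) • ∑ i, (x i : ℂ) • pauli i := by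
  rw [blochMatrix, Finset.smul_sum]
  simp only [PiLp.smul_apply, smul_eq_mul, Complex.ofReal_mul, mul_smul]

theorem outgoing_legsPoly_eq {ι : Type*} {s : Finset ι} {r : ι → BlochVector}
    (h : siteDensity s r ≠ 0) : outgoing (s.card + 1) (legsPoly s r) =
      (((s.card : ℂ) + 2) / 2 * siteDensity s r) •
        blochMatrix (-((siteDensity s r)⁻¹ • siteMoment s r)) := by
  rw [outgoing_legsPoly, ← neg_smul, blochMatrix_smul, mul_smul]
  congr 1
  rw [smul_add, smul_smul, Complex.ofReal_neg, Complex.ofReal_inv, mul_neg,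
    mul_inv_cancel₀ (by exact_mod_cast h), neg_one_smul, sub_eq_add_neg]

theorem siteTransfer_productBoundary (n : ℕ) (x : BlochVector) :
    siteTransfer n (productBoundary n x) = ((equalLegs (‖x‖ ^ 2) n).1 : ℂ) •
      blochMatrix (-(((equalLegs (‖x‖ ^ 2) n).2 / (equalLegs (‖x‖ ^ 2) n).1) • x)) := by
  have h := siteMoments_equal (s := (Finset.univ : Finset (Fin n))) (r := fun _ => x) (b := x)
    fun _ _ => rfl
  have hpos := (equalLegs_nonneg (sq_nonneg ‖x‖) n).1.ne'
  have ho := outgoing_legsPoly_eq (s := (Finset.univ : Finset (Fin n))) (r := fun _ => x)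
    (by rw [h.1, Finset.card_univ, Fintype.card_fin]; exact hpos)
  rw [h.1, h.2, Finset.card_univ, Fintype.card_fin] at ho
  rw [productBoundary, siteTransfer_prod n fun _ => blochMatrix x]
  rw [legsPoly] at ho
  rw [ho, smul_smul, smul_smul]
  have := natCast_add_two_ne_zero n
  congr 1
  · field_simp
  · rw [div_eq_inv_mul]

theorem chainTransfer_blochMatrix (x : BlochVector) :
    chainTransfer (blochMatrix x) = blochMatrix (-((3 : ℝ)⁻¹ • x)) := by
  have h : (Matrix.of fun a b => blochMatrix x (a 0) (b 0) :
      Matrix (Fin 1 → Fin 2) (Fin 1 → Fin 2) ℂ) = productBoundary 1 x := by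
    ext a b
    simp [productBoundary]
  rw [chainTransfer, h, siteTransfer_productBoundary]
  norm_num [equalLegs]

theorem chainTransfer_smul (c : ℂ) (M : Matrix (Fin 2) (Fin 2) ℂ) :
    chainTransfer (c • M) = c • chainTransfer M := by
  rw [chainTransfer, chainTransfer, ← siteTransfer_smul]
  rfl

theorem chainTransfer_iterate (g : ℕ) (c : ℂ) (x : BlochVector) :
    chainTransfer^[g] (c • blochMatrix x) = c • blochMatrix ((-(3 : ℝ)⁻¹) ^ g • x) := by
  induction g with
  | zero => simp
  | succ g ih =>
    rw [Function.iterate_succ_apply', ih, chainTransfer_smul, chainTransfer_blochMatrix, smul_smul,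
      ← neg_smul, pow_succ']
    congr 3
    ring

theorem trace_blochMatrix (x : BlochVector) : (blochMatrix x).trace = 2 := by
  rw [blochMatrix_eq, Matrix.trace_fin_two]
  simp
  ring

theorem normalizedCellImage_eq (d g : ℕ) (x : BlochVector) :
    normalizedCellImage d g x = blochMatrix (((-(3 : ℝ)⁻¹) ^ g *
      -((equalLegs (‖x‖ ^ 2) (d - 1)).2 / (equalLegs (‖x‖ ^ 2) (d - 1)).1)) • x) := by
  have hpos := (equalLegs_nonneg (sq_nonneg ‖x‖) (d - 1)).1.ne'
  have hpos' : ((equalLegs (‖x‖ ^ 2) (d - 1)).1 : ℂ) ≠ 0 := by exact_mod_cast hpos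
  rw [normalizedCellImage, cellTransfer, siteTransfer_productBoundary, chainTransfer_iterate,
    Matrix.trace_smul, trace_blochMatrix, smul_smul, smul_eq_mul, ← neg_smul, smul_smul]
  rw [show (2 : ℂ) / ((equalLegs (‖x‖ ^ 2) (d - 1)).1 * 2) * (equalLegs (‖x‖ ^ 2) (d - 1)).1 = 1 by
    field_simp, one_smul]

/-- The matrix x·σ is self-adjoint with square ‖x‖²; the C*-identity gives its norm. -/
theorem norm_toEuclideanCLM_pauli (x : BlochVector) :
    ‖Matrix.toEuclideanCLM (n := Fin 2) (𝕜 := ℂ) (blochMatrix x - 1)‖ = ‖x‖ := by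
  have hI := Complex.I_mul_I
  have hsq : x 0 ^ 2 + x 1 ^ 2 + x 2 ^ 2 = ‖x‖ ^ 2 := by
    rw [EuclideanSpace.norm_sq_eq, Fin.sum_univ_three]
    simp
  have hsq' : (x 0 : ℂ) ^ 2 + (x 1 : ℂ) ^ 2 + (x 2 : ℂ) ^ 2 = ((‖x‖ ^ 2 : ℝ) : ℂ) := by
    rw [← hsq]; push_cast; rfl
  have h : star (blochMatrix x - 1) * (blochMatrix x - 1) =
      ((‖x‖ ^ 2 : ℝ) : ℂ) • (1 : Matrix (Fin 2) (Fin 2) ℂ) := by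
    rw [blochMatrix_eq, ← hsq', Matrix.star_eq_conjTranspose]
    ext i j
    fin_cases i <;> fin_cases j <;> simp [Matrix.mul_apply, Fin.sum_univ_two] <;>
      first | ring1 | linear_combination -(x 1 : ℂ) ^ 2 * hI
  have h2 := CStarRing.norm_star_mul_self
    (x := Matrix.toEuclideanCLM (n := Fin 2) (𝕜 := ℂ) (blochMatrix x - 1))
  rw [← map_star, ← map_mul, h, map_smul, map_one, norm_smul, norm_one, mul_one, Complex.norm_real,
    Real.norm_of_nonneg (sq_nonneg _), sq] at h2
  exact (mul_self_inj_of_nonneg (norm_nonneg _) (norm_nonneg _)).mp h2.symm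

theorem cellTransferFunction_eq {d : ℕ} (g : ℕ) (hd : 2 ≤ d) (x : BlochVector) :
    cellTransferFunction d g x = ((3 : ℝ) ^ g)⁻¹ * transferF d ‖x‖ := by
  have hpos := (equalLegs_nonneg (sq_nonneg ‖x‖) (d - 1))
  have h1 : cellTransferFunction d g x = -(((3 : ℝ) ^ g)⁻¹ *
      ((equalLegs (‖x‖ ^ 2) (d - 1)).2 / (equalLegs (‖x‖ ^ 2) (d - 1)).1) * ‖x‖) := by
    rw [cellTransferFunction, normalizedCellImage_eq d g, norm_toEuclideanCLM_pauli, norm_smul,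
      norm_mul, norm_neg, norm_pow, norm_neg, norm_inv,
      Real.norm_of_nonneg (show (0 : ℝ) ≤ 3 by norm_num), Real.norm_of_nonneg (div_nonneg hpos.2 hpos.1.le),
      inv_pow]
  rw [h1, mul_assoc, ← mul_neg]
  congr 1
  obtain ⟨m, rfl⟩ : ∃ m, d = m + 1 := ⟨d - 1, by omega⟩
  rw [Nat.add_sub_cancel] at *
  obtain ⟨t, ht⟩ : ∃ t, t = ‖x‖ := ⟨_, rfl⟩
  rw [← ht] at hpos ⊢
  rw [transferF]
  congr 1
  by_cases ht0 : t = 0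
  · simp [ht0]
  · obtain ⟨h2, h3⟩ := equalLegs_closed (t := t) m
    have hnum : ((m + 1 : ℕ) + 1 : ℝ) * t * ((1 + t) ^ (m + 1) + (1 - t) ^ (m + 1)) -
        ((1 + t) ^ (m + 1 + 1) - (1 - t) ^ (m + 1 + 1)) =
        2 * t ^ 3 * ((m : ℝ) + 1) * ((m : ℝ) + 2) * (equalLegs (t ^ 2) m).2 := by
      rw [h3, pow_succ (1 + t) (m + 1), pow_succ (1 - t) (m + 1)]
      push_cast
      ring
    rw [hnum, ← h2]
    have := hpos.1.ne'
    have hm : (m : ℝ) + 1 ≠ 0 := by positivity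
    have hm2 : (m : ℝ) + 2 ≠ 0 := by positivity
    push_cast
    rw [show (m : ℝ) + 1 + 1 = m + 2 by ring]
    field_simp

end Transfer


/-! ### Trees -/

section Tree

variable {W : Type*} {G : SimpleGraph W}

/-- Two neighbours of y nearer to u would extend to two different paths from u to y. -/
theorem SimpleGraph.IsTree.eq_of_adj_of_dist_add_one (hG : G.IsTree) {u y z z' : W} (hz : G.Adj y z)
    (hz' : G.Adj y z') (hd : G.dist u z + 1 = G.dist u y) (hd' : G.dist u z' + 1 = G.dist u y) :
    z = z' := by
  obtain ⟨p, -, hp⟩ := hG.connected.exists_path_of_dist u z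
  obtain ⟨p', -, hp'⟩ := hG.connected.exists_path_of_dist u z'
  have h1 : (p.concat hz.symm).IsPath := (p.concat hz.symm).isPath_of_length_eq_dist (by
    rw [SimpleGraph.Walk.length_concat, hp, hd])
  have h2 : (p'.concat hz'.symm).IsPath := (p'.concat hz'.symm).isPath_of_length_eq_dist (by
    rw [SimpleGraph.Walk.length_concat, hp', hd'])
  have h3 := (hG.existsUnique_path u y).unique h1 h2
  have h4 := congrArg SimpleGraph.Walk.penultimate h3
  simpa using h4

theorem SimpleGraph.IsTree.exists_adj_dist_add_one (hG : G.IsTree) {u y : W} (h : y ≠ u) :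
    ∃ z, G.Adj y z ∧ G.dist u z + 1 = G.dist u y := by
  obtain ⟨p, -, hp⟩ := hG.connected.exists_path_of_dist u y
  have hnil : ¬ p.Nil := SimpleGraph.Walk.not_nil_of_ne h.symm
  refine ⟨p.penultimate, (p.adj_penultimate hnil).symm, ?_⟩
  have h1 : G.dist u p.penultimate ≤ p.dropLast.length := SimpleGraph.dist_le _
  have h2 : p.dropLast.length + 1 = p.length := by
    conv_rhs => rw [← p.concat_dropLast (p.adj_penultimate hnil)]
    rw [SimpleGraph.Walk.length_concat]
  have h3 := hG.dist_eq_dist_add_one_of_adj u (p.adj_penultimate hnil)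
  omega

/-- At a vertex of maximal height on a cycle, its two neighbours on the cycle are different and not
higher, contrary to uniqueness. -/
theorem SimpleGraph.isAcyclic_of_height (ht : W → ℕ)
    (huniq : ∀ x y z, G.Adj x y → G.Adj x z → ht y ≤ ht x → ht z ≤ ht x → y = z) :
    G.IsAcyclic := by
  classical
  intro v c hc
  obtain ⟨u, hu, hmax⟩ := Finset.exists_max_image c.support.toFinset ht
    ⟨v, List.mem_toFinset.mpr c.start_mem_support⟩
  have hu' : u ∈ c.support := List.mem_toFinset.mp hu
  have hc' := hc.rotate hu'
  have hmem : ∀ w ∈ (c.rotate u hu').support, ht w ≤ ht u := by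
    intro w hw
    exact hmax w (List.mem_toFinset.mpr ((SimpleGraph.Walk.mem_support_rotate_iff _ _ _).mp hw))
  have hnil := hc'.not_nil
  exact hc'.snd_ne_penultimate (huniq u _ _ ((c.rotate u hu').adj_snd hnil)
    ((c.rotate u hu').adj_penultimate hnil).symm
    (hmem _ (SimpleGraph.Walk.getVert_mem_support _ _))
    (hmem _ (SimpleGraph.Walk.getVert_mem_support _ _)))

theorem SimpleGraph.isTree_of_height (ht : W → ℕ) (v₀ : W)
    (hdown : ∀ x, x ≠ v₀ → ∃ y, G.Adj x y ∧ ht y < ht x)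
    (huniq : ∀ x y z, G.Adj x y → G.Adj x z → ht y ≤ ht x → ht z ≤ ht x → y = z) :
    G.IsTree := by
  have hreach : ∀ n x, ht x = n → G.Reachable x v₀ := by
    intro n
    induction n using Nat.strong_induction_on with
    | _ n ih =>
    intro x hx
    by_cases h : x = v₀
    · rw [h]
    · obtain ⟨y, hy, hlt⟩ := hdown x h
      exact hy.reachable.trans (ih _ (hx ▸ hlt) y rfl)
  have : Nonempty W := ⟨v₀⟩
  exact ⟨⟨fun x y => (hreach _ x rfl).trans (hreach _ y rfl).symm⟩,
    SimpleGraph.isAcyclic_of_height ht huniq⟩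

end Tree

/-! ### The geometry of the decorated tree -/

section Decorate

variable {V : Type*} (T : SimpleGraph V) (g : ℕ)

theorem decorationPoint_zero (e : T.edgeSet) :
    decorationPoint T g e 0 = Sum.inl (Quot.out (e : Sym2 V)).1 := by
  simp [decorationPoint]

theorem decorationPoint_succ (e : T.edgeSet) (j : Fin g) :
    decorationPoint T g e (j + 1) = Sum.inr (e, j) := by
  simp [decorationPoint]

theorem decorationPoint_last (e : T.edgeSet) :
    decorationPoint T g e (g + 1) = Sum.inl (Quot.out (e : Sym2 V)).2 := by
  simp [decorationPoint]

theorem decorationPoint_cases {i : ℕ} (hi : i ≤ g + 1) :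
    i = 0 ∨ (∃ j : Fin g, i = j + 1) ∨ i = g + 1 := by
  by_cases h0 : i = 0
  · exact Or.inl h0
  · by_cases h1 : i = g + 1
    · exact Or.inr (Or.inr h1)
    · exact Or.inr (Or.inl ⟨⟨i - 1, by omega⟩, by simp only; omega⟩)

theorem adj_out (e : T.edgeSet) : T.Adj (Quot.out (e : Sym2 V)).1 (Quot.out (e : Sym2 V)).2 := by
  have h : s((Quot.out (e : Sym2 V)).1, (Quot.out (e : Sym2 V)).2) = (e : Sym2 V) :=
    Quot.out_eq (e : Sym2 V)
  rw [← SimpleGraph.mem_edgeSet, h]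
  exact e.2

theorem out_eq_or {v w : V} : Quot.out s(v, w) = (v, w) ∨ Quot.out s(v, w) = (w, v) := by
  have h : s((Quot.out s(v, w)).1, (Quot.out s(v, w)).2) = s(v, w) := Quot.out_eq s(v, w)
  rw [Sym2.eq_iff] at h
  exact h.imp (fun h => Prod.ext h.1 h.2) fun h => Prod.ext h.1 h.2

theorem decorationPoint_eq_inr {e e₀ : T.edgeSet} {i : ℕ} {j : Fin g} (hi : i ≤ g + 1)
    (h : decorationPoint T g e i = Sum.inr (e₀, j)) : e = e₀ ∧ i = j + 1 := by
  rcases decorationPoint_cases g hi with rfl | ⟨k, rfl⟩ | rfl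
  · rw [decorationPoint_zero] at h; exact absurd h (by simp)
  · rw [decorationPoint_succ] at h
    simp only [Sum.inr.injEq, Prod.mk.injEq] at h
    exact ⟨h.1, by rw [h.2]⟩
  · rw [decorationPoint_last] at h; exact absurd h (by simp)

theorem decorationPoint_injective (e : T.edgeSet) {i i' : ℕ} (hi : i ≤ g + 1) (hi' : i' ≤ g + 1)
    (h : decorationPoint T g e i = decorationPoint T g e i') : i = i' := by
  have hne := (adj_out T e).ne
  rcases decorationPoint_cases g hi with rfl | ⟨k, rfl⟩ | rfl
  · rcases decorationPoint_cases g hi' with rfl | ⟨k', rfl⟩ | rfl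
    · rfl
    · rw [decorationPoint_zero, decorationPoint_succ] at h; exact absurd h (by simp)
    · rw [decorationPoint_zero, decorationPoint_last] at h
      exact absurd (Sum.inl_injective h) hne
  · rw [decorationPoint_succ] at h
    exact ((decorationPoint_eq_inr T g hi' h.symm).2).symm
  · rcases decorationPoint_cases g hi' with rfl | ⟨k', rfl⟩ | rfl
    · rw [decorationPoint_zero, decorationPoint_last] at h
      exact absurd (Sum.inl_injective h) hne.symm
    · rw [decorationPoint_last, decorationPoint_succ] at h; exact absurd h (by simp)
    · rfl

theorem decorate_adj {x y : V ⊕ T.edgeSet × Fin g} : (decorate T g).Adj x y ↔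
    ∃ e : T.edgeSet, ∃ i ≤ g, (x = decorationPoint T g e i ∧ y = decorationPoint T g e (i + 1)) ∨
      (y = decorationPoint T g e i ∧ x = decorationPoint T g e (i + 1)) := by
  rw [decorate, SimpleGraph.fromRel_adj]
  constructor
  · rintro ⟨-, ⟨e, i, hi, h⟩ | ⟨e, i, hi, h⟩⟩
    · exact ⟨e, i, hi, Or.inl h⟩
    · exact ⟨e, i, hi, Or.inr h⟩
  · rintro ⟨e, i, hi, ⟨rfl, rfl⟩ | ⟨rfl, rfl⟩⟩
    · refine ⟨fun h => ?_, Or.inl ⟨e, i, hi, rfl, rfl⟩⟩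
      have := decorationPoint_injective T g e (by omega) (by omega) h
      omega
    · refine ⟨fun h => ?_, Or.inr ⟨e, i, hi, rfl, rfl⟩⟩
      have := decorationPoint_injective T g e (by omega) (by omega) h
      omega

theorem decorate_adj_inr {e : T.edgeSet} {j : Fin g} {y : V ⊕ T.edgeSet × Fin g} :
    (decorate T g).Adj (Sum.inr (e, j)) y ↔
      y = decorationPoint T g e j ∨ y = decorationPoint T g e (j + 2) := by
  have hj := j.2
  rw [decorate_adj]
  constructor
  · rintro ⟨e', i, hi, ⟨h, rfl⟩ | ⟨rfl, h⟩⟩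
    · obtain ⟨rfl, rfl⟩ := decorationPoint_eq_inr T g (by omega) h.symm
      exact Or.inr rfl
    · obtain ⟨rfl, hij⟩ := decorationPoint_eq_inr T g (by omega) h.symm
      rw [Nat.add_right_cancel hij]
      exact Or.inl rfl
  · rintro (rfl | rfl)
    · exact ⟨e, j, by omega, Or.inr ⟨rfl, (decorationPoint_succ T g e j).symm⟩⟩
    · exact ⟨e, j + 1, by omega, Or.inl ⟨(decorationPoint_succ T g e j).symm, rfl⟩⟩

open scoped Classical in
/-- The neighbour of the vertex `v` in the decorated tree in the direction of its neighbour `w`. -/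
noncomputable def decorateToward {v w : V} (h : T.Adj v w) : V ⊕ T.edgeSet × Fin g :=
  if Quot.out s(v, w) = (v, w) then decorationPoint T g ⟨s(v, w), h⟩ 1
  else decorationPoint T g ⟨s(v, w), h⟩ g

theorem decorateToward_cases {v w : V} (h : T.Adj v w) :
    (Quot.out s(v, w) = (v, w) ∧ decorateToward T g h = decorationPoint T g ⟨s(v, w), h⟩ 1) ∨
    (Quot.out s(v, w) = (w, v) ∧ decorateToward T g h = decorationPoint T g ⟨s(v, w), h⟩ g) := by
  rw [decorateToward]
  split_ifs with h1
  · exact Or.inl ⟨h1, rfl⟩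
  · exact Or.inr ⟨out_eq_or.resolve_left h1, rfl⟩

theorem decorate_adj_inl {v : V} {y : V ⊕ T.edgeSet × Fin g} :
    (decorate T g).Adj (Sum.inl v) y ↔ ∃ w, ∃ h : T.Adj v w, y = decorateToward T g h := by
  rw [decorate_adj]
  constructor
  · rintro ⟨e, i, hi, ⟨h, rfl⟩ | ⟨rfl, h⟩⟩
    · have hi0 : i = 0 := by
        rcases decorationPoint_cases g (show i ≤ g + 1 by omega) with h0 | ⟨k, rfl⟩ | h0
        · exact h0
        · rw [decorationPoint_succ] at h; exact absurd h (by simp)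
        · omega
      subst hi0
      rw [decorationPoint_zero] at h
      have hv := Sum.inl_injective h
      have he : s(v, (Quot.out (e : Sym2 V)).2) = (e : Sym2 V) := by
        rw [hv]; exact Quot.out_eq (e : Sym2 V)
      have hadj : T.Adj v (Quot.out (e : Sym2 V)).2 := by rw [hv]; exact adj_out T e
      refine ⟨_, hadj, ?_⟩
      rcases decorateToward_cases T g hadj with ⟨h1, h2⟩ | ⟨h1, h2⟩
      · rw [h2]
        congr 1
        exact Subtype.ext he.symm
      · rw [he] at h1
        have := congrArg Prod.snd h1
        simp only at this
        exact absurd this.symm hadj.ne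
    · have hi0 : i = g := by
        rcases decorationPoint_cases g (show i + 1 ≤ g + 1 by omega) with h0 | ⟨k, hk⟩ | h0
        · omega
        · rw [hk, decorationPoint_succ] at h; exact absurd h (by simp)
        · omega
      subst hi0
      rw [decorationPoint_last] at h
      have hv := Sum.inl_injective h
      have he : s(v, (Quot.out (e : Sym2 V)).1) = (e : Sym2 V) := by
        rw [hv, Sym2.eq_swap]; exact Quot.out_eq (e : Sym2 V)
      have hadj : T.Adj v (Quot.out (e : Sym2 V)).1 := by rw [hv]; exact (adj_out T e).symm
      refine ⟨_, hadj, ?_⟩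
      rcases decorateToward_cases T i hadj with ⟨h1, h2⟩ | ⟨h1, h2⟩
      · rw [he] at h1
        have := congrArg Prod.fst h1
        simp only at this
        exact absurd this.symm hadj.ne
      · rw [h2]
        congr 1
        exact Subtype.ext he.symm
  · rintro ⟨w, h, rfl⟩
    rcases decorateToward_cases T g h with ⟨h1, h2⟩ | ⟨h1, h2⟩
    · refine ⟨⟨s(v, w), h⟩, 0, by omega, Or.inl ⟨?_, h2⟩⟩
      rw [decorationPoint_zero]
      simp only [h1]
    · refine ⟨⟨s(v, w), h⟩, g, le_rfl, Or.inr ⟨h2, ?_⟩⟩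
      rw [decorationPoint_last]
      simp only [h1]

theorem decorateToward_injective {v w w' : V} (h : T.Adj v w) (h' : T.Adj v w')
    (heq : decorateToward T g h = decorateToward T g h') : w = w' := by
  by_contra hne
  have hedge : (⟨s(v, w), h⟩ : T.edgeSet) ≠ ⟨s(v, w'), h'⟩ := by
    intro e
    exact hne (Sym2.congr_right.mp (Subtype.ext_iff.mp e))
  have key : ∀ (e e' : T.edgeSet) (i i' : ℕ), i ≤ g + 1 → i' ≤ g + 1 → 0 < i → i ≤ g →
      decorationPoint T g e i = decorationPoint T g e' i' → e = e' := by
    intro e e' i i' hi hi' h0 h1 hp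
    obtain ⟨j, rfl⟩ : ∃ j : Fin g, i = j + 1 := ⟨⟨i - 1, by omega⟩, by simp only; omega⟩
    rw [decorationPoint_succ] at hp
    exact (decorationPoint_eq_inr T g hi' hp.symm).1.symm
  -- Without new sites the neighbour towards w is w itself. Otherwise it is an interior point of a
  -- chain, which determines its edge.
  rcases Nat.eq_zero_or_pos g with hg | hg
  · subst hg
    have hend : ∀ {w : V} (h : T.Adj v w), decorateToward T 0 h = Sum.inl w := by
      intro w h
      rcases decorateToward_cases T 0 h with ⟨h1, h2⟩ | ⟨h1, h2⟩
      · rw [h2, decorationPoint_last T 0]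
        simp only [h1]
      · rw [h2, decorationPoint_zero T 0]
        simp only [h1]
    rw [hend, hend] at heq
    exact hne (Sum.inl_injective heq)
  · rcases decorateToward_cases T g h with ⟨-, h2⟩ | ⟨-, h2⟩ <;>
    rcases decorateToward_cases T g h' with ⟨-, h3⟩ | ⟨-, h3⟩ <;>
    · rw [h2, h3] at heq
      exact hedge (key _ _ _ _ (by omega) (by omega) (by omega) (by omega) heq)

theorem degree_decorate_inl [T.LocallyFinite] (v : V) :
    (decorate T g).degree (Sum.inl v) = T.degree v := by
  rw [← SimpleGraph.card_neighborSet_eq_degree, ← SimpleGraph.card_neighborSet_eq_degree]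
  refine (Fintype.card_of_bijective (f := fun w : T.neighborSet v =>
    (⟨decorateToward T g w.2, (decorate_adj_inl T g).mpr ⟨w, w.2, rfl⟩⟩ :
      (decorate T g).neighborSet (Sum.inl v))) ⟨?_, ?_⟩).symm
  · intro w w' h
    exact Subtype.ext (decorateToward_injective T g w.2 w'.2 (Subtype.ext_iff.mp h))
  · rintro ⟨y, hy⟩
    obtain ⟨w, h, rfl⟩ := (decorate_adj_inl T g).mp hy
    exact ⟨⟨w, h⟩, rfl⟩

theorem decorationPoint_ne_add_two (e : T.edgeSet) (j : Fin g) :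
    decorationPoint T g e j ≠ decorationPoint T g e (j + 2) := by
  intro h
  have := decorationPoint_injective T g e (by omega) (by omega) h
  omega

theorem degree_decorate_inr [T.LocallyFinite] (e : T.edgeSet) (j : Fin g) :
    (decorate T g).degree (Sum.inr (e, j)) = 2 := by
  classical
  have h : (decorate T g).neighborFinset (Sum.inr (e, j)) =
      {decorationPoint T g e j, decorationPoint T g e (j + 2)} := by
    ext y
    rw [SimpleGraph.mem_neighborFinset, decorate_adj_inr]
    simp
  rw [← SimpleGraph.card_neighborFinset_eq_degree, h,
    Finset.card_pair (decorationPoint_ne_add_two T g e j)]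

/-- The height of a vertex of the decorated tree over the vertex `v₀` of the tree. -/
noncomputable def decorateHeight (v₀ : V) : V ⊕ T.edgeSet × Fin g → ℕ
  | Sum.inl v => (g + 1) * T.dist v₀ v
  | Sum.inr (e, j) =>
    if T.dist v₀ (Quot.out (e : Sym2 V)).1 < T.dist v₀ (Quot.out (e : Sym2 V)).2 then
      (g + 1) * T.dist v₀ (Quot.out (e : Sym2 V)).1 + (j + 1)
    else (g + 1) * T.dist v₀ (Quot.out (e : Sym2 V)).2 + (g + 1 - (j + 1))

variable {T}

/-- Heights grow by one per step along a chain, starting at the endpoint nearer to v₀. The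
definition fixes them at vertices and at new sites separately; a single formula makes the tree
criterion applicable. -/
theorem decorateHeight_decorationPoint (hT : T.IsTree) (v₀ : V) (e : T.edgeSet) {i : ℕ}
    (hi : i ≤ g + 1) : decorateHeight T g v₀ (decorationPoint T g e i) =
      if T.dist v₀ (Quot.out (e : Sym2 V)).1 < T.dist v₀ (Quot.out (e : Sym2 V)).2 then
        (g + 1) * T.dist v₀ (Quot.out (e : Sym2 V)).1 + i
      else (g + 1) * T.dist v₀ (Quot.out (e : Sym2 V)).2 + (g + 1 - i) := by
  have hd := hT.dist_eq_dist_add_one_of_adj v₀ (adj_out T e)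
  rcases decorationPoint_cases g hi with rfl | ⟨j, rfl⟩ | rfl
  · rw [decorationPoint_zero, decorateHeight]
    split_ifs with h
    · rfl
    · rw [show T.dist v₀ (Quot.out (e : Sym2 V)).1 = T.dist v₀ (Quot.out (e : Sym2 V)).2 + 1 by omega]
      rfl
  · rw [decorationPoint_succ, decorateHeight]
  · rw [decorationPoint_last, decorateHeight]
    split_ifs with h
    · rw [show T.dist v₀ (Quot.out (e : Sym2 V)).2 = T.dist v₀ (Quot.out (e : Sym2 V)).1 + 1 by omega]
      rfl
    · simp

theorem decorateHeight_toward (hT : T.IsTree) (v₀ : V) {v w : V} (h : T.Adj v w) :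
    (T.dist v₀ v = T.dist v₀ w + 1 ∧ decorateHeight T g v₀ (decorateToward T g h) + 1 =
      decorateHeight T g v₀ (Sum.inl v)) ∨
    (T.dist v₀ w = T.dist v₀ v + 1 ∧ decorateHeight T g v₀ (decorateToward T g h) =
      decorateHeight T g v₀ (Sum.inl v) + 1) := by
  have hd := hT.dist_eq_dist_add_one_of_adj v₀ h
  have hv : decorateHeight T g v₀ (Sum.inl v) = (g + 1) * T.dist v₀ v := rfl
  rw [hv]
  rcases decorateToward_cases T g h with ⟨h1, h2⟩ | ⟨h1, h2⟩
  · rw [h2, decorateHeight_decorationPoint g hT v₀ _ (by omega)]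
    simp only [h1]
    rcases hd with hd | hd
    · refine Or.inl ⟨hd, ?_⟩
      rw [if_neg (by omega), hd, mul_add]
      omega
    · refine Or.inr ⟨hd, ?_⟩
      rw [if_pos (by omega)]
  · rw [h2, decorateHeight_decorationPoint g hT v₀ _ (by omega)]
    simp only [h1]
    rcases hd with hd | hd
    · refine Or.inl ⟨hd, ?_⟩
      rw [if_pos (by omega), hd, mul_add]
      omega
    · refine Or.inr ⟨hd, ?_⟩
      rw [if_neg (by omega)]
      omega

theorem isTree_decorate (hT : T.IsTree) : (decorate T g).IsTree := by
  obtain ⟨v₀⟩ := hT.connected.nonempty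
  have hpt := fun (e : T.edgeSet) {i : ℕ} (hi : i ≤ g + 1) =>
    decorateHeight_decorationPoint g hT v₀ e hi
  refine SimpleGraph.isTree_of_height (decorateHeight T g v₀) (Sum.inl v₀) ?_ ?_
  · rintro (v | ⟨e, j⟩) hx
    · have hv : v ≠ v₀ := fun h => hx (by rw [h])
      obtain ⟨w, hw, hd⟩ := hT.exists_adj_dist_add_one hv
      refine ⟨decorateToward T g hw, (decorate_adj_inl T g).mpr ⟨w, hw, rfl⟩, ?_⟩
      rcases decorateHeight_toward g hT v₀ hw with ⟨-, h⟩ | ⟨h, -⟩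
      · omega
      · omega
    · have hj := j.2
      have h0 := hpt e (i := j) (by omega)
      have h1 := hpt e (i := j + 1) (by omega)
      have h2 := hpt e (i := j + 2) (by omega)
      rw [decorationPoint_succ] at h1
      by_cases hlt : T.dist v₀ (Quot.out (e : Sym2 V)).1 < T.dist v₀ (Quot.out (e : Sym2 V)).2
      · refine ⟨_, (decorate_adj_inr T g).mpr (Or.inl rfl), ?_⟩
        rw [if_pos hlt] at h0 h1
        omega
      · refine ⟨_, (decorate_adj_inr T g).mpr (Or.inr rfl), ?_⟩
        rw [if_neg hlt] at h1 h2
        omega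
  · rintro (v | ⟨e, j⟩) y z hy hz hyle hzle
    · obtain ⟨w, hw, rfl⟩ := (decorate_adj_inl T g).mp hy
      obtain ⟨w', hw', rfl⟩ := (decorate_adj_inl T g).mp hz
      rcases decorateHeight_toward g hT v₀ hw with ⟨hd, -⟩ | ⟨-, h⟩
      · rcases decorateHeight_toward g hT v₀ hw' with ⟨hd', -⟩ | ⟨-, h⟩
        · obtain rfl := hT.eq_of_adj_of_dist_add_one hw hw' hd.symm hd'.symm
          rfl
        · omega
      · omega
    · have hj := j.2
      have h0 := hpt e (i := j) (by omega)
      have h1 := hpt e (i := j + 1) (by omega)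
      have h2 := hpt e (i := j + 2) (by omega)
      rw [decorationPoint_succ] at h1
      rcases (decorate_adj_inr T g).mp hy with rfl | rfl <;>
        rcases (decorate_adj_inr T g).mp hz with rfl | rfl
      · rfl
      · split_ifs at h0 h1 h2 <;> omega
      · split_ifs at h0 h1 h2 <;> omega
      · rfl

/-- A tree in which the vertices of degree `d` are joined by chains of `g` sites of degree `2`; for
neighbours `x`, `y`, the number `pos x y` is the position of `x` on the chain which starts at a vertex
of degree `d` and passes through `x` and then `y`. -/
structure IsDecoratedTree {W : Type*} (G : SimpleGraph W) [G.LocallyFinite] (d g : ℕ)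
    (pos : W → W → ℕ) : Prop where
  isTree : G.IsTree
  two_le : 2 ≤ d
  pos_le : ∀ x y, pos x y ≤ g
  cases : ∀ x, (G.degree x = d ∧ ∀ y, G.Adj x y → pos x y = 0 ∧ pos y x = g) ∨
    (G.degree x = 2 ∧ ∀ y z, G.Adj x y → G.Adj x z → y ≠ z → pos x y = pos z x + 1)

variable (T) in
open scoped Classical in
/-- The position of a vertex of the decorated tree on the chain through it, in the direction of a
neighbour. -/
noncomputable def decoratePos (x y : V ⊕ T.edgeSet × Fin g) : ℕ :=
  match x with
  | Sum.inl _ => 0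
  | Sum.inr (e, j) => if y = decorationPoint T g e (j + 2) then j + 1 else g - j

theorem decoratePos_up (e : T.edgeSet) {i : ℕ} (hi : i ≤ g) :
    decoratePos T g (decorationPoint T g e i) (decorationPoint T g e (i + 1)) = i := by
  rcases decorationPoint_cases g (show i ≤ g + 1 by omega) with rfl | ⟨j, rfl⟩ | rfl
  · rw [decorationPoint_zero, decoratePos]
  · rw [decorationPoint_succ, decoratePos, if_pos rfl]
  · omega

theorem decoratePos_down (e : T.edgeSet) {i : ℕ} (hi : i ≤ g) :
    decoratePos T g (decorationPoint T g e (i + 1)) (decorationPoint T g e i) = g - i := by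
  rcases decorationPoint_cases g (show i + 1 ≤ g + 1 by omega) with h | ⟨j, h⟩ | h
  · omega
  · obtain rfl : i = j := by omega
    rw [decorationPoint_succ, decoratePos, if_neg (decorationPoint_ne_add_two T g e j)]
  · obtain rfl : i = g := by omega
    rw [decorationPoint_last, decoratePos, Nat.sub_self]

theorem isDecoratedTree_decorate [T.LocallyFinite] {d : ℕ} (hd : 2 ≤ d) (hT : T.IsTree)
    (hreg : T.IsRegularOfDegree d) : IsDecoratedTree (decorate T g) d g (decoratePos T g) where
  isTree := isTree_decorate g hT
  two_le := hd
  pos_le x y := by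
    rcases x with v | ⟨e, j⟩
    · exact Nat.zero_le g
    · have := j.2
      rw [decoratePos]
      split_ifs <;> omega
  cases x := by
    rcases x with v | ⟨e, j⟩
    · refine Or.inl ⟨by rw [degree_decorate_inl, hreg.degree_eq], fun y hy => ⟨rfl, ?_⟩⟩
      obtain ⟨w, hw, rfl⟩ := (decorate_adj_inl T g).mp hy
      rcases decorateToward_cases T g hw with ⟨h1, h2⟩ | ⟨h1, h2⟩
      · have h3 := decoratePos_down g ⟨s(v, w), hw⟩ (Nat.zero_le g)
        rw [decorationPoint_zero] at h3
        simp only [h1] at h3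
        rw [h2]
        exact h3
      · have h3 := decoratePos_up g ⟨s(v, w), hw⟩ (le_refl g)
        rw [decorationPoint_last] at h3
        simp only [h1] at h3
        rw [h2]
        exact h3
    · have hj := j.2
      refine Or.inr ⟨degree_decorate_inr T g e j, fun y z hy hz hyz => ?_⟩
      have h1 := decoratePos_up g e (i := j) (by omega)
      have h2 := decoratePos_up g e (i := j + 1) (by omega)
      have h3 := decoratePos_down g e (i := j) (by omega)
      have h4 := decoratePos_down g e (i := j + 1) (by omega)
      rw [decorationPoint_succ] at h1 h2 h3 h4
      rcases (decorate_adj_inr T g).mp hy with rfl | rfl <;>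
        rcases (decorate_adj_inr T g).mp hz with rfl | rfl
      · exact absurd rfl hyz
      · rw [h3, h4]; omega
      · rw [h2, h1]
      · exact absurd rfl hyz

end Decorate


/-! ### Balls in a tree, and the reduction of a state to a smaller region -/

section Balls

open scoped Classical ComplexOrder

variable {W : Type*} {G : SimpleGraph W} [G.LocallyFinite] {Λ S : Finset W}

theorem mem_graphBall (hG : G.IsTree) {o x : W} {n : ℕ} : x ∈ graphBall G o n ↔ G.dist o x ≤ n := by
  induction n generalizing x with
  | zero =>
    rw [graphBall, Finset.mem_singleton, Nat.le_zero, hG.connected.dist_eq_zero_iff, eq_comm]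
  | succ n ih =>
    rw [graphBall, Finset.mem_union, Finset.mem_biUnion, ih]
    constructor
    · rintro (h | ⟨y, hy, hxy⟩)
      · omega
      · rw [SimpleGraph.mem_neighborFinset] at hxy
        have := hG.dist_eq_dist_add_one_of_adj o hxy
        rw [ih] at hy
        omega
    · intro h
      by_cases hx : x = o
      · left; rw [hx, SimpleGraph.dist_self]; omega
      · obtain ⟨z, hz, hd⟩ := hG.exists_adj_dist_add_one hx
        right
        exact ⟨z, ih.mpr (by omega), (SimpleGraph.mem_neighborFinset _ _ _).mpr hz.symm⟩

theorem graphBall_mono (hG : G.IsTree) (o : W) {m n : ℕ} (h : m ≤ n) :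
    graphBall G o m ⊆ graphBall G o n := fun x hx => by
  rw [mem_graphBall hG] at hx ⊢
  omega

theorem exists_subset_graphBall (hG : G.IsTree) (o : W) (Λ : Finset W) : ∃ k, Λ ⊆ graphBall G o k := by
  refine ⟨Λ.sup fun x => G.dist o x, fun x hx => ?_⟩
  rw [mem_graphBall hG]
  exact Finset.le_sup (f := fun x => G.dist o x) hx

/-- The region `S` contains, with every site, the next site in the direction of `u`. -/
def ClosedToward (G : SimpleGraph W) (u : W) (S : Finset W) : Prop :=
  ∀ y ∈ S, ∀ p, G.Adj y p → G.dist u p + 1 = G.dist u y → p ∈ S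

/-- The path to x, once it leaves y away from o, keeps going away from o: the only neighbour of p
nearer to o is y, and returning there does not approach x. Hence balls are convex, and a state on a
ball around o can be reduced towards any of its sites. -/
theorem dist_le_of_toward (hG : G.IsTree) (o x : W) : ∀ n y p, G.dist x y = n → G.Adj y p →
    G.dist x p + 1 = G.dist x y → G.dist o p = G.dist o y + 1 → G.dist o p ≤ G.dist o x := by
  intro n
  induction n using Nat.strong_induction_on with
  | _ n ih =>
  intro y p hn hyp hx ho
  by_cases hpx : p = x
  · rw [hpx]
  · obtain ⟨q, hpq, hq⟩ := hG.exists_adj_dist_add_one hpx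
    have hqo := hG.dist_eq_dist_add_one_of_adj o hpq
    have hne : G.dist o q ≠ G.dist o y := by
      intro h
      have hqy : q = y := hG.eq_of_adj_of_dist_add_one hpq hyp.symm (by omega : G.dist o q + 1 = _)
        (by omega)
      rw [hqy] at hq
      omega
    have := ih (G.dist x p) (by omega) p q rfl hpq hq (by omega)
    omega

theorem closedToward_graphBall (hG : G.IsTree) {o x : W} {n : ℕ} (hx : x ∈ graphBall G o n) :
    ClosedToward G x (graphBall G o n) := by
  intro y hy p hyp hd
  rw [mem_graphBall hG] at hx hy ⊢
  rcases hG.dist_eq_dist_add_one_of_adj o hyp with h | h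
  · omega
  · exact (dist_le_of_toward hG o x _ y p rfl hyp hd h).trans hx

theorem closedToward_singleton (x : W) : ClosedToward G x {x} := by
  intro y hy p _ hd
  rw [Finset.mem_singleton.mp hy, SimpleGraph.dist_self] at hd
  omega

/-- The partial trace of a valence bond state over the complement of a region. -/
theorem stateFun_vbsPoly_of_subset (hG : G.IsTree) {u : W} (hu : u ∈ Λ) (hΛ : ClosedToward G u Λ)
    {Q : W → W → Matrix (Fin 2) (Fin 2) ℂ} {n : ℕ} : ∀ {S : Finset W}, ClosedToward G u S →
    ∀ h : Λ ⊆ S, (S \ Λ).card = n →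
    (∀ y ∈ S, y ∉ Λ → ∀ p, G.Adj y p → G.dist u p + 1 = G.dist u y → ∃ c : ℝ, 0 < c ∧
      outgoing (G.degree y) (∏ z ∈ (G.neighborFinset y).erase p, legPoly (Q z y)) = (c : ℂ) • Q y p) →
    ∃ C : ℝ, 0 < C ∧ ∀ A : LocalOp G Λ,
      stateFun (extendOp G h A) (vbsPoly G S Q) = C * stateFun A (vbsPoly G Λ Q) := by
  induction n with
  | zero =>
    intro S hS h hn hQ
    obtain rfl : Λ = S := h.antisymm (Finset.sdiff_eq_empty_iff_subset.mp (Finset.card_eq_zero.mp hn))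
    refine ⟨1, one_pos, fun A => ?_⟩
    rw [extendOp_self, Complex.ofReal_one, one_mul]
  | succ n ih =>
    intro S hS h hn hQ
    -- A site of S outside Λ at maximal distance from u is a leaf of S: its neighbour p towards u is
    -- its only neighbour in S.
    obtain ⟨y, hy, hmax⟩ := Finset.exists_max_image (S \ Λ) (fun z => G.dist u z)
      (Finset.card_pos.mp (by omega))
    rw [Finset.mem_sdiff] at hy
    have hyu : y ≠ u := fun e => hy.2 (e ▸ hu)
    obtain ⟨p, hyp, hd⟩ := hG.exists_adj_dist_add_one hyu
    have hp : p ∈ S := hS y hy.1 p hyp hd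
    have hpy : p ≠ y := hyp.ne'
    have huniq : ∀ z ∈ S, G.Adj z y → z = p := by
      intro z hz hzy
      rcases hG.dist_eq_dist_add_one_of_adj u hzy with hzd | hzd
      · exfalso
        by_cases hzΛ : z ∈ Λ
        · exact hy.2 (hΛ z hzΛ y hzy hzd.symm)
        · have := hmax z (Finset.mem_sdiff.mpr ⟨hz, hzΛ⟩)
          omega
      · exact hG.eq_of_adj_of_dist_add_one hzy.symm hyp hzd.symm hd
    obtain ⟨S', hS'⟩ : ∃ S', S' = S.erase y := ⟨_, rfl⟩
    have hyS' : y ∉ S' := by rw [hS']; exact Finset.notMem_erase y S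
    obtain rfl : S = insert y S' := by rw [hS', Finset.insert_erase hy.1]
    have hΛS' : Λ ⊆ S' := fun z hz =>
      (Finset.mem_insert.mp (h hz)).resolve_left fun e => hy.2 (e ▸ hz)
    have hclosed : ClosedToward G u S' := by
      intro z hz q hzq hqd
      rcases Finset.mem_insert.mp (hS z (Finset.mem_insert_of_mem hz) q hzq hqd) with rfl | hq
      · exfalso
        obtain rfl := huniq z (Finset.mem_insert_of_mem hz) hzq
        omega
      · exact hq
    have hcard : (S' \ Λ).card = n := by
      rw [Finset.insert_sdiff_of_notMem _ hy.2, Finset.card_insert_of_notMem (by simp [hyS'])] at hn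
      omega
    obtain ⟨C, hC, hCA⟩ := ih hclosed hΛS' hcard fun z hz => hQ z (Finset.mem_insert_of_mem hz)
    obtain ⟨c, hc, hcQ⟩ := hQ y hy.1 hy.2 p hyp hd
    refine ⟨c * C, mul_pos hc hC, fun A => ?_⟩
    have hpS' : p ∈ S' := (Finset.mem_insert.mp hp).resolve_left hpy
    rw [← extendOp_extendOp hΛS' (Finset.subset_insert y S'), stateFun_vbsPoly_insert hyS' hpS' hyp.symm
      (fun z hz => huniq z (Finset.mem_insert_of_mem hz)) hcQ, hCA]
    push_cast
    ring

/-! ### The state of a single site -/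

theorem vbsPoly_singleton (x : W) (Q : W → W → Matrix (Fin 2) (Fin 2) ℂ) :
    vbsPoly G {x} Q = atSite x (∏ y ∈ G.neighborFinset x, legPoly (Q y x)) := by
  have h : edgesIn G {x} = ∅ := by
    rw [Finset.eq_empty_iff_forall_notMem]
    intro e
    induction e using Sym2.inductionOn with
    | hf a b =>
    rw [mk_mem_edgesIn, Finset.mem_singleton, Finset.mem_singleton]
    rintro ⟨⟨rfl, rfl⟩, h⟩
    exact h.ne rfl
  have h2 : G.neighborFinset x \ {x} = G.neighborFinset x := by
    rw [Finset.sdiff_singleton_eq_erase, Finset.erase_eq_of_notMem]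
    simp
  rw [vbsPoly, h, Finset.prod_empty, doubled_one, one_mul, legProduct, Finset.prod_singleton, h2,
    map_prod]

/-- The configurations of a single site. -/
def singletonConfig (x : W) : Fin (G.degree x + 1) ≃ Config G {x} where
  toFun k y := Fin.cast (by rw [Finset.mem_singleton.mp y.2]) k
  invFun σ := σ ⟨x, Finset.mem_singleton_self x⟩
  left_inv _ := rfl
  right_inv σ := by
    funext ⟨y, hy⟩
    obtain rfl := Finset.mem_singleton.mp hy
    rfl

theorem stateFun_siteOp_atSite (x : W) (M : Matrix (Fin (G.degree x + 1)) (Fin (G.degree x + 1)) ℂ)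
    (h : MvPolynomial (Fin 2) ℂ) :
    stateFun (siteOp G (⟨x, Finset.mem_singleton_self x⟩ : ({x} : Finset W)) M) (atSite x h) =
      ∑ k : Fin (G.degree x + 1), ∑ l : Fin (G.degree x + 1), M l k *
        MvPolynomial.coeff (pairExpo k l) h /
          (((Real.sqrt ((G.degree x).choose k) * Real.sqrt ((G.degree x).choose l) : ℝ)) : ℂ) := by
  have hexpo : ∀ k : Fin (G.degree x + 1), expo (singletonConfig (G := G) x k) =
      Finsupp.single x (k : ℕ) := by
    intro k
    ext y
    by_cases hy : y = x
    · subst hy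
      rw [Finsupp.single_eq_same]
      exact expo_apply (singletonConfig (G := G) y k) ⟨y, Finset.mem_singleton_self y⟩
    · rw [expo_apply_of_notMem _ (by simpa using hy), Finsupp.single_eq_of_ne hy]
  have hcoeff : ∀ k l : Fin (G.degree x + 1), MvPolynomial.coeff
      (expo₂ (singletonConfig (G := G) x k) (singletonConfig (G := G) x l)) (atSite x h) =
      MvPolynomial.coeff (pairExpo k l) h := by
    intro k l
    have h1 := coeff_mul_atSite (y := x) (F := 1) (one_mem _) h (e := 0) ⟨rfl, rfl⟩ k l
    rw [add_zero, one_mul, MvPolynomial.coeff_zero_one, one_mul] at h1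
    rw [← h1]
    congr 1
    rw [expo₂, hexpo, hexpo, siteExpo, sumElim_eq_mapDomain_add, Finsupp.mapDomain_single,
      Finsupp.mapDomain_single]
  have hnorm : ∀ k : Fin (G.degree x + 1), configNorm (singletonConfig (G := G) x k) =
      Real.sqrt ((G.degree x).choose k) := by
    intro k
    rw [configNorm]
    exact Fintype.prod_unique _
  rw [stateFun_apply, ← Equiv.sum_comp (singletonConfig (G := G) x)]
  refine Finset.sum_congr rfl fun k _ => ?_
  rw [← Equiv.sum_comp (singletonConfig (G := G) x)]
  refine Finset.sum_congr rfl fun l _ => ?_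
  rw [hcoeff, hnorm, hnorm, siteOp, Matrix.of_apply, if_pos, mul_div_assoc, Complex.ofReal_mul]
  · rfl
  · intro y hy
    exact absurd (Subtype.ext (Finset.mem_singleton.mp y.2)) hy

theorem stateFun_siteOp_diagonal (x : W) (f : ℕ → ℂ) (h : MvPolynomial (Fin 2) ℂ) :
    stateFun (siteOp G (⟨x, Finset.mem_singleton_self x⟩ : ({x} : Finset W))
      (Matrix.diagonal fun k => f k)) (atSite x h) =
      ∑ k ∈ Finset.range (G.degree x + 1), f k * (((G.degree x).choose k : ℂ)⁻¹ *
        MvPolynomial.coeff (pairExpo k k) h) := by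
  rw [stateFun_siteOp_atSite, ← Fin.sum_univ_eq_sum_range (fun k => f k *
    (((G.degree x).choose k : ℂ)⁻¹ * MvPolynomial.coeff (pairExpo k k) h))]
  refine Finset.sum_congr rfl fun k _ => ?_
  rw [Finset.sum_eq_single k]
  · rw [Matrix.diagonal_apply_eq, Real.mul_self_sqrt (by positivity)]
    push_cast
    ring
  · intro l _ hl
    rw [Matrix.diagonal_apply_ne _ hl, zero_mul, zero_div]
  · intro hk
    exact absurd (Finset.mem_univ k) hk

theorem stateFun_one_atSite (x : W) (h : MvPolynomial (Fin 2) ℂ) :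
    stateFun (1 : LocalOp G {x}) (atSite x h) = siteFun (G.degree x) h := by
  have h1 := stateFun_siteOp_diagonal (G := G) x (fun _ => 1) h
  rw [Matrix.diagonal_one, siteOp_one] at h1
  rw [h1, siteFun_apply]
  simp only [one_mul]

theorem sum_sub_half_mul_coeff (n : ℕ) (h : MvPolynomial (Fin 2) ℂ) :
    ∑ k ∈ Finset.range (n + 1), ((k : ℂ) - (n : ℂ) / 2) * ((n.choose k : ℂ)⁻¹ *
      MvPolynomial.coeff (pairExpo k k) h) =
      siteFun n (MvPolynomial.X 0 * MvPolynomial.pderiv 0 h) - (n : ℂ) / 2 * siteFun n h := by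
  rw [siteFun_apply, siteFun_apply, Finset.mul_sum, ← Finset.sum_sub_distrib]
  refine Finset.sum_congr rfl fun k _ => ?_
  have hk : MvPolynomial.coeff (pairExpo k k) (MvPolynomial.X 0 * MvPolynomial.pderiv 0 h) =
      (k : ℂ) * MvPolynomial.coeff (pairExpo k k) h := by
    induction h using MvPolynomial.induction_on' with
    | add p q hp hq => simp only [map_add, mul_add, MvPolynomial.coeff_add, hp, hq]
    | monomial d r =>
      rw [MvPolynomial.X_mul_pderiv_monomial, MvPolynomial.coeff_smul, MvPolynomial.coeff_monomial]
      split_ifs with hd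
      · rw [hd, pairExpo_apply_zero, nsmul_eq_mul]
      · simp
  rw [hk]
  ring

/-- On polynomials S³ is X∂ - n/2, and the recursions in the spin express X∂ by a test leg σ₃ on a
spin with one leg more. The sign is again that of the singlets. -/
theorem stateFun_spinAt_two (x : W) {s : Finset W} (hs : s.card = G.degree x) (r : W → BlochVector) :
    stateFun (spinAt G x 2) (atSite x (legsPoly s r)) =
      -(((G.degree x : ℂ) + 1) * ((G.degree x : ℂ) + 2) / 2 * (siteMoment s r 2 : ℂ)) := by
  have h1 := stateFun_siteOp_diagonal (G := G) x (fun k => (k : ℂ) - (G.degree x : ℂ) / 2)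
    (legsPoly s r)
  rw [sum_sub_half_mul_coeff] at h1
  have h2 : spinAt G x 2 = siteOp G (⟨x, Finset.mem_singleton_self x⟩ : ({x} : Finset W))
      (Matrix.diagonal fun k => (k : ℂ) - (G.degree x : ℂ) / 2) := rfl
  have hm := siteFun_legPoly_pauli_eq s r 2
  have hc : MvPolynomial.coeff (pairExpo (s.card + 1) (s.card + 1)) (legsPoly s r) = 0 :=
    coeff_prod_legPoly s _ (Nat.lt_succ_self _)
  rw [h2, h1, ← hs]
  generalize legsPoly s r = P at *
  have e1 := siteFun_succ_X_mul_X s.card P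
  have e2 := siteFun_succ s.card P
  rw [hc] at e2
  have e3 : legPoly (pauli 2) * P = P - MvPolynomial.X 0 * (MvPolynomial.X 1 * P) := by
    simp [legPoly, pauli]; ring
  rw [e3, map_sub] at hm
  linear_combination (e2 - e1) / 2 - ((s.card : ℂ) + 1) / 2 * hm

/-- The leg with boundary condition 1 is 1 + XY. So the one-site state is diagonal, and S¹ and S²,
which have zero diagonal, have expectation zero. -/
theorem coeff_prod_legPoly_one {ι : Type*} (s : Finset ι) {k l : ℕ} (h : k ≠ l) :
    MvPolynomial.coeff (pairExpo k l) (∏ _i ∈ s, legPoly 1) = 0 := by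
  have h1 : legPoly 1 = MvPolynomial.monomial (pairExpo 1 1) 1 + 1 := by
    simp only [legPoly, Matrix.one_apply, reduceIte, one_ne_zero, zero_ne_one, map_one, map_zero,
      MvPolynomial.X, MvPolynomial.monomial_mul, pairExpo, mul_one, zero_mul, one_mul]
    ring
  rw [Finset.prod_const, h1, add_pow, MvPolynomial.coeff_sum]
  refine Finset.sum_eq_zero fun j _ => ?_
  rw [one_pow, mul_one, MvPolynomial.monomial_pow, one_pow, mul_comm, ← nsmul_eq_mul,
    MvPolynomial.coeff_smul, MvPolynomial.coeff_monomial, if_neg, smul_zero]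
  intro hj
  have h0 := DFunLike.congr_fun hj 0
  have h2 := DFunLike.congr_fun hj 1
  simp only [Finsupp.smul_apply, pairExpo_apply_zero, pairExpo_apply_one, smul_eq_mul] at h0 h2
  omega

theorem stateFun_spinAt_vbsPoly_one (x : W) (α : Fin 3) :
    stateFun (spinAt G x α) (vbsPoly G {x} fun _ _ => 1) = 0 := by
  rw [vbsPoly_singleton]
  have hoff : ∀ M : Matrix (Fin (G.degree x + 1)) (Fin (G.degree x + 1)) ℂ, (∀ k, M k k = 0) →
      stateFun (siteOp G (⟨x, Finset.mem_singleton_self x⟩ : ({x} : Finset W)) M)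
        (atSite x (∏ _y ∈ G.neighborFinset x, legPoly 1)) = 0 := by
    intro M hM
    rw [stateFun_siteOp_atSite]
    refine Finset.sum_eq_zero fun k _ => Finset.sum_eq_zero fun l _ => ?_
    by_cases hkl : k = l
    · rw [hkl, hM, zero_mul, zero_div]
    · rw [coeff_prod_legPoly_one _ (fun h => hkl (Fin.ext h)), mul_zero, zero_div]
  have hdiag : ∀ k, spinRaise (G.degree x) k k = 0 := by
    intro k
    rw [spinRaise, Matrix.of_apply, if_neg (by omega)]
  fin_cases α
  · refine hoff _ fun k => ?_
    simp [spinMatrix, Matrix.conjTranspose_apply, hdiag]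
  · refine hoff _ fun k => ?_
    simp [spinMatrix, Matrix.conjTranspose_apply, hdiag]
  · have h1 := stateFun_spinAt_two (G := G) x (G.card_neighborFinset_eq_degree x) fun _ => 0
    have h2 := (siteMoments_equal (s := G.neighborFinset x) (r := fun _ => 0) (b := 0)
      fun _ _ => rfl).2
    have h3 : legsPoly (G.neighborFinset x) (fun _ => 0) =
        ∏ _y ∈ G.neighborFinset x, legPoly 1 := by
      simp [legsPoly, blochMatrix]
    rw [h2, h3, smul_zero] at h1
    simpa using h1

theorem stateFun_one_vbsPoly_singleton (x : W) (r : W → BlochVector) :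
    stateFun (1 : LocalOp G {x}) (vbsPoly G {x} fun y _ => blochMatrix (r y)) =
      ((G.degree x : ℂ) + 1) * siteDensity (G.neighborFinset x) r := by
  rw [vbsPoly_singleton, stateFun_one_atSite, ← G.card_neighborFinset_eq_degree,
    ← siteFun_legsPoly_eq]
  rfl

end Balls


/-! ### Ground states from boundary conditions -/

section GroundStates

open scoped Classical ComplexOrder

variable {W : Type*} {G : SimpleGraph W} [G.LocallyFinite] {Λ S : Finset W}

/-! ### The degrees of the product of the singlets -/

theorem degreeOf_X_sub_X {x y z : W} (hxy : x ≠ y) :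
    (MvPolynomial.X x - MvPolynomial.X y : MvPolynomial W ℂ).degreeOf z =
      if z = x ∨ z = y then 1 else 0 := by
  have hle : (MvPolynomial.X x - MvPolynomial.X y : MvPolynomial W ℂ).degreeOf z ≤
      max (if z = x then 1 else 0) (if z = y then 1 else 0) := by
    have := MvPolynomial.degreeOf_sub_le z (MvPolynomial.X x : MvPolynomial W ℂ) (MvPolynomial.X y)
    rwa [MvPolynomial.degreeOf_X, MvPolynomial.degreeOf_X] at this
  have hx := one_le_degreeOf_X_sub_X hxy
  have hy := one_le_degreeOf_X_sub_X hxy.symm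
  rw [← neg_sub, MvPolynomial.degreeOf_neg] at hy
  by_cases h1 : z = x
  · subst h1
    rw [if_neg hxy, if_pos rfl] at hle
    rw [if_pos (Or.inl rfl)]
    exact le_antisymm hle hx
  · by_cases h2 : z = y
    · subst h2
      rw [if_neg h1, if_pos rfl] at hle
      rw [if_pos (Or.inr rfl)]
      exact le_antisymm hle hy
    · rw [if_neg h1, if_neg h2] at hle
      rw [if_neg (by tauto)]
      exact Nat.le_zero.mp hle

theorem degreeOf_edgePoly {e : Sym2 W} (he : ¬ e.IsDiag) (z : W) :
    (edgePoly e).degreeOf z = if z ∈ e then 1 else 0 := by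
  induction e using Sym2.inductionOn with
  | hf x y =>
  rw [Sym2.mk_isDiag_iff] at he
  simp only [Sym2.mem_iff]
  rcases edgePoly_mk x y with h | h
  · rw [h, degreeOf_X_sub_X he]
  · rw [h, MvPolynomial.degreeOf_neg, degreeOf_X_sub_X he]

theorem edgePoly_ne_zero {e : Sym2 W} (he : ¬ e.IsDiag) : edgePoly e ≠ 0 := by
  induction e using Sym2.inductionOn with
  | hf x y =>
  rw [Sym2.mk_isDiag_iff] at he
  rcases edgePoly_mk x y with h | h
  · rw [h]; exact X_sub_X_ne_zero he
  · rw [h]; exact neg_ne_zero.mpr (X_sub_X_ne_zero he)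

theorem prod_edgePoly_ne_zero : ∏ e ∈ edgesIn G Λ, edgePoly e ≠ 0 :=
  Finset.prod_ne_zero_iff.mpr fun _ he => edgePoly_ne_zero (not_isDiag_of_mem_edgesIn he)

/-- The degree left over at z is the number of edges from z that leave Λ. This leaves room for
exactly one factor per leg, and no room at sites whose neighbours all lie in Λ. -/
theorem degreeOf_prod_edgePoly (z : W) : (∏ e ∈ edgesIn G Λ, edgePoly e).degreeOf z =
    if z ∈ Λ then (G.neighborFinset z ∩ Λ).card else 0 := by
  rw [MvPolynomial.degreeOf_prod_eq _ _ fun e he => edgePoly_ne_zero (not_isDiag_of_mem_edgesIn he),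
    Finset.sum_congr rfl fun e he => degreeOf_edgePoly (not_isDiag_of_mem_edgesIn he) z,
    ← Finset.card_filter]
  split_ifs with hz
  · symm
    refine Finset.card_bij (fun y _ => s(z, y)) ?_ ?_ ?_
    · intro y hy
      rw [Finset.mem_inter, SimpleGraph.mem_neighborFinset] at hy
      rw [Finset.mem_filter, mk_mem_edgesIn]
      exact ⟨⟨⟨hz, hy.2⟩, hy.1⟩, Sym2.mem_mk_left z y⟩
    · intro y _ y' _ h
      exact Sym2.congr_right.mp h
    · intro e he
      obtain ⟨he, y, rfl⟩ := Finset.mem_filter.mp he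
      rw [mk_mem_edgesIn] at he
      exact ⟨y, Finset.mem_inter.mpr ⟨(SimpleGraph.mem_neighborFinset _ _ _).mpr he.2, he.1.2⟩, rfl⟩
  · rw [Finset.card_eq_zero, Finset.filter_eq_empty_iff]
    rintro e he ⟨y, rfl⟩
    exact hz (mk_mem_edgesIn.mp he).1.1

/-! ### Valence bond states with diagonal boundary conditions are ground states -/

/-- The operator on `Λ` which represents the functional `A ↦ stateFun A P`. -/
noncomputable def densityOf (Λ : Finset W) (P : MvPolynomial (W ⊕ W) ℂ) : LocalOp G Λ :=
  Matrix.of fun σ τ => MvPolynomial.coeff (expo₂ σ τ) P / (configNorm σ * configNorm τ)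

theorem trace_densityOf_mul (P : MvPolynomial (W ⊕ W) ℂ) (A : LocalOp G Λ) :
    (densityOf Λ P * A).trace = stateFun A P := by
  rw [stateFun_apply, Matrix.trace]
  refine Finset.sum_congr rfl fun σ _ => ?_
  rw [Matrix.diag_apply, Matrix.mul_apply]
  exact Finset.sum_congr rfl fun τ _ => mul_comm _ _

theorem densityOf_sum {ι : Type*} (s : Finset ι) (P : ι → MvPolynomial (W ⊕ W) ℂ) :
    (densityOf Λ (∑ i ∈ s, P i) : LocalOp G Λ) = ∑ i ∈ s, densityOf Λ (P i) := by
  ext σ τ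
  rw [Matrix.sum_apply]
  simp only [densityOf, Matrix.of_apply, MvPolynomial.coeff_sum, Finset.sum_div]

theorem densityOf_doubled (p : MvPolynomial W ℂ) : (densityOf Λ (doubled p) : LocalOp G Λ) =
    Matrix.vecMulVec (vecOf p) (star (vecOf p)) := by
  ext σ τ
  rw [densityOf, Matrix.of_apply, doubled, expo₂, coeff_rename_inl_mul_rename_inr,
    MvPolynomial.coeff_map, Matrix.vecMulVec_apply, Pi.star_apply, vecOf, vecOf, star_div₀,
    Complex.star_def, Complex.conj_ofReal]
  exact mul_div_mul_comm _ _ _ _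

/-- The unit vector in the direction of the magnetization. -/
noncomputable def northPole : BlochVector := EuclideanSpace.single 2 1

theorem norm_northPole : ‖northPole‖ = 1 := by simp [northPole]

theorem blochMatrix_smul_northPole (b : ℝ) :
    blochMatrix (b • northPole) = !![((1 + b : ℝ) : ℂ), 0; 0, ((1 - b : ℝ) : ℂ)] := by
  rw [blochMatrix_eq]
  ext i j
  fin_cases i <;> fin_cases j <;> simp [northPole, PiLp.smul_apply]

theorem atSite_legPoly_northPole (x : W) {b : ℝ} (hb : |b| ≤ 1) :
    atSite x (legPoly (blochMatrix (b • northPole))) =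
      doubled (MvPolynomial.C ((Real.sqrt (1 + b) : ℝ) : ℂ)) +
        doubled (MvPolynomial.C ((Real.sqrt (1 - b) : ℝ) : ℂ) * MvPolynomial.X x) := by
  obtain ⟨h1, h2⟩ := abs_le.mp hb
  have e1 := ofReal_sqrt_mul_self (show 0 ≤ 1 + b by linarith)
  have e2 := ofReal_sqrt_mul_self (show 0 ≤ 1 - b by linarith)
  rw [doubled_mul, doubled_C, doubled_C, doubled_X, Complex.conj_ofReal,
    Complex.conj_ofReal, e1, e2, blochMatrix_smul_northPole]
  simp only [legPoly, Matrix.of_apply, Matrix.cons_val', Matrix.cons_val_zero, Matrix.cons_val_one,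
    Matrix.cons_val_fin_one, map_add, map_sub, map_mul, map_zero, zero_mul, atSite_C, atSite_X_zero,
    atSite_X_one]
  ring

theorem degreeOf_prod_legs_le (t : Finset (Σ _ : W, W))
    (ht : t ⊆ Λ.sigma fun x => G.neighborFinset x \ Λ) (c : (Σ _ : W, W) → ℂ) (z : W) :
    (∏ l ∈ t, (MvPolynomial.C (c l) * MvPolynomial.X l.1 : MvPolynomial W ℂ)).degreeOf z ≤
      if z ∈ Λ then (G.neighborFinset z \ Λ).card else 0 := by
  have h1 : ∀ l ∈ t, (MvPolynomial.C (c l) * MvPolynomial.X l.1 : MvPolynomial W ℂ).degreeOf z ≤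
      if l.1 = z then 1 else 0 := by
    intro l _
    refine (MvPolynomial.degreeOf_C_mul_le _ _ _).trans ?_
    rw [MvPolynomial.degreeOf_X]
    simp only [eq_comm, le_refl]
  refine (MvPolynomial.degreeOf_prod_le _ _ _).trans ((Finset.sum_le_sum h1).trans ?_)
  rw [← Finset.card_filter]
  split_ifs with hz
  · refine Finset.card_le_card_of_injOn (fun l => l.2) ?_ ?_
    · intro l hl
      obtain ⟨hlt, rfl⟩ := Finset.mem_filter.mp (Finset.mem_coe.mp hl)
      exact (Finset.mem_sigma.mp (ht hlt)).2
    · rintro ⟨a, b⟩ hl ⟨a', b'⟩ hl' h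
      obtain rfl := (Finset.mem_filter.mp hl).2
      have h2 := (Finset.mem_filter.mp hl').2
      simp only at h h2
      rw [h, h2]
  · rw [Nat.le_zero, Finset.card_eq_zero, Finset.filter_eq_empty_iff]
    rintro l hl rfl
    exact hz (Finset.mem_sigma.mp (ht hl)).1

/-- A diagonal boundary condition is the sum of the pure up and down ones with weights 1 ± b ≥ 0.
Expanding the product over the legs, by the subset t of legs which take the constant term, gives a
positive sum of pure states. Each contains all singlet forms and respects the degree bounds, so it
is a ground state. -/
theorem vbsPoly_northPole_eq_sum {b : W → W → ℝ} (hb : ∀ y x, |b y x| ≤ 1) :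
    ∃ (s : Finset (Finset (Σ _ : W, W))) (p : Finset (Σ _ : W, W) → MvPolynomial W ℂ),
      vbsPoly G Λ (fun y x => blochMatrix (b y x • northPole)) = ∑ i ∈ s, doubled (p i) ∧
      ∀ i ∈ s, akltHamiltonian G Λ *ᵥ vecOf (p i) = 0 := by
  obtain ⟨L, hL⟩ : ∃ L, L = Λ.sigma fun x => G.neighborFinset x \ Λ := ⟨_, rfl⟩
  have hprod : legProduct G Λ (fun y x => blochMatrix (b y x • northPole)) = ∏ l ∈ L,
      (doubled (MvPolynomial.C ((Real.sqrt (1 + b l.2 l.1) : ℝ) : ℂ)) +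
        doubled (MvPolynomial.C ((Real.sqrt (1 - b l.2 l.1) : ℝ) : ℂ) * MvPolynomial.X l.1)) := by
    rw [hL, legProduct, Finset.prod_sigma]
    exact Finset.prod_congr rfl fun x _ => Finset.prod_congr rfl fun y _ =>
      atSite_legPoly_northPole x (hb y x)
  refine ⟨L.powerset, fun t => (∏ e ∈ edgesIn G Λ, edgePoly e) *
    ((∏ l ∈ t, MvPolynomial.C ((Real.sqrt (1 + b l.2 l.1) : ℝ) : ℂ)) *
      ∏ l ∈ L \ t, MvPolynomial.C ((Real.sqrt (1 - b l.2 l.1) : ℝ) : ℂ) * MvPolynomial.X l.1), ?_, ?_⟩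
  · rw [vbsPoly, hprod, Finset.prod_add, Finset.mul_sum]
    refine Finset.sum_congr rfl fun t _ => ?_
    rw [doubled_mul, doubled_mul, doubled_prod t, doubled_prod (L \ t)]
  · intro t _
    rw [akltHamiltonian_mulVec_eq_zero_iff_prod_dvd, polyOf_vecOf]
    · exact Dvd.intro _ rfl
    · intro z
      refine (MvPolynomial.degreeOf_mul_le _ _ _).trans ?_
      have h1 : (∏ l ∈ t, (MvPolynomial.C ((Real.sqrt (1 + b l.2 l.1) : ℝ) : ℂ) :
          MvPolynomial W ℂ)).degreeOf z = 0 := by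
        rw [← map_prod, MvPolynomial.degreeOf_C]
      have h2 := degreeOf_prod_legs_le (G := G) (Λ := Λ) (L \ t)
        (hL ▸ Finset.sdiff_subset) (fun l => ((Real.sqrt (1 - b l.2 l.1) : ℝ) : ℂ)) z
      have h3 := (MvPolynomial.degreeOf_mul_le z (∏ l ∈ t,
        (MvPolynomial.C ((Real.sqrt (1 + b l.2 l.1) : ℝ) : ℂ) : MvPolynomial W ℂ))
        (∏ l ∈ L \ t, (MvPolynomial.C ((Real.sqrt (1 - b l.2 l.1) : ℝ) : ℂ) *
          MvPolynomial.X l.1 : MvPolynomial W ℂ)))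
      rw [h1, zero_add] at h3
      refine (Nat.add_le_add_left (h3.trans h2) _).trans ?_
      rw [degreeOf_prod_edgePoly, capDegree]
      split_ifs with hz
      · rw [Finset.card_inter_add_card_sdiff, G.card_neighborFinset_eq_degree]
      · rfl

theorem exists_groundState_of_vbsPoly {b : W → W → ℝ} (hb : ∀ y x, |b y x| ≤ 1) {Z : ℝ} (hZ : 0 < Z)
    (h1 : stateFun (1 : LocalOp G Λ) (vbsPoly G Λ fun y x => blochMatrix (b y x • northPole)) = Z) :
    ∃ ρ : LocalOp G Λ, IsFiniteVolumeGroundState G ρ ∧ ∀ A : LocalOp G Λ, (ρ * A).trace =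
      (Z : ℂ)⁻¹ * stateFun A (vbsPoly G Λ fun y x => blochMatrix (b y x • northPole)) := by
  obtain ⟨s, p, hp, hker⟩ := vbsPoly_northPole_eq_sum (G := G) (Λ := Λ) hb
  have htr : ∀ A : LocalOp G Λ, (((Z : ℂ)⁻¹ • densityOf Λ (∑ i ∈ s, doubled (p i))) * A).trace =
      (Z : ℂ)⁻¹ * stateFun A (vbsPoly G Λ fun y x => blochMatrix (b y x • northPole)) := by
    intro A
    rw [Matrix.smul_mul, Matrix.trace_smul, trace_densityOf_mul, hp, smul_eq_mul]
  have hZ' : (Z : ℂ) ≠ 0 := by exact_mod_cast hZ.ne'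
  refine ⟨(Z : ℂ)⁻¹ • densityOf Λ (∑ i ∈ s, doubled (p i)), ⟨?_, ?_, ?_⟩, htr⟩
  · rw [densityOf_sum]
    refine (Matrix.posSemidef_sum s fun i _ => ?_).smul ?_
    · rw [densityOf_doubled]
      exact Matrix.posSemidef_vecMulVec_self_star _
    · rw [← Complex.ofReal_inv]
      exact_mod_cast (inv_pos.mpr hZ).le
  · have := htr 1
    rwa [mul_one, h1, inv_mul_cancel₀ hZ'] at this
  · rw [densityOf_sum, Matrix.mul_smul, Finset.mul_sum, Finset.sum_eq_zero, smul_zero]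
    intro i hi
    rw [densityOf_doubled, Matrix.mul_vecMulVec, hker i hi, Matrix.zero_vecMulVec]

/-! ### Consistent families of boundary conditions -/

/-- The outgoing boundary condition of a site with the boundary conditions `𝟙 + r i · σ` on its other
legs. -/
noncomputable def siteMessage {ι : Type*} (s : Finset ι) (r : ι → BlochVector) : BlochVector :=
  -((siteDensity s r)⁻¹ • siteMoment s r)

theorem norm_siteMessage_le_one {ι : Type*} {s : Finset ι} {r : ι → BlochVector}
    (hr : ∀ i ∈ s, ‖r i‖ ≤ 1) : ‖siteMessage s r‖ ≤ 1 := by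
  have h := siteDensity_pos hr
  rw [siteMessage, norm_neg, norm_smul, norm_inv, Real.norm_of_nonneg h.le, inv_mul_le_one₀ h]
  exact (norm_siteMoment_lt hr).le

theorem card_neighborFinset_erase {y p : W} (h : G.Adj y p) :
    ((G.neighborFinset y).erase p).card + 1 = G.degree y := by
  rw [Finset.card_erase_add_one ((SimpleGraph.mem_neighborFinset _ _ _).mpr h),
    G.card_neighborFinset_eq_degree]

theorem exists_outgoing_eq {y p : W} (h : G.Adj y p) {r : W → BlochVector}
    (hr : ∀ z ∈ (G.neighborFinset y).erase p, ‖r z‖ ≤ 1) : ∃ c : ℝ, 0 < c ∧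
      outgoing (G.degree y) (∏ z ∈ (G.neighborFinset y).erase p, legPoly (blochMatrix (r z))) =
        (c : ℂ) • blochMatrix (siteMessage ((G.neighborFinset y).erase p) r) := by
  have hpos := siteDensity_pos hr
  have h1 := outgoing_legsPoly_eq hpos.ne'
  rw [card_neighborFinset_erase h] at h1
  refine ⟨((((G.neighborFinset y).erase p).card : ℝ) + 2) / 2 *
    siteDensity ((G.neighborFinset y).erase p) r, by positivity, ?_⟩
  push_cast
  exact h1

/-- The boundary conditions `𝟙 + r y p · σ` on the oriented edges are preserved by all sites. -/
def IsConsistent (G : SimpleGraph W) [G.LocallyFinite] (r : W → W → BlochVector) : Prop :=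
  (∀ y p, ‖r y p‖ ≤ 1) ∧
    ∀ y p, G.Adj y p → siteMessage ((G.neighborFinset y).erase p) (fun z => r z y) = r y p

theorem IsConsistent.stateFun_eq {r : W → W → BlochVector} (hr : IsConsistent G r) (hG : G.IsTree)
    {u : W} (hu : u ∈ Λ) (hΛ : ClosedToward G u Λ) (hS : ClosedToward G u S) (h : Λ ⊆ S) :
    ∃ C : ℝ, 0 < C ∧ ∀ A : LocalOp G Λ,
      stateFun (extendOp G h A) (vbsPoly G S fun y p => blochMatrix (r y p)) =
        C * stateFun A (vbsPoly G Λ fun y p => blochMatrix (r y p)) := by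
  refine stateFun_vbsPoly_of_subset hG hu hΛ hS h rfl fun y _ _ p hyp _ => ?_
  have h1 := exists_outgoing_eq hyp (r := fun z => r z y) fun z _ => hr.1 z y
  rwa [hr.2 y p hyp] at h1

theorem IsConsistent.exists_stateFun_one_eq {r : W → W → BlochVector} (hr : IsConsistent G r)
    (hG : G.IsTree) {u : W} (hu : u ∈ S) (hS : ClosedToward G u S) : ∃ Z : ℝ, 0 < Z ∧
      stateFun (1 : LocalOp G S) (vbsPoly G S fun y p => blochMatrix (r y p)) = Z := by
  obtain ⟨C, hC, h⟩ := hr.stateFun_eq hG (Finset.mem_singleton_self u) (closedToward_singleton u) hS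
    (Finset.singleton_subset_iff.mpr hu)
  have h1 := h 1
  have h2 := stateFun_one_vbsPoly_singleton (G := G) u fun y => r y u
  have h3 : vbsPoly G {u} (fun y p => blochMatrix (r y p)) =
      vbsPoly G {u} (fun y _ => blochMatrix (r y u)) := by
    rw [vbsPoly_singleton, vbsPoly_singleton]
  have h4 := siteDensity_pos (s := G.neighborFinset u) (r := fun y => r y u) fun y _ => hr.1 y u
  rw [extendOp_one, h3, h2] at h1
  refine ⟨C * (((G.degree u : ℝ) + 1) * siteDensity (G.neighborFinset u) fun y => r y u),
    by positivity, ?_⟩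
  rw [h1]
  push_cast
  rfl

theorem mem_graphBall_self (hG : G.IsTree) (o : W) (n : ℕ) : o ∈ graphBall G o n := by
  rw [mem_graphBall hG, SimpleGraph.dist_self]
  exact Nat.zero_le n

/-- A consistent family of boundary conditions defines an infinite-volume ground state. -/
theorem exists_infiniteVolumeGroundState (hG : G.IsTree) (o : W) {b : W → W → ℝ}
    (hb : ∀ y x, |b y x| ≤ 1) (hr : IsConsistent G fun y x => b y x • northPole) :
    ∃ ω : (Λ : Finset W) → LocalOp G Λ → ℂ, IsInfiniteVolumeGroundState G o ω ∧
      ∀ (x : W) (A : LocalOp G {x}), ω {x} A =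
        stateFun A (vbsPoly G {x} fun y p => blochMatrix (b y p • northPole)) /
          stateFun (1 : LocalOp G {x}) (vbsPoly G {x} fun y p => blochMatrix (b y p • northPole)) := by
  obtain ⟨P, hP⟩ : ∃ P : Finset W → MvPolynomial (W ⊕ W) ℂ,
    P = fun Λ => vbsPoly G Λ fun y p => blochMatrix (b y p • northPole) := ⟨_, rfl⟩
  have hclosed := fun n => closedToward_graphBall hG (mem_graphBall_self hG o n)
  have hground : ∀ n, ∃ ρ : LocalOp G (graphBall G o n), IsFiniteVolumeGroundState G ρ ∧
      ∀ A : LocalOp G (graphBall G o n), (ρ * A).trace =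
        stateFun A (P (graphBall G o n)) / stateFun (1 : LocalOp G (graphBall G o n))
          (P (graphBall G o n)) := by
    intro n
    obtain ⟨Z, hZ, h1⟩ := hr.exists_stateFun_one_eq hG (mem_graphBall_self hG o n) (hclosed n)
    obtain ⟨ρ, hρ, hA⟩ := exists_groundState_of_vbsPoly hb hZ h1
    refine ⟨ρ, hρ, fun A => ?_⟩
    rw [hA, hP, h1, div_eq_inv_mul]
  choose ρ hρ hρA using hground
  have hratio : ∀ {u : W} {Λ S : Finset W} (_ : u ∈ Λ) (_ : ClosedToward G u Λ)
      (_ : ClosedToward G u S) (h : Λ ⊆ S) (A : LocalOp G Λ),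
      stateFun (extendOp G h A) (P S) / stateFun (1 : LocalOp G S) (P S) =
        stateFun A (P Λ) / stateFun (1 : LocalOp G Λ) (P Λ) := by
    intro u Λ S hu hΛ hS h A
    obtain ⟨C, hC, hCA⟩ := hr.stateFun_eq hG hu hΛ hS h
    have hC' : (C : ℂ) ≠ 0 := by exact_mod_cast hC.ne'
    have h1 := hCA 1
    rw [extendOp_one] at h1
    rw [hP]
    simp only
    rw [hCA, h1, mul_div_mul_left _ _ hC']
  choose k hk using fun Λ => exists_subset_graphBall hG o Λ
  -- The limit is the expectation in the first ball known to contain Λ: by consistency, larger balls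
  -- give the same value, so the sequence is eventually constant.
  refine ⟨fun Λ A => stateFun (extendOp G (hk Λ) A) (P (graphBall G o (k Λ))) /
    stateFun (1 : LocalOp G (graphBall G o (k Λ))) (P (graphBall G o (k Λ))), ⟨ρ, hρ, ?_⟩, ?_⟩
  · intro Λ A
    refine tendsto_const_nhds.congr' ?_
    filter_upwards [Filter.eventually_ge_atTop (k Λ)] with n hn
    have hsub := graphBall_mono hG o hn
    rw [expectation, dif_pos ((hk Λ).trans hsub), hρA, ← extendOp_extendOp (hk Λ) hsub,
      hratio (mem_graphBall_self hG o (k Λ)) (hclosed _) (hclosed n) hsub]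
  · intro x A
    have hx : x ∈ graphBall G o (k {x}) := hk {x} (Finset.mem_singleton_self x)
    -- For a one-site observable the ball is reduced towards x rather than towards o.
    have := hratio (Finset.mem_singleton_self x) (closedToward_singleton x)
      (closedToward_graphBall hG hx) (hk {x}) A
    simp only
    rw [this, hP]

end GroundStates


/-! ### Néel order -/

section Order

open scoped Classical ComplexOrder

variable {W : Type*} {G : SimpleGraph W} [G.LocallyFinite]

theorem siteMessage_equal {ι : Type*} {s : Finset ι} {r : ι → BlochVector} {v : BlochVector}
    (hr : ∀ i ∈ s, r i = v) : siteMessage s r =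
      -(((equalLegs (‖v‖ ^ 2) s.card).2 / (equalLegs (‖v‖ ^ 2) s.card).1) • v) := by
  obtain ⟨h1, h2⟩ := siteMoments_equal hr
  rw [siteMessage, h1, h2, smul_smul, div_eq_inv_mul]

/-- For parallel messages all terms of the recursions are nonnegative. The moment is bounded below
because D ≥ 1, and each leg at most doubles D because ‖N‖ < D. Together these bound the
magnetization below uniformly in the site. -/
theorem siteMoments_aligned {ι : Type*} {e : BlochVector} (he : ‖e‖ = 1) {r : ι → BlochVector}
    {c : ι → ℝ} {b : ℝ} (hb : 0 ≤ b) (s : Finset ι) (hr : ∀ i ∈ s, r i = c i • e)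
    (hc : ∀ i ∈ s, b ≤ c i) (hc1 : ∀ i ∈ s, c i ≤ 1) : ∃ ν : ℝ, 0 ≤ ν ∧ siteMoment s r = ν • e ∧
      1 ≤ siteDensity s r ∧ siteDensity s r ≤ 2 ^ s.card ∧ s.card * b ≤ (s.card + 2) * ν := by
  induction s using Finset.strongInduction with
  | H s ih =>
  have hih : ∀ i ∈ s, _ := fun i hi => ih _ (Finset.erase_ssubset hi)
    (fun j hj => hr j (Finset.mem_of_mem_erase hj)) (fun j hj => hc j (Finset.mem_of_mem_erase hj))
    fun j hj => hc1 j (Finset.mem_of_mem_erase hj)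
  have hf : ∃ f : ι → ℝ, ∀ i ∈ s, 0 ≤ f i ∧ siteMoment (s.erase i) r = f i • e := by
    refine ⟨fun i => if hi : i ∈ s then (hih i hi).choose else 0, fun i hi => ?_⟩
    beta_reduce
    rw [dif_pos hi]
    exact ⟨(hih i hi).choose_spec.1, (hih i hi).choose_spec.2.1⟩
  obtain ⟨f, hf⟩ := hf
  have hD : ∀ i ∈ s, 1 ≤ siteDensity (s.erase i) r ∧
      siteDensity (s.erase i) r ≤ 2 ^ (s.erase i).card := by
    intro i hi
    obtain ⟨ν, -, -, h1, h2, -⟩ := hih i hi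
    exact ⟨h1, h2⟩
  have hcard : (0 : ℝ) < s.card + 2 := by positivity
  obtain ⟨ν, hν⟩ : ∃ ν : ℝ, ν = (∑ i ∈ s, (f i + siteDensity (s.erase i) r * c i)) / (s.card + 2) :=
    ⟨_, rfl⟩
  have hterm : ∀ i ∈ s, b ≤ f i + siteDensity (s.erase i) r * c i := by
    intro i hi
    nlinarith [(hf i hi).1, hc i hi, (hD i hi).1]
  have hsum : s.card * b ≤ (s.card + 2) * ν := by
    rw [hν, mul_div_cancel₀ _ hcard.ne', ← nsmul_eq_mul]
    exact Finset.card_nsmul_le_sum s _ b hterm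
  refine ⟨ν, ?_, ?_, ?_, ?_, hsum⟩
  · rw [hν]
    exact div_nonneg (Finset.sum_nonneg fun i hi => hb.trans (hterm i hi)) hcard.le
  · have h := siteMoment_eq s r
    rw [Finset.sum_congr rfl fun i hi => by
      rw [(hf i hi).2, hr i hi, smul_smul, ← add_smul], ← Finset.sum_smul] at h
    rw [hν, div_eq_inv_mul, mul_smul, ← h, smul_smul, inv_mul_cancel₀ hcard.ne', one_smul]
  · rcases s.eq_empty_or_nonempty with rfl | ⟨i, hi⟩
    · rw [siteDensity_empty]
    · rw [← Finset.insert_erase hi, siteDensity_insert (Finset.notMem_erase i s), (hf i hi).2, hr i hi,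
        inner_smul_left, inner_smul_right, real_inner_self_eq_norm_sq, he, conj_trivial]
      nlinarith [(hD i hi).1, mul_nonneg (hb.trans (hc i hi)) (hf i hi).1]
  · rcases s.eq_empty_or_nonempty with rfl | ⟨i, hi⟩
    · rw [siteDensity_empty]; simp
    · have h1 : f i ≤ siteDensity (s.erase i) r := by
        have h2 := norm_siteMoment_lt (s := s.erase i) (r := r) fun j hj => by
          rw [hr j (Finset.mem_of_mem_erase hj), norm_smul, he, mul_one, Real.norm_of_nonneg
            (hb.trans (hc j (Finset.mem_of_mem_erase hj)))]
          exact hc1 j (Finset.mem_of_mem_erase hj)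
        rw [(hf i hi).2, norm_smul, he, mul_one, Real.norm_of_nonneg (hf i hi).1] at h2
        exact h2.le
      have h3 := siteDensity_insert (Finset.notMem_erase i s) r
      rw [Finset.insert_erase hi, (hf i hi).2, hr i hi, inner_smul_left, inner_smul_right,
        real_inner_self_eq_norm_sq, he, conj_trivial] at h3
      have h4 := mul_le_mul (hc1 i hi) h1 (hf i hi).1 zero_le_one
      rw [h3, ← Finset.card_erase_add_one hi, pow_succ (2 : ℝ)]
      linarith [(hD i hi).2]

theorem neg_one_pow_dist_of_adj (hG : G.IsTree) (o : W) {x y : W} (h : G.Adj x y) :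
    (-1 : ℝ) ^ G.dist o y = -(-1) ^ G.dist o x := by
  rcases hG.dist_eq_dist_add_one_of_adj o h with h1 | h1
  · rw [h1, pow_succ]; ring
  · rw [h1, pow_succ]; ring

theorem stateFun_spinAt_div (x : W) (r : W → BlochVector) (hr : ∀ y, ‖r y‖ ≤ 1) :
    stateFun (spinAt G x 2) (vbsPoly G {x} fun y _ => blochMatrix (r y)) /
      stateFun (1 : LocalOp G {x}) (vbsPoly G {x} fun y _ => blochMatrix (r y)) =
      ((-(((G.degree x : ℝ) + 2) / 2 * siteMoment (G.neighborFinset x) r 2 /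
        siteDensity (G.neighborFinset x) r) : ℝ) : ℂ) := by
  rw [stateFun_one_vbsPoly_singleton, vbsPoly_singleton]
  have h1 := stateFun_spinAt_two (G := G) x (G.card_neighborFinset_eq_degree x) r
  rw [legsPoly] at h1
  rw [h1]
  have h2 : (siteDensity (G.neighborFinset x) r : ℂ) ≠ 0 := by
    exact_mod_cast (siteDensity_pos fun y _ => hr y).ne'
  have h3 := natCast_add_one_ne_zero' (G.degree x)
  push_cast
  field_simp

/-- The staggered infinite-volume ground states. -/
theorem exists_staggered_groundState {d g : ℕ} {pos : W → W → ℕ} (hG : IsDecoratedTree G d g pos)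
    (hdg : 3 ^ (g + 1) + 1 < d) (o : W) : ∃ m : ℝ, 0 < m ∧ ∀ s : ℝ, s = 1 ∨ s = -1 →
    ∃ ω : (Λ : Finset W) → LocalOp G Λ → ℂ, IsInfiniteVolumeGroundState G o ω ∧
      ∀ x, m ≤ s * ((-1) ^ G.dist o x * (ω {x} (spinAt G x 2)).re) := by
  have hT := hG.isTree
  have hd := hG.two_le
  obtain ⟨c, hcdef⟩ : ∃ c : ℝ, c = (3⁻¹ : ℝ) ^ g := ⟨_, rfl⟩
  have hc0 : 0 < c := by rw [hcdef]; positivity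
  have hc1 : c ≤ 1 := by rw [hcdef]; exact pow_le_one₀ (by norm_num) (by norm_num)
  have hn : 3 < c * ((d - 1 : ℕ) : ℝ) := by
    have h1 : 3 ^ (g + 1) < d - 1 := by omega
    have h2 : ((3 : ℝ) ^ (g + 1)) < ((d - 1 : ℕ) : ℝ) := by exact_mod_cast h1
    rw [hcdef, inv_pow, inv_mul_eq_div, lt_div_iff₀ (by positivity), ← pow_succ']
    exact h2
  -- Here b is the length of the messages entering a vertex of degree d, t = b/c the length of those
  -- leaving it, and c the reduction by the g sites of a chain.
  obtain ⟨b, hb0, hbc, hbeq⟩ := exists_equalLegs_eq hc0 hc1 hn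
  obtain ⟨t, ht⟩ : ∃ t, t = b / c := ⟨_, rfl⟩
  have ht0 : 0 < t := by rw [ht]; positivity
  have ht1 : t ≤ 1 := by rw [ht, div_le_one hc0]; exact hbc
  have htc : c * t = b := by rw [ht, mul_div_cancel₀ _ hc0.ne']
  have hposle : ∀ y p, b ≤ (3⁻¹ : ℝ) ^ pos y p * t ∧ (3⁻¹ : ℝ) ^ pos y p * t ≤ 1 := by
    intro y p
    constructor
    · rw [← htc, hcdef]
      exact mul_le_mul_of_nonneg_right
        (pow_le_pow_of_le_one (by norm_num) (by norm_num) (hG.pos_le y p)) ht0.le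
    · exact mul_le_one₀ (pow_le_one₀ (by norm_num) (by norm_num)) ht0.le ht1
  -- The factor 2^d bounds the density of a site with at most d legs; b bounds the numerator of the
  -- magnetization because every degree is at least 2.
  refine ⟨b / 2 ^ d, by positivity, fun s hs => ?_⟩
  have hs2 : s * s = 1 := by rcases hs with rfl | rfl <;> norm_num
  have hsabs : |s| = 1 := by rcases hs with rfl | rfl <;> norm_num
  -- The sign alternates between the sublattices, the length falls by 1/3 per site along a chain,
  -- and s selects one of the two opposite states.
  obtain ⟨β, hβ⟩ : ∃ β : W → W → ℝ, β = fun y p => s * (-1) ^ G.dist o y * ((3⁻¹ : ℝ) ^ pos y p * t) :=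
    ⟨_, rfl⟩
  have hβ1 : ∀ y p, |β y p| ≤ 1 := by
    intro y p
    rw [hβ]
    simp only [abs_mul, hsabs, abs_pow, abs_neg, abs_one, one_pow, one_mul]
    rw [← abs_pow, ← abs_mul, abs_of_nonneg (by positivity)]
    exact (hposle y p).2
  have hcons : IsConsistent G fun y p => β y p • northPole := by
    refine ⟨fun y p => ?_, fun y p hyp => ?_⟩
    · rw [norm_smul, norm_northPole, mul_one]; exact hβ1 y p
    · have hcard := card_neighborFinset_erase hyp
      rcases hG.cases y with ⟨hdeg, hy⟩ | ⟨hdeg, hy⟩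
      -- At a vertex of degree d the incoming messages come from the ends of chains, so all have
      -- length ct = b and the opposite sign. The equation for b restores the length t.
      · have hr : ∀ z ∈ (G.neighborFinset y).erase p, β z y • northPole =
            (-(s * (-1) ^ G.dist o y) * b) • northPole := by
          intro z hz
          have hyz : G.Adj y z :=
            (SimpleGraph.mem_neighborFinset _ _ _).mp (Finset.mem_of_mem_erase hz)
          rw [hβ]
          simp only
          rw [(hy z hyz).2, neg_one_pow_dist_of_adj hT o hyz, ← htc, hcdef]
          congr 1
          ring
        have hnorm : ‖(-(s * (-1) ^ G.dist o y) * b) • northPole‖ ^ 2 = b ^ 2 := by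
          rw [norm_smul, norm_northPole, mul_one, Real.norm_eq_abs, sq_abs, mul_pow, neg_sq, mul_pow,
            ← pow_mul, mul_comm (G.dist o y), pow_mul, neg_one_sq, one_pow, sq s, hs2, one_mul, one_mul]
        rw [siteMessage_equal hr, hnorm, show ((G.neighborFinset y).erase p).card = d - 1 by omega, hbeq,
          smul_smul, ← neg_smul, hβ]
        simp only
        rw [(hy p hyp).1, ht]
        have hV := equalLegs_snd_pos (sq_nonneg b) (show d - 1 ≠ 0 by omega)
        congr 1
        field_simp
      · have hr : ∀ z ∈ (G.neighborFinset y).erase p, β z y • northPole = (-3 * β y p) • northPole := by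
          intro z hz
          have hyz : G.Adj y z :=
            (SimpleGraph.mem_neighborFinset _ _ _).mp (Finset.mem_of_mem_erase hz)
          rw [hβ]
          simp only
          rw [hy p z hyp hyz (Finset.ne_of_mem_erase hz).symm, neg_one_pow_dist_of_adj hT o hyz, pow_succ]
          congr 1
          ring
        rw [siteMessage_equal hr, show ((G.neighborFinset y).erase p).card = 1 by omega]
        simp only [equalLegs]
        rw [smul_smul, ← neg_smul]
        congr 1
        norm_num
        ring
  obtain ⟨ω, hω, hωx⟩ := exists_infiniteVolumeGroundState hT o hβ1 hcons
  refine ⟨ω, hω, fun x => ?_⟩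
  have hvbs : vbsPoly G {x} (fun y p => blochMatrix (β y p • northPole)) =
      vbsPoly G {x} (fun y _ => blochMatrix (β y x • northPole)) := by
    rw [vbsPoly_singleton, vbsPoly_singleton]
  rw [hωx, hvbs, stateFun_spinAt_div x (fun y => β y x • northPole) fun y => hcons.1 y x,
    Complex.ofReal_re]
  obtain ⟨σ, hσ⟩ : ∃ σ : ℝ, σ = s * (-1) ^ G.dist o x := ⟨_, rfl⟩
  have hσ2 : σ * σ = 1 := by
    rw [hσ, mul_mul_mul_comm, hs2, ← pow_add, Even.neg_one_pow ⟨_, rfl⟩, one_mul]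
  have he : ‖-σ • northPole‖ = 1 := by
    rw [norm_smul, norm_northPole, mul_one, norm_neg, hσ, norm_mul, norm_pow, norm_neg, norm_one, one_pow,
      mul_one, Real.norm_eq_abs, hsabs]
  -- The messages at x come from the other sublattice, so they are positive multiples of minus the
  -- staggered direction. The minus sign in the expectation of S³ compensates this.
  obtain ⟨ν, hν0, hν, hD1, hD2, hνb⟩ := siteMoments_aligned he (r := fun y => β y x • northPole)
    (c := fun y => (3⁻¹ : ℝ) ^ pos y x * t) hb0.le (G.neighborFinset x)
    (fun y hy => by
      rw [SimpleGraph.mem_neighborFinset] at hy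
      rw [hβ, smul_smul, hσ]
      simp only
      rw [neg_one_pow_dist_of_adj hT o hy]
      congr 1
      ring)
    (fun y _ => (hposle y x).1) fun y _ => (hposle y x).2
  rw [hν, G.card_neighborFinset_eq_degree] at *
  have h2 : ((ν • -σ • northPole : BlochVector)) 2 = -(σ * ν) := by
    simp [northPole]
    ring
  rw [h2]
  have hdeg : (2 : ℝ) ≤ G.degree x ∧ G.degree x ≤ d := by
    rcases hG.cases x with ⟨h, -⟩ | ⟨h, -⟩
    · rw [h]; exact ⟨by exact_mod_cast hd, le_rfl⟩
    · rw [h]; exact ⟨by norm_num, hd⟩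
  have hD3 : siteDensity (G.neighborFinset x) (fun y => β y x • northPole) ≤ 2 ^ d :=
    hD2.trans (pow_le_pow_right₀ (by norm_num) hdeg.2)
  generalize siteDensity (G.neighborFinset x) (fun y => β y x • northPole) = D at *
  have hD0 : 0 < D := by linarith
  have h3 : s * ((-1) ^ G.dist o x * -(((G.degree x : ℝ) + 2) / 2 * -(σ * ν) / D)) =
      ((G.degree x : ℝ) + 2) * ν / 2 / D := by
    rw [show s * ((-1) ^ G.dist o x * -(((G.degree x : ℝ) + 2) / 2 * -(σ * ν) / D)) =
      (s * (-1) ^ G.dist o x) * σ * (((G.degree x : ℝ) + 2) * ν / 2 / D) by ring, ← hσ, hσ2, one_mul]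
  rw [h3]
  have h4 : b ≤ ((G.degree x : ℝ) + 2) * ν / 2 := by nlinarith [hdeg.1]
  gcongr

theorem isOrdered_of_isDecoratedTree {d g : ℕ} {pos : W → W → ℕ} (hG : IsDecoratedTree G d g pos)
    (hdg : 3 ^ (g + 1) + 1 < d) (o : W) : IsOrdered G o ∧ ¬ HasUniqueGroundState G o := by
  obtain ⟨m, hm, h⟩ := exists_staggered_groundState hG hdg o
  obtain ⟨ω, hω, hωm⟩ := h 1 (Or.inl rfl)
  obtain ⟨ω', hω', hωm'⟩ := h (-1) (Or.inr rfl)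
  refine ⟨⟨ω, hω, m, hm, fun x => by simpa using hωm x⟩, fun hu => ?_⟩
  have heq := hu.unique hω hω'
  have h1 := hωm o
  have h2 := hωm' o
  rw [← heq] at h2
  linarith

end Order


/-! ### Averages over coherent states -/

section Coherent

open scoped Classical ComplexOrder

/-- The beta integral represents the inverse binomials of a trace over a spin as moments of a
positive measure; it is the radial part of the coherent-state average. -/
theorem integral_pow_mul_one_sub_pow (i j : ℕ) :
    (∫ x in (0 : ℝ)..1, x ^ i * (1 - x) ^ j) * (((i : ℝ) + j + 1) * ((i + j).choose i : ℝ)) = 1 := by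
  induction j generalizing i with
  | zero =>
    simp only [pow_zero, mul_one, add_zero, Nat.choose_self, Nat.cast_one, CharP.cast_eq_zero]
    rw [integral_pow]
    have : (i : ℝ) + 1 ≠ 0 := by positivity
    field_simp
    simp
  | succ j ih =>
    have hparts : ((i : ℝ) + 1) * (∫ x in (0 : ℝ)..1, x ^ i * (1 - x) ^ (j + 1)) =
        ((j : ℝ) + 1) * ∫ x in (0 : ℝ)..1, x ^ (i + 1) * (1 - x) ^ j := by
      have hderiv : ∀ x ∈ Set.uIcc (0 : ℝ) 1, HasDerivAt (fun x : ℝ => x ^ (i + 1) * (1 - x) ^ (j + 1))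
          (((i : ℝ) + 1) * (x ^ i * (1 - x) ^ (j + 1)) -
            ((j : ℝ) + 1) * (x ^ (i + 1) * (1 - x) ^ j)) x := by
        intro x _
        have h1 := hasDerivAt_pow (i + 1) x
        have h2 := ((hasDerivAt_id x).const_sub 1).pow (j + 1)
        refine (h1.mul h2).congr_deriv ?_
        simp only [Nat.add_sub_cancel, id, Pi.pow_apply]
        push_cast
        ring
      have hint := intervalIntegral.integral_eq_sub_of_hasDerivAt hderiv
        (Continuous.intervalIntegrable (by fun_prop) _ _)
      rw [intervalIntegral.integral_sub (Continuous.intervalIntegrable (by fun_prop) _ _)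
        (Continuous.intervalIntegrable (by fun_prop) _ _), intervalIntegral.integral_const_mul,
        intervalIntegral.integral_const_mul] at hint
      simp at hint
      linarith
    have h := ih (i + 1)
    have hchoose : ((i + 1 + j).choose (i + 1) : ℝ) * (i + 1) = ((i + (j + 1)).choose i : ℝ) * (j + 1) := by
      have := Nat.choose_succ_right_eq (i + 1 + j) i
      rw [show i + 1 + j - i = j + 1 by omega] at this
      rw [show i + (j + 1) = i + 1 + j by omega]
      exact_mod_cast this
    push_cast at h ⊢
    have hi : (i : ℝ) + 1 ≠ 0 := by positivity
    have hj : (j : ℝ) + 1 ≠ 0 := by positivity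
    refine mul_left_cancel₀ hi (mul_left_cancel₀ hj ?_)
    generalize (∫ x in (0 : ℝ)..1, x ^ i * (1 - x) ^ (j + 1)) = I at *
    generalize (∫ x in (0 : ℝ)..1, x ^ (i + 1) * (1 - x) ^ j) = I' at *
    generalize ((i + 1 + j).choose (i + 1) : ℝ) = c at *
    generalize ((i + (j + 1)).choose i : ℝ) = c' at *
    have e1 : ((j : ℝ) + 1) * (((i : ℝ) + 1) * (I * (((i : ℝ) + (j + 1) + 1) * c'))) =
        (((i : ℝ) + 1) * I) * ((i : ℝ) + (j + 1) + 1) * (c' * (j + 1)) := by ring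
    rw [e1, hparts, ← hchoose]
    linear_combination ((i : ℝ) + 1) * ((j : ℝ) + 1) * h

theorem sum_rootOfUnity_mul {M : ℕ} {ω : ℂ} (hω : IsPrimitiveRoot ω M) {k l : ℕ} (hk : k < M)
    (hl : l < M) : ∑ j ∈ Finset.range M, (ω ^ j) ^ k * ((ω ^ j)⁻¹) ^ l = if k = l then (M : ℂ) else 0 := by
  have hω0 : ω ≠ 0 := hω.ne_zero (by omega)
  have h1 : ∀ j, (ω ^ j) ^ k * ((ω ^ j)⁻¹) ^ l = (ω ^ k * (ω ^ l)⁻¹) ^ j := by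
    intro j
    rw [inv_pow, mul_pow, inv_pow, ← pow_mul, ← pow_mul, ← pow_mul, ← pow_mul, mul_comm j k, mul_comm j l]
  simp only [h1]
  split_ifs with hkl
  · rw [hkl, mul_inv_cancel₀ (pow_ne_zero l hω0)]
    simp
  · have hne : ω ^ k * (ω ^ l)⁻¹ ≠ 1 := by
      intro h
      rw [mul_inv_eq_one₀ (pow_ne_zero l hω0)] at h
      exact hkl (hω.pow_inj hk hl h)
    have hpow : (ω ^ k * (ω ^ l)⁻¹) ^ M = 1 := by
      rw [mul_pow, inv_pow, ← pow_mul, ← pow_mul, mul_comm k, mul_comm l, pow_mul, pow_mul, hω.pow_eq_one,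
        one_pow, one_pow, inv_one, mul_one]
    rw [geom_sum_eq hne, hpow, sub_self, zero_div]

/-- The value of a polynomial in `ζ` and its conjugate. -/
noncomputable def coherentSum (m : ℕ) (a : ℕ → ℕ → ℂ) (ζ : ℂ) : ℂ :=
  ∑ k ∈ Finset.range (m + 1), ∑ l ∈ Finset.range (m + 1), ζ ^ k * star ζ ^ l * a k l

/-- The angular part of the average. All exponents are at most m, so the (m+1)-st roots of unity
already remove the off-diagonal terms, as an integral over the circle would. -/
theorem sum_coherentSum (m : ℕ) (a : ℕ → ℕ → ℂ) {q : ℝ} (hq : 0 ≤ q) {ω : ℂ}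
    (hω : IsPrimitiveRoot ω (m + 1)) :
    ∑ j ∈ Finset.range (m + 1), coherentSum m a ((Real.sqrt q : ℝ) * ω ^ j) =
      ((m : ℂ) + 1) * ∑ k ∈ Finset.range (m + 1), ((q ^ k : ℝ) : ℂ) * a k k := by
  have hnorm : star ω = ω⁻¹ := by
    rw [Complex.inv_def, Complex.normSq_eq_norm_sq, hω.norm'_eq_one (Nat.succ_ne_zero m)]
    simp
  have hstar : ∀ j, star (((Real.sqrt q : ℝ) : ℂ) * ω ^ j) = (Real.sqrt q : ℝ) * (ω ^ j)⁻¹ := by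
    intro j
    rw [star_mul', star_pow, hnorm, inv_pow, Complex.star_def, Complex.conj_ofReal]
  simp only [coherentSum, hstar]
  rw [Finset.sum_comm, Finset.mul_sum]
  refine Finset.sum_congr rfl fun k hk => ?_
  rw [Finset.sum_comm]
  have h1 : ∀ l ∈ Finset.range (m + 1), ∑ j ∈ Finset.range (m + 1),
      (((Real.sqrt q : ℝ) : ℂ) * ω ^ j) ^ k * (((Real.sqrt q : ℝ) : ℂ) * (ω ^ j)⁻¹) ^ l * a k l =
      if k = l then ((m : ℂ) + 1) * (((q ^ k : ℝ) : ℂ) * a k k) else 0 := by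
    intro l hl
    have h2 : ∀ j, (((Real.sqrt q : ℝ) : ℂ) * ω ^ j) ^ k * (((Real.sqrt q : ℝ) : ℂ) * (ω ^ j)⁻¹) ^ l *
        a k l = ((Real.sqrt q : ℝ) : ℂ) ^ k * ((Real.sqrt q : ℝ) : ℂ) ^ l * a k l *
          ((ω ^ j) ^ k * ((ω ^ j)⁻¹) ^ l) := by
      intro j
      rw [mul_pow, mul_pow]
      ring
    rw [Finset.sum_congr rfl fun j _ => h2 j, ← Finset.mul_sum,
      sum_rootOfUnity_mul hω (Finset.mem_range.mp hk) (Finset.mem_range.mp hl)]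
    split_ifs with hkl
    · rw [← hkl, ← mul_pow, ofReal_sqrt_mul_self hq]
      push_cast
      ring
    · rw [mul_zero]
  rw [Finset.sum_congr rfl h1, Finset.sum_ite_eq, if_pos hk]

theorem norm_sum_pow_le {m : ℕ} {a b : ℕ → ℕ → ℂ}
    (h : ∀ ζ, ‖coherentSum m a ζ‖ ≤ (coherentSum m b ζ).re) {q : ℝ} (hq : 0 ≤ q) :
    ‖∑ k ∈ Finset.range (m + 1), ((q ^ k : ℝ) : ℂ) * a k k‖ ≤
      ∑ k ∈ Finset.range (m + 1), q ^ k * (b k k).re := by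
  obtain ⟨ω, hω⟩ : ∃ ω : ℂ, IsPrimitiveRoot ω (m + 1) :=
    ⟨_, Complex.isPrimitiveRoot_exp (m + 1) (Nat.succ_ne_zero m)⟩
  have h1 := (norm_sum_le (Finset.range (m + 1)) fun j =>
    coherentSum m a ((Real.sqrt q : ℝ) * ω ^ j)).trans
      (Finset.sum_le_sum fun j _ => h ((Real.sqrt q : ℝ) * ω ^ j))
  rw [← Complex.re_sum, sum_coherentSum m a hq hω, sum_coherentSum m b hq hω] at h1
  have hm : ((m : ℂ) + 1) = (((m : ℝ) + 1 : ℝ) : ℂ) := by push_cast; rfl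
  have hm0 : (0 : ℝ) < (m : ℝ) + 1 := by positivity
  rw [hm, norm_mul, Complex.norm_real, Real.norm_of_nonneg hm0.le, Complex.re_ofReal_mul] at h1
  refine (le_of_mul_le_mul_left h1 hm0).trans_eq ?_
  rw [Complex.re_sum]
  exact Finset.sum_congr rfl fun k _ => Complex.re_ofReal_mul _ _

/-- A bound that holds at every coherent state survives the positive average, and the average is the
trace over the spin. The radial variable is q = x/(1-x) with weight (1-x)^m; the endpoint x = 1,
where q is infinite, is a null set. -/
theorem norm_sum_choose_inv_le {m : ℕ} {a b : ℕ → ℕ → ℂ}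
    (h : ∀ ζ, ‖coherentSum m a ζ‖ ≤ (coherentSum m b ζ).re) :
    ‖∑ k ∈ Finset.range (m + 1), (m.choose k : ℂ)⁻¹ * a k k‖ ≤
      (∑ k ∈ Finset.range (m + 1), (m.choose k : ℂ)⁻¹ * b k k).re := by
  have hpt : ∀ x : ℝ, 0 ≤ x → x < 1 →
      ‖∑ k ∈ Finset.range (m + 1), (x ^ k * (1 - x) ^ (m - k)) • a k k‖ ≤
        ∑ k ∈ Finset.range (m + 1), (x ^ k * (1 - x) ^ (m - k)) * (b k k).re := by
    intro x hx0 hx1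
    have hpos : 0 < 1 - x := by linarith
    have h1 := mul_le_mul_of_nonneg_left (norm_sum_pow_le h (div_nonneg hx0 hpos.le))
      (pow_nonneg hpos.le m)
    have h2 : ∀ k ∈ Finset.range (m + 1),
        (1 - x) ^ m * (x / (1 - x)) ^ k = x ^ k * (1 - x) ^ (m - k) := by
      intro k hk
      have hkm : m = (m - k) + k := by have := Finset.mem_range.mp hk; omega
      conv_lhs => rw [hkm, pow_add, div_pow]
      field_simp
    rw [Finset.mul_sum, ← Real.norm_of_nonneg (pow_nonneg hpos.le m), ← Complex.norm_real, ← norm_mul,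
      Finset.mul_sum, Complex.norm_real, Real.norm_of_nonneg (pow_nonneg hpos.le m)] at h1
    have e1 : ∑ k ∈ Finset.range (m + 1), (x ^ k * (1 - x) ^ (m - k)) • a k k =
        ∑ k ∈ Finset.range (m + 1), (((1 - x) ^ m : ℝ) : ℂ) * ((((x / (1 - x)) ^ k : ℝ) : ℂ) * a k k) := by
      refine Finset.sum_congr rfl fun k hk => ?_
      rw [← h2 k hk, Complex.real_smul, Complex.ofReal_mul, mul_assoc]
    have e2 : ∑ k ∈ Finset.range (m + 1), (x ^ k * (1 - x) ^ (m - k)) * (b k k).re =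
        ∑ k ∈ Finset.range (m + 1), (1 - x) ^ m * ((x / (1 - x)) ^ k * (b k k).re) := by
      refine Finset.sum_congr rfl fun k hk => ?_
      rw [← h2 k hk, mul_assoc]
    rw [e1, e2]
    exact h1
  have hint : ∀ k ∈ Finset.range (m + 1), ∫ x in (0 : ℝ)..1, x ^ k * (1 - x) ^ (m - k) =
      ((m : ℝ) + 1)⁻¹ * (m.choose k : ℝ)⁻¹ := by
    intro k hk
    have hkm : k + (m - k) = m := by have := Finset.mem_range.mp hk; omega
    have h1 := integral_pow_mul_one_sub_pow k (m - k)
    rw [hkm, show (k : ℝ) + ((m - k : ℕ) : ℝ) = m by exact_mod_cast hkm] at h1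
    rw [← mul_inv]
    exact eq_inv_of_mul_eq_one_left h1
  have hmono := intervalIntegral.norm_integral_le_of_norm_le (μ := MeasureTheory.volume) (a := (0 : ℝ))
    (b := 1) (f := fun x => ∑ k ∈ Finset.range (m + 1), (x ^ k * (1 - x) ^ (m - k)) • a k k)
    (g := fun x => ∑ k ∈ Finset.range (m + 1), (x ^ k * (1 - x) ^ (m - k)) * (b k k).re) zero_le_one
    (by
      filter_upwards [MeasureTheory.compl_mem_ae_iff.mpr (MeasureTheory.measure_singleton (1 : ℝ))]
        with x hx1 hx
      exact hpt x hx.1.le (lt_of_le_of_ne hx.2 hx1))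
    (Continuous.intervalIntegrable (by fun_prop) _ _)
  rw [intervalIntegral.integral_finsetSum fun k _ => Continuous.intervalIntegrable (by fun_prop) _ _,
    intervalIntegral.integral_finsetSum fun k _ => Continuous.intervalIntegrable (by fun_prop) _ _]
    at hmono
  simp only [intervalIntegral.integral_smul_const, intervalIntegral.integral_mul_const] at hmono
  have e1 : ∑ k ∈ Finset.range (m + 1), (∫ x in (0 : ℝ)..1, x ^ k * (1 - x) ^ (m - k)) • a k k =
      (((m : ℝ) + 1)⁻¹ : ℝ) • ∑ k ∈ Finset.range (m + 1), (m.choose k : ℂ)⁻¹ * a k k := by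
    rw [Finset.smul_sum]
    refine Finset.sum_congr rfl fun k hk => ?_
    rw [hint k hk, mul_smul]
    simp
  have e2 : ∑ k ∈ Finset.range (m + 1), (∫ x in (0 : ℝ)..1, x ^ k * (1 - x) ^ (m - k)) * (b k k).re =
      ((m : ℝ) + 1)⁻¹ * (∑ k ∈ Finset.range (m + 1), (m.choose k : ℂ)⁻¹ * b k k).re := by
    rw [Complex.re_sum, Finset.mul_sum]
    refine Finset.sum_congr rfl fun k hk => ?_
    rw [hint k hk, mul_assoc, show ((m.choose k : ℂ)⁻¹) = (((m.choose k : ℝ)⁻¹ : ℝ) : ℂ) by push_cast; rfl,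
      Complex.re_ofReal_mul]
  have hm : (0 : ℝ) < ((m : ℝ) + 1)⁻¹ := by positivity
  rw [e1, e2, norm_smul, Real.norm_of_nonneg hm.le] at hmono
  exact le_of_mul_le_mul_left hmono hm

/-! ### Fixing the variables of a site -/

variable {W : Type*}

/-- The substitution of a number for the variable of the site `y`. -/
noncomputable def fixVar (y : W) (c : ℂ) : MvPolynomial W ℂ →ₐ[ℂ] MvPolynomial W ℂ :=
  MvPolynomial.aeval fun x => if x = y then MvPolynomial.C c else MvPolynomial.X x

theorem fixVar_monomial (y : W) (c : ℂ) (d : W →₀ ℕ) (r : ℂ) :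
    fixVar y c (MvPolynomial.monomial d r) = MvPolynomial.monomial (d.erase y) (r * c ^ d y) := by
  rw [fixVar, MvPolynomial.aeval_monomial, ← Finsupp.mul_prod_erase' d y
    (fun x k => (if x = y then MvPolynomial.C c else MvPolynomial.X x : MvPolynomial W ℂ) ^ k) fun _ => pow_zero _,
    if_pos rfl, MvPolynomial.algebraMap_eq, ← map_pow, ← mul_assoc, ← map_mul,
    MvPolynomial.monomial_eq (s := d.erase y)]
  congr 1
  refine Finsupp.prod_congr fun x hx => ?_
  rw [Finsupp.support_erase] at hx
  rw [if_neg (Finset.ne_of_mem_erase hx)]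

/-- A threshold that does not refer to the degree lets the induction pass through sums, where
degrees may drop. The sharp range is recovered in `coeff_fixVar`. -/
theorem coeff_fixVar_aux (y : W) (c : ℂ) (p : MvPolynomial W ℂ) : ∃ M₀, ∀ M ≥ M₀, ∀ e : W →₀ ℕ, e y = 0 →
    MvPolynomial.coeff e (fixVar y c p) =
      ∑ k ∈ Finset.range M, c ^ k * MvPolynomial.coeff (e + Finsupp.single y k) p := by
  induction p using MvPolynomial.induction_on' with
  | add p q hp hq =>
    obtain ⟨M₁, h1⟩ := hp
    obtain ⟨M₂, h2⟩ := hq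
    refine ⟨max M₁ M₂, fun M hM e he => ?_⟩
    simp only [map_add, MvPolynomial.coeff_add, mul_add, Finset.sum_add_distrib]
    rw [h1 M (le_of_max_le_left hM) e he, h2 M (le_of_max_le_right hM) e he]
  | monomial d r =>
    refine ⟨d y + 1, fun M hM e he => ?_⟩
    rw [fixVar_monomial, MvPolynomial.coeff_monomial]
    simp only [MvPolynomial.coeff_monomial]
    have hiff : ∀ k, d = e + Finsupp.single y k ↔ d.erase y = e ∧ d y = k := by
      intro k
      constructor
      · rintro rfl
        rw [Finsupp.erase_add, Finsupp.erase_single, add_zero, Finsupp.erase_of_notMem_support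
          (by rwa [Finsupp.notMem_support_iff])]
        simp [he]
      · rintro ⟨rfl, rfl⟩
        exact (Finsupp.erase_add_single y d).symm
    simp only [hiff]
    split_ifs with h
    · simp only [h, true_and]
      rw [Finset.sum_eq_single (d y)]
      · rw [if_pos rfl, mul_comm]
      · intro k _ hk
        rw [if_neg hk.symm, mul_zero]
      · intro hk
        exact absurd (Finset.mem_range.mpr (by omega)) hk
    · simp [h]

theorem coeff_fixVar {y : W} (c : ℂ) {p : MvPolynomial W ℂ} {m : ℕ} (hp : p.degreeOf y ≤ m)
    {e : W →₀ ℕ} (he : e y = 0) : MvPolynomial.coeff e (fixVar y c p) =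
      ∑ k ∈ Finset.range (m + 1), c ^ k * MvPolynomial.coeff (e + Finsupp.single y k) p := by
  obtain ⟨M₀, h⟩ := coeff_fixVar_aux y c p
  rw [h (max M₀ (m + 1)) (le_max_left _ _) e he]
  symm
  refine Finset.sum_subset (Finset.range_mono (le_max_right _ _)) fun k _ hk => ?_
  rw [Finset.mem_range, not_lt] at hk
  have h0 : MvPolynomial.coeff (e + Finsupp.single y k) p = 0 := by
    by_contra hne
    have := MvPolynomial.monomial_le_degreeOf y (MvPolynomial.mem_support_iff.mpr hne)
    rw [Finsupp.add_apply, he, Finsupp.single_eq_same] at this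
    omega
  rw [h0, mul_zero]

theorem degreeOf_fixVar_le (y z : W) (c : ℂ) (p : MvPolynomial W ℂ) :
    (fixVar y c p).degreeOf z ≤ p.degreeOf z := by
  rw [MvPolynomial.degreeOf_le_iff]
  intro e he
  rw [MvPolynomial.mem_support_iff] at he
  conv at he => rw [MvPolynomial.as_sum p, map_sum, MvPolynomial.coeff_sum]
  obtain ⟨d, hd, hne⟩ := Finset.exists_ne_zero_of_sum_ne_zero he
  rw [fixVar_monomial, MvPolynomial.coeff_monomial] at hne
  have hde : d.erase y = e := by
    by_contra h
    exact hne (if_neg h)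
  refine le_trans ?_ (MvPolynomial.monomial_le_degreeOf z hd)
  rw [← hde, Finsupp.erase_apply]
  split_ifs <;> omega

/-- The substitution of numbers for the variables of the sites in `t`. -/
noncomputable def fixVars (t : Finset W) (ζ : W → ℂ) : MvPolynomial W ℂ →ₐ[ℂ] MvPolynomial W ℂ :=
  MvPolynomial.aeval fun x => if x ∈ t then MvPolynomial.C (ζ x) else MvPolynomial.X x

theorem fixVars_insert {y : W} {t : Finset W} (ζ : W → ℂ) (p : MvPolynomial W ℂ) :
    fixVars (insert y t) ζ p = fixVars t ζ (fixVar y (ζ y) p) := by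
  have h : fixVars (insert y t) ζ = (fixVars t ζ).comp (fixVar y (ζ y)) := by
    refine MvPolynomial.algHom_ext fun x => ?_
    rw [AlgHom.comp_apply, fixVars, fixVar, MvPolynomial.aeval_X, MvPolynomial.aeval_X]
    by_cases hx : x = y
    · rw [if_pos (by rw [hx]; exact Finset.mem_insert_self y t), if_pos hx, hx,
        ← MvPolynomial.algebraMap_eq, AlgHom.commutes]
    · rw [if_neg hx, fixVars, MvPolynomial.aeval_X]
      simp only [Finset.mem_insert, hx, false_or]
  rw [h, AlgHom.comp_apply]

variable {G : SimpleGraph W} [G.LocallyFinite] {Λ : Finset W}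

/-- The functional of the observable `A` is within `ε` of the constant `c`, relative to the
normalization. -/
def IsCloseTo (A : LocalOp G Λ) (c : ℂ) (ε : ℝ) (P : MvPolynomial (W ⊕ W) ℂ) : Prop :=
  ‖stateFun A P - c * stateFun (1 : LocalOp G Λ) P‖ ≤ ε * (stateFun (1 : LocalOp G Λ) P).re

/-- Fixing the variable of y in ket and bra gives a sesquilinear sum over the exponents at y. Its
diagonal coefficients are those that occur in the trace over y. -/
theorem stateFun_doubled_fixVar {y : W} (hy : y ∉ Λ) (A : LocalOp G Λ) {p : MvPolynomial W ℂ} {m : ℕ}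
    (hp : p.degreeOf y ≤ m) (ζ : ℂ) : stateFun A (doubled (fixVar y ζ p)) =
      coherentSum m (fun k l => stateFun A ((doubled p).divMonomial (siteExpo y k l))) ζ := by
  have hexpo : ∀ (σ τ : Config G Λ) (k l : ℕ), siteExpo y k l + expo₂ σ τ =
      Finsupp.sumElim (expo σ + Finsupp.single y k) (expo τ + Finsupp.single y l) := by
    intro σ τ k l
    rw [expo₂, siteExpo, sumElim_eq_mapDomain_add, sumElim_eq_mapDomain_add, Finsupp.mapDomain_add,
      Finsupp.mapDomain_add, Finsupp.mapDomain_single, Finsupp.mapDomain_single]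
    abel
  have hswap : ∀ f : ℕ → ℕ → Config G Λ → Config G Λ → ℂ,
      ∑ k ∈ Finset.range (m + 1), ∑ l ∈ Finset.range (m + 1), ∑ σ, ∑ τ, f k l σ τ =
        ∑ σ, ∑ τ, ∑ k ∈ Finset.range (m + 1), ∑ l ∈ Finset.range (m + 1), f k l σ τ := by
    intro f
    calc _ = ∑ k ∈ Finset.range (m + 1), ∑ σ, ∑ τ, ∑ l ∈ Finset.range (m + 1), f k l σ τ := by
          refine Finset.sum_congr rfl fun k _ => ?_
          rw [Finset.sum_comm]
          exact Finset.sum_congr rfl fun σ _ => Finset.sum_comm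
      _ = _ := by
          rw [Finset.sum_comm]
          exact Finset.sum_congr rfl fun σ _ => Finset.sum_comm
  simp only [coherentSum, stateFun_apply, Finset.mul_sum]
  rw [hswap]
  refine Finset.sum_congr rfl fun σ _ => Finset.sum_congr rfl fun τ _ => ?_
  rw [doubled, expo₂, coeff_rename_inl_mul_rename_inr, MvPolynomial.coeff_map,
    coeff_fixVar ζ hp (expo_apply_of_notMem σ hy), coeff_fixVar ζ hp (expo_apply_of_notMem τ hy), map_sum,
    Finset.sum_mul_sum, Finset.sum_div, Finset.mul_sum]
  refine Finset.sum_congr rfl fun k _ => ?_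
  rw [Finset.sum_div, Finset.mul_sum]
  refine Finset.sum_congr rfl fun l _ => ?_
  have h1 := hexpo σ τ k l
  rw [expo₂] at h1
  rw [MvPolynomial.coeff_divMonomial, h1, doubled, coeff_rename_inl_mul_rename_inr, MvPolynomial.coeff_map,
    map_mul, map_pow, Complex.star_def]
  ring

theorem coherentSum_sub_mul (m : ℕ) (a b : ℕ → ℕ → ℂ) (c ζ : ℂ) :
    coherentSum m a ζ - c * coherentSum m b ζ = coherentSum m (fun k l => a k l - c * b k l) ζ := by
  simp only [coherentSum, Finset.mul_sum, ← Finset.sum_sub_distrib]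
  refine Finset.sum_congr rfl fun k _ => Finset.sum_congr rfl fun l _ => ?_
  ring

theorem mul_re_coherentSum (m : ℕ) (b : ℕ → ℕ → ℂ) (ε : ℝ) (ζ : ℂ) :
    ε * (coherentSum m b ζ).re = (coherentSum m (fun k l => (ε : ℂ) * b k l) ζ).re := by
  rw [← Complex.re_ofReal_mul]
  congr 1
  simp only [coherentSum, Finset.mul_sum]
  refine Finset.sum_congr rfl fun k _ => Finset.sum_congr rfl fun l _ => ?_
  ring

/-- A state on a larger region is an average over coherent states of the additional site. -/
theorem IsCloseTo.of_fixVar {y : W} (hy : y ∉ Λ) {A : LocalOp G Λ} {c : ℂ} {ε : ℝ}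
    {p : MvPolynomial W ℂ} (hp : p.degreeOf y ≤ G.degree y)
    (h : ∀ ζ, IsCloseTo A c ε (doubled (fixVar y ζ p))) :
    IsCloseTo (extendOp G (Finset.subset_insert y Λ) A) c ε (doubled p) := by
  have h1 := norm_sum_choose_inv_le (m := G.degree y)
    (a := fun k l => stateFun A ((doubled p).divMonomial (siteExpo y k l)) -
      c * stateFun (1 : LocalOp G Λ) ((doubled p).divMonomial (siteExpo y k l)))
    (b := fun k l => (ε : ℂ) * stateFun (1 : LocalOp G Λ) ((doubled p).divMonomial (siteExpo y k l)))
    (fun ζ => by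
      have := h ζ
      rwa [IsCloseTo, stateFun_doubled_fixVar hy A hp, stateFun_doubled_fixVar hy 1 hp,
        coherentSum_sub_mul, mul_re_coherentSum] at this)
  have e1 := stateFun_extendOp_insert hy A (doubled p)
  have e2 := stateFun_extendOp_insert hy (1 : LocalOp G Λ) (doubled p)
  rw [extendOp_one] at e2
  rw [IsCloseTo, e1, e2]
  convert h1 using 1
  · congr 1
    rw [Finset.mul_sum, ← Finset.sum_sub_distrib]
    exact Finset.sum_congr rfl fun k _ => by ring
  · rw [← Complex.re_ofReal_mul, Finset.mul_sum]
    congr 1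
    exact Finset.sum_congr rfl fun k _ => by ring

theorem IsCloseTo.of_fixVars {A : LocalOp G Λ} {c : ℂ} {ε : ℝ} (t : Finset W) : ∀ {S : Finset W}
    (_ : S = Λ ∪ t) (_ : Disjoint Λ t) (h : Λ ⊆ S) {p : MvPolynomial W ℂ}
    (_ : ∀ z ∈ t, p.degreeOf z ≤ G.degree z)
    (_ : ∀ ζ, IsCloseTo A c ε (doubled (fixVars t ζ p))), IsCloseTo (extendOp G h A) c ε (doubled p) := by
  induction t using Finset.induction_on with
  | empty =>
    intro S hS _ h p _ hζ
    obtain rfl : Λ = S := by rw [hS, Finset.union_empty]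
    rw [extendOp_self]
    have h1 : fixVars ∅ (0 : W → ℂ) p = p := by
      rw [fixVars]
      simp
    have h2 := hζ 0
    rwa [h1] at h2
  | insert y t hy ih =>
    intro S hS hd h p hp hζ
    rw [Finset.disjoint_insert_right] at hd
    rw [Finset.union_insert] at hS
    subst hS
    have hyS : y ∉ Λ ∪ t := by simp [hy, hd.1]
    rw [← extendOp_extendOp Finset.subset_union_left (Finset.subset_insert y (Λ ∪ t)) A]
    refine IsCloseTo.of_fixVar hyS (hp y (Finset.mem_insert_self y t)) fun ζ₀ => ?_
    refine ih rfl hd.2 Finset.subset_union_left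
      (fun z hz => (degreeOf_fixVar_le y z ζ₀ p).trans (hp z (Finset.mem_insert_of_mem hz))) fun ζ => ?_
    have h1 := hζ (Function.update ζ y ζ₀)
    rw [fixVars_insert, Function.update_self] at h1
    have h2 : fixVars t (Function.update ζ y ζ₀) = fixVars t ζ := by
      rw [fixVars, fixVars]
      congr 1
      funext x
      split_ifs with hx
      · rw [Function.update_of_ne (ne_of_mem_of_not_mem hx hy)]
      · rfl
    rwa [h2] at h1

end Coherent


/-! ### Ground states with coherent boundary conditions -/

section Boundary

open scoped Classical ComplexOrder

variable {W : Type*} {G : SimpleGraph W} [G.LocallyFinite] {Λ S : Finset W}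

/-- The matrix is v v* with v = (ζ, 1). So s is half its trace, and u is obtained from ζ by inverse
stereographic projection, up to a reflection. -/
theorem exists_blochMatrix_of_coherent (ζ : ℂ) : ∃ s : ℝ, 0 ≤ s ∧ ∃ u : BlochVector, ‖u‖ ≤ 1 ∧
    (s : ℂ) • blochMatrix u = !![ζ * star ζ, ζ; star ζ, 1] := by
  obtain ⟨s, hs⟩ : ∃ s : ℝ, s = (ζ.re ^ 2 + ζ.im ^ 2 + 1) / 2 := ⟨_, rfl⟩
  have hs0 : 0 < s := by rw [hs]; positivity
  have hsC : (s : ℂ) ≠ 0 := by exact_mod_cast hs0.ne'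
  refine ⟨s, hs0.le, !₂[ζ.re / s, -ζ.im / s, (ζ.re ^ 2 + ζ.im ^ 2 - 1) / (2 * s)], ?_, ?_⟩
  · refine (sq_le_one_iff₀ (norm_nonneg _)).mp ?_
    rw [EuclideanSpace.norm_sq_eq, Fin.sum_univ_three]
    simp only [Real.norm_eq_abs, sq_abs, Matrix.cons_val]
    rw [div_pow, div_pow, div_pow, ← sub_nonneg]
    have : 1 - (ζ.re ^ 2 / s ^ 2 + (-ζ.im) ^ 2 / s ^ 2 +
        (ζ.re ^ 2 + ζ.im ^ 2 - 1) ^ 2 / (2 * s) ^ 2) = 0 := by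
      field_simp
      rw [hs]
      ring
    rw [this]
  · have h1 : ζ * star ζ = ((ζ.re ^ 2 + ζ.im ^ 2 : ℝ) : ℂ) := by
      rw [Complex.star_def, Complex.mul_conj, Complex.normSq_apply]
      push_cast
      ring
    have h2 : (s : ℂ) = ((ζ.re : ℂ) ^ 2 + (ζ.im : ℂ) ^ 2 + 1) / 2 := by
      rw [hs]; push_cast; rfl
    have h3 : ζ = ζ.re + ζ.im * Complex.I := (Complex.re_add_im ζ).symm
    have h4 : star ζ = ζ.re - ζ.im * Complex.I := by
      conv_lhs => rw [h3]
      simp only [Complex.star_def, map_add, map_mul, Complex.conj_ofReal, Complex.conj_I]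
      ring
    rw [h1, h4, blochMatrix_eq]
    ext i j
    fin_cases i <;> fin_cases j <;> simp <;> field_simp
    · rw [h2]; ring
    · linear_combination -h3
    · ring
    · rw [h2]; ring

theorem doubled_X_sub_C (x : W) (ζ : ℂ) : doubled (MvPolynomial.X x - MvPolynomial.C ζ) =
    atSite x (legPoly !![ζ * star ζ, ζ; star ζ, 1]) := by
  simp only [doubled, legPoly, map_sub, map_add, map_mul, MvPolynomial.rename_X, MvPolynomial.rename_C,
    MvPolynomial.map_X, MvPolynomial.map_C, atSite_C, atSite_X_zero, atSite_X_one, Matrix.of_apply,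
    Matrix.cons_val', Matrix.cons_val_zero, Matrix.cons_val_one, Matrix.cons_val_fin_one, map_one,
    Complex.star_def]
  ring

/-- Here S is Λ with one more layer: every edge of S either lies in Λ or is a leg leaving Λ. When
the outer ends are fixed, edges of the second kind become boundary conditions. -/
theorem prod_edgesIn_eq {M : Type*} [CommMonoid M] (h : Λ ⊆ S)
    (hnbr : ∀ x ∈ Λ, G.neighborFinset x ⊆ S)
    (hout : ∀ x ∈ S, ∀ y ∈ S, G.Adj x y → x ∈ Λ ∨ y ∈ Λ) (f : Sym2 W → M) :
    ∏ e ∈ edgesIn G S, f e =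
      (∏ e ∈ edgesIn G Λ, f e) * ∏ x ∈ Λ, ∏ y ∈ G.neighborFinset x \ Λ, f s(x, y) := by
  have h1 : edgesIn G S = edgesIn G Λ ∪
      (Λ.sigma fun x => G.neighborFinset x \ Λ).image fun l => s(l.1, l.2) := by
    ext e
    induction e using Sym2.inductionOn with
    | hf a b =>
    rw [Finset.mem_union, mk_mem_edgesIn, mk_mem_edgesIn, Finset.mem_image]
    constructor
    · rintro ⟨⟨ha, hb⟩, hab⟩
      by_cases haΛ : a ∈ Λ
      · by_cases hbΛ : b ∈ Λ
        · exact Or.inl ⟨⟨haΛ, hbΛ⟩, hab⟩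
        · exact Or.inr ⟨⟨a, b⟩, by simp [haΛ, hbΛ, hab], rfl⟩
      · have hbΛ := (hout a ha b hb hab).resolve_left haΛ
        exact Or.inr ⟨⟨b, a⟩, by simp [haΛ, hbΛ, hab.symm], Sym2.eq_swap⟩
    · rintro (⟨⟨ha, hb⟩, hab⟩ | ⟨⟨x, y⟩, hl, he⟩)
      · exact ⟨⟨h ha, h hb⟩, hab⟩
      · rw [Finset.mem_sigma, Finset.mem_sdiff, SimpleGraph.mem_neighborFinset] at hl
        rw [← mk_mem_edgesIn, ← he, mk_mem_edgesIn]
        exact ⟨⟨h hl.1, hnbr x hl.1 (by simpa using hl.2.1)⟩, hl.2.1⟩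
  rw [h1, Finset.prod_union, Finset.prod_image, Finset.prod_sigma]
  · rintro ⟨x, y⟩ hl ⟨x', y'⟩ hl' he
    rw [Finset.mem_coe, Finset.mem_sigma, Finset.mem_sdiff] at hl hl'
    simp only at hl hl' he
    rcases Sym2.eq_iff.mp he with ⟨rfl, rfl⟩ | ⟨rfl, rfl⟩
    · rfl
    · exact absurd hl.1 hl'.2.2
  · rw [Finset.disjoint_left]
    intro e he he'
    rw [Finset.mem_image] at he'
    obtain ⟨⟨x, y⟩, hl, rfl⟩ := he'
    rw [Finset.mem_sigma, Finset.mem_sdiff] at hl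
    exact hl.2.2 (mk_mem_edgesIn.mp he).1.2

theorem fixVars_X_of_mem {t : Finset W} {x : W} (hx : x ∈ t) (ζ : W → ℂ) :
    fixVars t ζ (MvPolynomial.X x) = MvPolynomial.C (ζ x) := by
  rw [fixVars, MvPolynomial.aeval_X, if_pos hx]

theorem fixVars_X_of_notMem {t : Finset W} {x : W} (hx : x ∉ t) (ζ : W → ℂ) :
    fixVars t ζ (MvPolynomial.X x) = MvPolynomial.X x := by
  rw [fixVars, MvPolynomial.aeval_X, if_neg hx]

theorem fixVars_eq_C {t : Finset W} (ζ : W → ℂ) {q : MvPolynomial W ℂ}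
    (hq : ∀ x ∉ t, q.degreeOf x = 0) : fixVars t ζ q = MvPolynomial.C (MvPolynomial.eval ζ q) := by
  have h := MvPolynomial.hom_congr_vars (f₁ := (fixVars t ζ : MvPolynomial W ℂ →+* MvPolynomial W ℂ))
    (f₂ := MvPolynomial.C.comp (MvPolynomial.eval ζ)) (p₁ := q) (p₂ := q) ?_ ?_ rfl
  · exact h
  · ext c
    simp [fixVars]
  · intro x hx _
    have hxt : x ∈ t := by
      by_contra hxt
      exact MvPolynomial.mem_vars_iff_degreeOf_ne_zero.mp hx (hq x hxt)
    simp [fixVars_X_of_mem hxt]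

theorem fixVars_edgePoly_of_notMem {t : Finset W} {x y : W} (hx : x ∉ t) (hy : y ∉ t) (ζ : W → ℂ) :
    fixVars t ζ (edgePoly s(x, y)) = edgePoly s(x, y) := by
  rcases edgePoly_mk x y with h | h <;>
    rw [h] <;> simp only [map_neg, map_sub, fixVars_X_of_notMem hx, fixVars_X_of_notMem hy]

theorem doubled_fixVars_edgePoly {t : Finset W} {x y : W} (hx : x ∉ t) (hy : y ∈ t) (ζ : W → ℂ) :
    doubled (fixVars t ζ (edgePoly s(x, y))) =
      atSite x (legPoly !![ζ y * star (ζ y), ζ y; star (ζ y), 1]) := by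
  rw [← doubled_X_sub_C]
  rcases edgePoly_mk x y with h | h <;>
    rw [h] <;> simp only [map_neg, map_sub, fixVars_X_of_notMem hx, fixVars_X_of_mem hy, doubled_neg]

/-- Fixing the variables outside `Λ` in a ground state gives a valence bond state on `Λ`. -/
theorem exists_doubled_fixVars_eq (h : Λ ⊆ S) (hnbr : ∀ x ∈ Λ, G.neighborFinset x ⊆ S)
    (hout : ∀ x ∈ S, ∀ y ∈ S, G.Adj x y → x ∈ Λ ∨ y ∈ Λ) {ψ : Config G S → ℂ}
    (hψ : akltHamiltonian G S *ᵥ ψ = 0) (ζ : W → ℂ) :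
    ∃ K : ℝ, 0 ≤ K ∧ ∃ u : W → BlochVector, (∀ y, ‖u y‖ ≤ 1) ∧
      doubled (fixVars (S \ Λ) ζ (polyOf ψ)) =
        MvPolynomial.C (K : ℂ) * vbsPoly G Λ fun y _ => blochMatrix (u y) := by
  obtain ⟨q, hq⟩ := (akltHamiltonian_mulVec_eq_zero_iff_prod_dvd ψ).mp hψ
  -- All neighbours of a site of Λ lie in S, so the singlet forms exhaust the degree there. The
  -- cofactor q depends only on the fixed variables and becomes a constant.
  have hdeg : ∀ x ∉ S \ Λ, q.degreeOf x = 0 := by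
    intro x hx
    rcases eq_or_ne q 0 with rfl | hq0
    · exact MvPolynomial.degreeOf_zero x
    have h1 := degreeOf_polyOf_le ψ x
    rw [hq, MvPolynomial.degreeOf_mul_eq prod_edgePoly_ne_zero hq0, degreeOf_prod_edgePoly,
      capDegree] at h1
    by_cases hxS : x ∈ S
    · have hxΛ : x ∈ Λ := by
        by_contra hxΛ
        exact hx (Finset.mem_sdiff.mpr ⟨hxS, hxΛ⟩)
      have h2 : (G.neighborFinset x ∩ S).card = G.degree x := by
        rw [Finset.inter_eq_left.mpr (hnbr x hxΛ), G.card_neighborFinset_eq_degree]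
      rw [if_pos hxS, if_pos hxS, h2] at h1
      omega
    · rw [if_neg hxS, if_neg hxS] at h1
      omega
  choose s hs u hu hsu using exists_blochMatrix_of_coherent
  obtain ⟨c, hc⟩ : ∃ c, c = MvPolynomial.eval ζ q := ⟨_, rfl⟩
  have hprod : doubled (fixVars (S \ Λ) ζ (∏ e ∈ edgesIn G S, edgePoly e)) =
      MvPolynomial.C (((∏ x ∈ Λ, ∏ y ∈ G.neighborFinset x \ Λ, s (ζ y) : ℝ)) : ℂ) *
        vbsPoly G Λ fun y _ => blochMatrix (u (ζ y)) := by
    rw [prod_edgesIn_eq h hnbr hout, map_mul, map_prod, map_prod, doubled_mul, doubled_prod,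
      Finset.prod_congr rfl fun e he => ?_, ← doubled_prod, vbsPoly, mul_left_comm]
    · congr 1
      rw [legProduct, Complex.ofReal_prod, map_prod, ← Finset.prod_mul_distrib, doubled_prod]
      refine Finset.prod_congr rfl fun x hx => ?_
      rw [Complex.ofReal_prod, map_prod, map_prod, ← Finset.prod_mul_distrib, doubled_prod]
      refine Finset.prod_congr rfl fun y hy => ?_
      rw [Finset.mem_sdiff] at hy
      rw [doubled_fixVars_edgePoly (by simp [hx])
        (Finset.mem_sdiff.mpr ⟨hnbr x hx hy.1, hy.2⟩), ← hsu, legPoly_smul, map_mul, atSite_C]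
    · induction e using Sym2.inductionOn with
      | hf a b =>
      obtain ⟨⟨ha, hb⟩, -⟩ := mk_mem_edgesIn.mp he
      rw [fixVars_edgePoly_of_notMem (by simp [ha]) (by simp [hb])]
  refine ⟨Complex.normSq c * ∏ x ∈ Λ, ∏ y ∈ G.neighborFinset x \ Λ, s (ζ y),
    mul_nonneg (Complex.normSq_nonneg _) (Finset.prod_nonneg fun x _ => Finset.prod_nonneg fun y _ => hs _),
    fun y => u (ζ y), fun y => hu _, ?_⟩
  rw [hq, map_mul, doubled_mul, fixVars_eq_C ζ hdeg, ← hc, doubled_C, hprod, Complex.mul_conj,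
    Complex.ofReal_mul, map_mul]
  ring

theorem IsCloseTo.C_mul {A : LocalOp G Λ} {c : ℂ} {ε K : ℝ} (hK : 0 ≤ K)
    {P : MvPolynomial (W ⊕ W) ℂ} (h : IsCloseTo A c ε P) :
    IsCloseTo A c ε (MvPolynomial.C (K : ℂ) * P) := by
  rw [IsCloseTo] at h ⊢
  rw [MvPolynomial.C_mul', map_smul, map_smul, smul_eq_mul, smul_eq_mul, mul_left_comm c, ← mul_sub,
    norm_mul, Complex.norm_real, Real.norm_of_nonneg hK, Complex.re_ofReal_mul, mul_left_comm ε]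
  exact mul_le_mul_of_nonneg_left h hK

/-- A bound that holds for all product boundary conditions holds in all ground states. -/
theorem isCloseTo_doubled_polyOf (h : Λ ⊆ S) (hnbr : ∀ x ∈ Λ, G.neighborFinset x ⊆ S)
    (hout : ∀ x ∈ S, ∀ y ∈ S, G.Adj x y → x ∈ Λ ∨ y ∈ Λ) {A : LocalOp G Λ} {c : ℂ} {ε : ℝ}
    (hA : ∀ u : W → BlochVector, (∀ y, ‖u y‖ ≤ 1) →
      IsCloseTo A c ε (vbsPoly G Λ fun y _ => blochMatrix (u y)))
    {ψ : Config G S → ℂ} (hψ : akltHamiltonian G S *ᵥ ψ = 0) :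
    IsCloseTo (extendOp G h A) c ε (doubled (polyOf ψ)) := by
  refine IsCloseTo.of_fixVars (S \ Λ) (Finset.union_sdiff_of_subset h).symm Finset.disjoint_sdiff h
    (fun z hz => (degreeOf_polyOf_le ψ z).trans ?_) fun ζ => ?_
  · rw [capDegree, if_pos (Finset.mem_sdiff.mp hz).1]
  · obtain ⟨K, hK, u, hu, heq⟩ := exists_doubled_fixVars_eq h hnbr hout hψ ζ
    rw [heq]
    exact (hA u hu).C_mul hK

/-- The same bound for the density matrix of a ground state. -/
theorem norm_trace_mul_sub_le {A : LocalOp G S} {c : ℂ} {ε : ℝ}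
    (hA : ∀ ψ : Config G S → ℂ, akltHamiltonian G S *ᵥ ψ = 0 → IsCloseTo A c ε (doubled (polyOf ψ)))
    {ρ : LocalOp G S} (hρ : IsFiniteVolumeGroundState G ρ) : ‖(ρ * A).trace - c‖ ≤ ε := by
  obtain ⟨hpos, htr, hker⟩ := hρ
  obtain ⟨m, v, hv⟩ := Matrix.posSemidef_iff_eq_sum_vecMulVec.mp hpos
  obtain ⟨B, hBdef⟩ : ∃ B : Matrix (Config G S) (Fin m) ℂ, B = Matrix.of fun i j => v j i := ⟨_, rfl⟩
  have hB : ρ = B * Bᴴ := by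
    ext i k
    rw [hv, hBdef, Matrix.mul_apply, Matrix.sum_apply]
    rfl
  -- From Hρ = 0 and ρ = BB* it follows that (HB)(HB)* = 0, hence HB = 0: every vector in the
  -- decomposition is a ground state.
  have hcol : ∀ j, akltHamiltonian G S *ᵥ v j = 0 := by
    have h1 : akltHamiltonian G S * B = 0 := by
      have h2 : (akltHamiltonian G S * B) * (akltHamiltonian G S * B)ᴴ = 0 := by
        rw [Matrix.conjTranspose_mul, Matrix.mul_assoc, ← Matrix.mul_assoc B, ← hB, ← Matrix.mul_assoc,
          hker, Matrix.zero_mul]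
      exact Matrix.self_mul_conjTranspose_eq_zero.mp h2
    intro j
    funext i
    have h2 := congrFun (congrFun h1 i) j
    rw [hBdef] at h2
    exact h2
  have htrace : ∀ A : LocalOp G S, (ρ * A).trace = ∑ j, stateFun A (doubled (polyOf (v j))) := by
    intro A
    rw [hv, Finset.sum_mul, Matrix.trace_sum]
    refine Finset.sum_congr rfl fun j _ => ?_
    rw [← trace_densityOf_mul, densityOf_doubled, vecOf_polyOf]
  have h1 := htrace 1
  rw [mul_one, htr] at h1
  calc ‖(ρ * A).trace - c‖ = ‖∑ j, (stateFun A (doubled (polyOf (v j))) -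
        c * stateFun (1 : LocalOp G S) (doubled (polyOf (v j))))‖ := by
        rw [Finset.sum_sub_distrib, ← Finset.mul_sum, ← h1, htrace, mul_one]
    _ ≤ ∑ j, ε * (stateFun (1 : LocalOp G S) (doubled (polyOf (v j)))).re :=
        (norm_sum_le _ _).trans (Finset.sum_le_sum fun j _ => hA _ (hcol j))
    _ = ε := by
        rw [← Finset.mul_sum, ← Complex.re_sum, ← h1, Complex.one_re, mul_one]

end Boundary


/-! ### Decay of the influence of the boundary -/

section Decay

open scoped Classical ComplexOrder

variable {W : Type*} {G : SimpleGraph W} [G.LocallyFinite] {Λ S : Finset W}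

theorem vbsPoly_congr {Q Q' : W → W → Matrix (Fin 2) (Fin 2) ℂ}
    (h : ∀ x ∈ Λ, ∀ y ∉ Λ, G.Adj x y → Q y x = Q' y x) : vbsPoly G Λ Q = vbsPoly G Λ Q' := by
  have h1 : legProduct G Λ Q = legProduct G Λ Q' := by
    refine Finset.prod_congr rfl fun x hx => Finset.prod_congr rfl fun y hy => ?_
    rw [Finset.mem_sdiff, SimpleGraph.mem_neighborFinset] at hy
    rw [h x hx y hy.2 hy.1]
  rw [vbsPoly, vbsPoly, h1]

theorem siteMessage_congr {ι : Type*} {s : Finset ι} {r r' : ι → BlochVector}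
    (h : ∀ i ∈ s, r i = r' i) : siteMessage s r = siteMessage s r' := by
  obtain ⟨h1, h2⟩ := siteMoments_congr h
  rw [siteMessage, siteMessage, h1, h2]

theorem norm_siteMessage_le {ι : Type*} {s : Finset ι} {r : ι → BlochVector} {t : ℝ} (ht : 0 ≤ t)
    (ht1 : t ≤ 1) (hr : ∀ i ∈ s, ‖r i‖ ≤ t) (hu : (((s.card : ℝ) + 2) * t / 3) ^ 2 ≤ 2) :
    ‖siteMessage s r‖ ≤ s.card * t / 3 := by
  have h := siteDensity_pos fun i hi => (hr i hi).trans ht1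
  rw [siteMessage, norm_neg, norm_smul, norm_inv, Real.norm_of_nonneg h.le, inv_mul_le_iff₀ h, mul_comm]
  exact norm_siteMoment_le ht ht1 hr hu

theorem SimpleGraph.IsTree.filter_dist_eq_erase (hG : G.IsTree) {o y p : W} (h : G.Adj y p)
    (hd : G.dist o p + 1 = G.dist o y) :
    (G.neighborFinset y).filter (fun z => G.dist o z = G.dist o y + 1) =
      (G.neighborFinset y).erase p := by
  ext z
  rw [Finset.mem_filter, Finset.mem_erase, SimpleGraph.mem_neighborFinset]
  constructor
  · rintro ⟨hz, hzd⟩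
    refine ⟨?_, hz⟩
    rintro rfl
    omega
  · rintro ⟨hne, hz⟩
    refine ⟨hz, ?_⟩
    rcases hG.dist_eq_dist_add_one_of_adj o hz with h1 | h1
    · exact absurd (hG.eq_of_adj_of_dist_add_one hz h h1.symm hd) hne
    · exact h1

/-- The boundary condition at the site `y` which results, after `n` steps towards `o`, from the
boundary conditions `𝟙 + u z · σ`. -/
noncomputable def boundaryMessage (G : SimpleGraph W) [G.LocallyFinite] (o : W) (u : W → BlochVector) :
    ℕ → W → BlochVector
  | 0, y => u y
  | n + 1, y => siteMessage ((G.neighborFinset y).filter fun z => G.dist o z = G.dist o y + 1)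
      (boundaryMessage G o u n)

theorem norm_boundaryMessage_le_one (o : W) {u : W → BlochVector} (hu : ∀ y, ‖u y‖ ≤ 1) (n : ℕ) (y : W) :
    ‖boundaryMessage G o u n y‖ ≤ 1 := by
  induction n generalizing y with
  | zero => exact hu y
  | succ n ih => exact norm_siteMessage_le_one fun z _ => ih z

/-- J counts complete cells. A site of degree 2 contributes the factor 1/3 and a site of degree d
the factor (d-1)/3, so a cell contributes κ = (d-1)/3^(g+1); the remaining `pos y p` sites of the
current chain give the power of 1/3. With J = 0 at a site of degree d only the trivial bound 1 is
used. -/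
theorem norm_boundaryMessage_le {d g : ℕ} {pos : W → W → ℕ} (hG : IsDecoratedTree G d g pos)
    (hdg : d < 3 ^ (g + 1) + 1) (o : W) {u : W → BlochVector} (hu : ∀ y, ‖u y‖ ≤ 1) (n : ℕ) :
    ∀ (J : ℕ) (y p : W), G.Adj y p → G.dist o p + 1 = G.dist o y → J * (g + 1) + pos y p ≤ n →
      ‖boundaryMessage G o u n y‖ ≤ (3 ^ pos y p)⁻¹ * (((d : ℝ) - 1) / 3 ^ (g + 1)) ^ J := by
  have h2d : (2 : ℝ) ≤ d := by exact_mod_cast hG.two_le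
  have hd3 : (d : ℝ) ≤ 3 ^ (g + 1) := by exact_mod_cast Nat.lt_succ_iff.mp hdg
  have h3 : (0 : ℝ) < 3 ^ (g + 1) := by positivity
  obtain ⟨κ, hκ⟩ : ∃ κ : ℝ, κ = ((d : ℝ) - 1) / 3 ^ (g + 1) := ⟨_, rfl⟩
  have hκ0 : 0 ≤ κ := by rw [hκ]; exact div_nonneg (by linarith) h3.le
  have hκ1 : κ ≤ 1 := by rw [hκ, div_le_one h3]; linarith
  have ht1 : ∀ a J : ℕ, 0 ≤ ((3 : ℝ) ^ a)⁻¹ * κ ^ J ∧ ((3 : ℝ) ^ a)⁻¹ * κ ^ J ≤ 1 := fun a J =>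
    ⟨by positivity, mul_le_one₀ (inv_le_one_of_one_le₀ (one_le_pow₀ (by norm_num))) (by positivity)
      (pow_le_one₀ hκ0 hκ1)⟩
  rw [← hκ]
  induction n with
  | zero =>
    intro J y p _ _ hn
    have hJ : J = 0 := by
      by_contra h
      have := Nat.mul_pos (Nat.pos_of_ne_zero h) (by omega : 0 < g + 1)
      omega
    have hpos : pos y p = 0 := by omega
    rw [hJ, hpos, pow_zero, pow_zero, inv_one, one_mul]
    exact hu y
  | succ n ih =>
    intro J y p hyp hdist hn
    have hcard := card_neighborFinset_erase hyp
    have hchild : ∀ z ∈ (G.neighborFinset y).erase p, G.Adj y z ∧ z ≠ p ∧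
        G.dist o y + 1 = G.dist o z := by
      intro z hz
      have hz' := hz
      rw [← hG.isTree.filter_dist_eq_erase hyp hdist, Finset.mem_filter] at hz'
      rw [Finset.mem_erase, SimpleGraph.mem_neighborFinset] at hz
      exact ⟨hz.2, hz.1, hz'.2.symm⟩
    rw [boundaryMessage, hG.isTree.filter_dist_eq_erase hyp hdist]
    rcases hG.cases y with ⟨hdeg, hpos⟩ | ⟨hdeg, hpos⟩
    · rw [(hpos p hyp).1] at hn ⊢
      rw [pow_zero, inv_one, one_mul]
      rcases J with _ | J
      · rw [pow_zero]
        exact norm_siteMessage_le_one fun z _ => norm_boundaryMessage_le_one o hu n z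
      · have hc : (((G.neighborFinset y).erase p).card : ℝ) = d - 1 := by
          rw [hdeg] at hcard
          rw [← hcard]
          push_cast
          ring
        obtain ⟨h0, h1⟩ := ht1 g J
        have heq : ((d : ℝ) - 1) * (((3 : ℝ) ^ g)⁻¹ * κ ^ J) / 3 = κ ^ (J + 1) := by
          rw [pow_succ, hκ]
          field_simp
          ring
        refine (norm_siteMessage_le h0 h1 (fun z hz => ?_) ?_).trans_eq (by rw [hc, heq])
        · obtain ⟨hyz, -, hz⟩ := hchild z hz
          have h4 := ih J z y hyz.symm hz
          rw [(hpos z hyz).2] at h4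
          refine h4 ?_
          rw [add_mul] at hn
          omega
        · rw [hc]
          -- The side condition of the contraction: d ≤ 3^(g+1) gives d + 1 ≤ (4/3)·3^(g+1), and
          -- (4/3)² = 16/9 < 2.
          have h5 : ((d : ℝ) - 1 + 2) * (((3 : ℝ) ^ g)⁻¹ * κ ^ J) / 3 ≤ 4 / 3 := by
            have h6 : ((d : ℝ) - 1 + 2) * (((3 : ℝ) ^ g)⁻¹ * κ ^ J) / 3 =
                κ ^ J * (((d : ℝ) + 1) / 3 ^ (g + 1)) := by
              field_simp
              ring
            rw [h6]
            have h7 : (3 : ℝ) ≤ 3 ^ (g + 1) := by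
              rw [pow_succ]
              linarith [one_le_pow₀ (M₀ := ℝ) (a := 3) (n := g) (by norm_num)]
            have h8 : ((d : ℝ) + 1) / 3 ^ (g + 1) ≤ 4 / 3 := by
              rw [div_le_div_iff₀ h3 (by norm_num)]
              linarith
            calc κ ^ J * (((d : ℝ) + 1) / 3 ^ (g + 1)) ≤ 1 * (4 / 3) :=
                  mul_le_mul (pow_le_one₀ hκ0 hκ1) h8 (by positivity) zero_le_one
              _ = 4 / 3 := one_mul _
          have h9 : 0 ≤ ((d : ℝ) - 1 + 2) * (((3 : ℝ) ^ g)⁻¹ * κ ^ J) / 3 :=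
            div_nonneg (mul_nonneg (by linarith) h0) (by norm_num)
          nlinarith
    · rw [hdeg] at hcard
      obtain ⟨z, hz⟩ := Finset.card_eq_one.mp (by omega : ((G.neighborFinset y).erase p).card = 1)
      obtain ⟨hyz, hzp, hzd⟩ := hchild z (by rw [hz]; exact Finset.mem_singleton_self z)
      have hp := hpos p z hyp hyz hzp.symm
      obtain ⟨h0, h1⟩ := ht1 (pos z y) J
      rw [hz]
      refine (norm_siteMessage_le h0 h1 (fun i hi => ?_) ?_).trans_eq ?_
      · rw [Finset.mem_singleton.mp hi]
        exact ih J z y hyz.symm hzd (by omega)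
      · rw [Finset.card_singleton]
        push_cast
        nlinarith
      · rw [Finset.card_singleton, hp, pow_succ, mul_inv]
        push_cast
        ring

theorem exists_outgoing_boundaryMessage (hG : G.IsTree) (o : W) {u : W → BlochVector}
    (hu : ∀ y, ‖u y‖ ≤ 1) (N : ℕ) {y p : W} (hy : G.dist o y ≤ N) (hyp : G.Adj y p)
    (hd : G.dist o p + 1 = G.dist o y) : ∃ c : ℝ, 0 < c ∧
      outgoing (G.degree y) (∏ z ∈ (G.neighborFinset y).erase p,
        legPoly (blochMatrix (boundaryMessage G o u (N + 1 - G.dist o z) z))) =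
        (c : ℂ) • blochMatrix (boundaryMessage G o u (N + 1 - G.dist o y) y) := by
  obtain ⟨c, hc, h⟩ := exists_outgoing_eq hyp
    (r := fun z => boundaryMessage G o u (N + 1 - G.dist o z) z)
    fun z _ => norm_boundaryMessage_le_one o hu _ z
  refine ⟨c, hc, h.trans ?_⟩
  have h1 : siteMessage ((G.neighborFinset y).erase p)
      (fun z => boundaryMessage G o u (N + 1 - G.dist o z) z) =
      boundaryMessage G o u (N + 1 - G.dist o y) y := by
    rw [show N + 1 - G.dist o y = (N - G.dist o y) + 1 by omega, boundaryMessage,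
      hG.filter_dist_eq_erase hyp hd]
    refine siteMessage_congr fun z hz => ?_
    rw [← hG.filter_dist_eq_erase hyp hd, Finset.mem_filter] at hz
    rw [hz.2, show N + 1 - (G.dist o y + 1) = N - G.dist o y by omega]
  rw [h1]

/-- The state on a ball as a function of the boundary conditions on a larger ball. -/
theorem exists_stateFun_graphBall_eq (hG : G.IsTree) (o : W) {u : W → BlochVector}
    (hu : ∀ y, ‖u y‖ ≤ 1) {k N : ℕ} (hkN : k ≤ N) : ∃ C : ℝ, 0 < C ∧ ∀ A : LocalOp G (graphBall G o k),
      stateFun (extendOp G (graphBall_mono hG o hkN) A)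
        (vbsPoly G (graphBall G o N) fun y _ => blochMatrix (u y)) =
      C * stateFun A (vbsPoly G (graphBall G o k) fun y _ =>
        blochMatrix (boundaryMessage G o u (N + 1 - G.dist o y) y)) := by
  have h1 : (vbsPoly G (graphBall G o N) fun y _ => blochMatrix (u y)) =
      vbsPoly G (graphBall G o N) fun y _ =>
        blochMatrix (boundaryMessage G o u (N + 1 - G.dist o y) y) := by
    refine vbsPoly_congr fun x hx y hy hxy => ?_
    rw [mem_graphBall hG] at hx hy
    have h2 := hG.dist_eq_dist_add_one_of_adj o hxy
    rw [show N + 1 - G.dist o y = 0 by omega, boundaryMessage]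
  rw [h1]
  refine stateFun_vbsPoly_of_subset hG (mem_graphBall_self hG o k)
    (closedToward_graphBall hG (mem_graphBall_self hG o k))
    (closedToward_graphBall hG (mem_graphBall_self hG o N)) (graphBall_mono hG o hkN) rfl
    fun y hy _ p hyp hd => ?_
  exact exists_outgoing_boundaryMessage hG o hu N ((mem_graphBall hG).mp hy) hyp hd

/-- The boundary conditions that result from far away are close to the free ones. -/
theorem eventually_boundaryMessage {d g : ℕ} {pos : W → W → ℕ} (hG : IsDecoratedTree G d g pos)
    (hdg : d < 3 ^ (g + 1) + 1) (o : W) {P : (W → BlochVector) → Prop}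
    (hP : ∀ᶠ r in nhds (0 : W → BlochVector), P r) : ∀ᶠ N : ℕ in Filter.atTop, ∀ u : W → BlochVector,
      (∀ y, ‖u y‖ ≤ 1) →
        P fun y => if y = o then 0 else boundaryMessage G o u (N + 1 - G.dist o y) y := by
  obtain ⟨κ, hκ⟩ : ∃ κ : ℝ, κ = ((d : ℝ) - 1) / 3 ^ (g + 1) := ⟨_, rfl⟩
  have h2d : (2 : ℝ) ≤ d := by exact_mod_cast hG.two_le
  have hd3 : (d : ℝ) ≤ 3 ^ (g + 1) := by exact_mod_cast Nat.lt_succ_iff.mp hdg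
  have h3 : (0 : ℝ) < 3 ^ (g + 1) := by positivity
  have hκ0 : 0 ≤ κ := by rw [hκ]; exact div_nonneg (by linarith) h3.le
  have hκ1 : κ < 1 := by rw [hκ, div_lt_one h3]; linarith
  -- Pairing N with u and pulling back the filter along the first component makes the convergence
  -- uniform in u. The root has no direction towards itself and hence no decay estimate; its entry
  -- is set to 0, and it never enters as the outer end of a leg.
  have htend : Filter.Tendsto (fun q : ℕ × {u : W → BlochVector // ∀ y, ‖u y‖ ≤ 1} => fun y =>
      if y = o then 0 else boundaryMessage G o q.2 (q.1 + 1 - G.dist o y) y)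
      (Filter.comap Prod.fst Filter.atTop) (nhds (0 : W → BlochVector)) := by
    rw [tendsto_pi_nhds]
    intro y
    by_cases hy : y = o
    · simp only [if_pos hy, Pi.zero_apply]
      exact tendsto_const_nhds
    simp only [if_neg hy, Pi.zero_apply]
    obtain ⟨p, hyp, hd⟩ := hG.isTree.exists_adj_dist_add_one hy
    -- The number of complete cells guaranteed between the boundary and y; subtracting g allows for
    -- any position on the last chain.
    have hJ : Filter.Tendsto (fun N : ℕ => (N + 1 - G.dist o y - g) / (g + 1)) Filter.atTop
        Filter.atTop := by
      rw [Filter.tendsto_atTop]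
      intro b
      filter_upwards [Filter.eventually_ge_atTop (b * (g + 1) + G.dist o y + g)] with N hN
      rw [Nat.le_div_iff_mul_le (by omega : 0 < g + 1)]
      omega
    have hpow := ((tendsto_pow_atTop_nhds_zero_of_lt_one hκ0 hκ1).comp hJ).comp
      (Filter.tendsto_comap (f := (Prod.fst : ℕ × {u : W → BlochVector // ∀ y, ‖u y‖ ≤ 1} → ℕ)))
    refine squeeze_zero_norm' ?_ hpow
    rw [Filter.eventually_comap]
    filter_upwards [Filter.eventually_ge_atTop (G.dist o y + g)] with N hN q hq
    subst hq
    have hdiv := Nat.div_mul_le_self (q.1 + 1 - G.dist o y - g) (g + 1)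
    have hpos := hG.pos_le y p
    have h4 := norm_boundaryMessage_le hG hdg o q.2.2 (q.1 + 1 - G.dist o y)
      ((q.1 + 1 - G.dist o y - g) / (g + 1)) y p hyp hd (by omega)
    rw [← hκ] at h4
    refine h4.trans (mul_le_of_le_one_left (pow_nonneg hκ0 _) ?_)
    exact inv_le_one_of_one_le₀ (one_le_pow₀ (by norm_num))
  have h4 := htend.eventually hP
  rw [Filter.eventually_comap] at h4
  filter_upwards [h4] with N hN u hu
  exact hN (N, ⟨u, hu⟩) rfl

end Decay


/-! ### Uniqueness -/

section Uniqueness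

open scoped Classical ComplexOrder

/-- A family of polynomials all of whose coefficients are continuous. -/
def CoeffContinuous {T σ : Type*} [TopologicalSpace T] (P : T → MvPolynomial σ ℂ) : Prop :=
  ∀ e, Continuous fun r => MvPolynomial.coeff e (P r)

section CoeffContinuous

variable {T σ : Type*} [TopologicalSpace T] {P Q : T → MvPolynomial σ ℂ}

theorem CoeffContinuous.const (p : MvPolynomial σ ℂ) : CoeffContinuous fun _ : T => p :=
  fun _ => continuous_const

theorem CoeffContinuous.add (hP : CoeffContinuous P) (hQ : CoeffContinuous Q) :
    CoeffContinuous fun r => P r + Q r := fun e => by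
  simp only [MvPolynomial.coeff_add]
  exact (hP e).add (hQ e)

theorem CoeffContinuous.mul (hP : CoeffContinuous P) (hQ : CoeffContinuous Q) :
    CoeffContinuous fun r => P r * Q r := fun e => by
  simp only [MvPolynomial.coeff_mul]
  exact continuous_finsetSum _ fun i _ => (hP i.1).mul (hQ i.2)

theorem CoeffContinuous.smul {f : T → ℂ} (hf : Continuous f) (p : MvPolynomial σ ℂ) :
    CoeffContinuous fun r => f r • p := fun e => by
  simp only [MvPolynomial.coeff_smul, smul_eq_mul]
  exact hf.mul continuous_const

theorem CoeffContinuous.sum {ι : Type*} (s : Finset ι) {P : ι → T → MvPolynomial σ ℂ}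
    (h : ∀ i ∈ s, CoeffContinuous (P i)) : CoeffContinuous fun r => ∑ i ∈ s, P i r := fun e => by
  simp only [MvPolynomial.coeff_sum]
  exact continuous_finsetSum _ fun i hi => h i hi e

theorem CoeffContinuous.prod {ι : Type*} (s : Finset ι) {P : ι → T → MvPolynomial σ ℂ}
    (h : ∀ i ∈ s, CoeffContinuous (P i)) : CoeffContinuous fun r => ∏ i ∈ s, P i r := by
  induction s using Finset.induction_on with
  | empty =>
    simp only [Finset.prod_empty]
    exact CoeffContinuous.const 1
  | insert i s hi ih =>
    simp only [Finset.prod_insert hi]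
    exact (h i (Finset.mem_insert_self i s)).mul (ih fun j hj => h j (Finset.mem_insert_of_mem hj))

end CoeffContinuous

variable {W : Type*} {G : SimpleGraph W} [G.LocallyFinite] {Λ S : Finset W}

theorem atSite_legPoly_blochMatrix (x : W) (r : BlochVector) :
    atSite x (legPoly (blochMatrix r)) = atSite x (legPoly 1) +
      ∑ a, (r a : ℂ) • atSite x (legPoly (pauli a)) := by
  rw [blochMatrix, legPoly_add, map_add, Fin.sum_univ_three, Fin.sum_univ_three]
  simp only [legPoly_add, legPoly_smul, map_add, map_smul, MvPolynomial.C_mul']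

theorem coeffContinuous_vbsPoly : CoeffContinuous fun r : W → BlochVector =>
    vbsPoly G Λ fun y _ => blochMatrix (r y) := by
  refine (CoeffContinuous.const _).mul (CoeffContinuous.prod _ fun x _ => CoeffContinuous.prod _
    fun y _ => ?_)
  simp only [atSite_legPoly_blochMatrix]
  refine (CoeffContinuous.const _).add (CoeffContinuous.sum _ fun a _ => CoeffContinuous.smul ?_ _)
  fun_prop

theorem continuous_stateFun (A : LocalOp G Λ) {T : Type*} [TopologicalSpace T]
    {P : T → MvPolynomial (W ⊕ W) ℂ} (hP : CoeffContinuous P) : Continuous fun r => stateFun A (P r) := by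
  simp only [stateFun_apply]
  exact continuous_finsetSum _ fun σ _ => continuous_finsetSum _ fun τ _ =>
    continuous_const.mul ((hP _).div_const _)

theorem isConsistent_zero : IsConsistent G fun _ _ => (0 : BlochVector) := by
  refine ⟨fun _ _ => by simp, fun y p _ => ?_⟩
  rw [siteMessage_equal (v := 0) fun _ _ => rfl, smul_zero, neg_zero]

theorem blochMatrix_zero : blochMatrix 0 = 1 := by simp [blochMatrix]

/-- The constant c is the expectation with message 1 on all legs, where the normalization is
positive. The functionals are continuous in the messages for the product topology, so the strict
inequality 0 < εZ at r = 0 persists nearby. -/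
theorem eventually_isCloseTo {u : W} (hG : G.IsTree) (hu : u ∈ S) (hS : ClosedToward G u S)
    (A : LocalOp G S) : ∃ c : ℂ, ∀ ε > 0, ∀ᶠ r in nhds (0 : W → BlochVector),
      IsCloseTo A c ε (vbsPoly G S fun y _ => blochMatrix (r y)) := by
  obtain ⟨Z, hZ, h1⟩ := (isConsistent_zero (G := G)).exists_stateFun_one_eq hG hu hS
  have hZ' : (Z : ℂ) ≠ 0 := by exact_mod_cast hZ.ne'
  obtain ⟨a, ha⟩ : ∃ a, a = stateFun A (vbsPoly G S fun _ _ => blochMatrix (0 : BlochVector)) := ⟨_, rfl⟩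
  refine ⟨a / Z, fun ε hε => ?_⟩
  have hA := continuous_stateFun A (coeffContinuous_vbsPoly (G := G) (Λ := S))
  have hone := continuous_stateFun (1 : LocalOp G S) (coeffContinuous_vbsPoly (G := G) (Λ := S))
  have hcont := ((hA.sub (continuous_const.mul hone)).norm).tendsto' (0 : W → BlochVector) 0 (by
    change ‖stateFun A (vbsPoly G S fun _ _ => blochMatrix (0 : BlochVector)) -
      a / Z * stateFun (1 : LocalOp G S) (vbsPoly G S fun _ _ => blochMatrix (0 : BlochVector))‖ = 0
    rw [← ha, h1, div_mul_cancel₀ _ hZ', sub_self, norm_zero])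
  have hcont' := (continuous_const.mul (Complex.continuous_re.comp hone)).tendsto'
    (0 : W → BlochVector) (ε * Z) (by
      change ε * (stateFun (1 : LocalOp G S) (vbsPoly G S fun _ _ =>
        blochMatrix (0 : BlochVector))).re = ε * Z
      rw [h1, Complex.ofReal_re])
  filter_upwards [hcont.eventually_lt hcont' (mul_pos hε hZ)] with r hr
  exact hr.le

/-- Below the threshold the expectations of an observable in the ground states on large balls are
close to a number that does not depend on the ground states. -/
theorem exists_eventually_norm_expectation_sub_le {d g : ℕ} {pos : W → W → ℕ}
    (hG : IsDecoratedTree G d g pos) (hdg : d < 3 ^ (g + 1) + 1) (o : W) (A : LocalOp G Λ) :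
    ∃ c : ℂ, ∀ ε > 0, ∀ᶠ N in Filter.atTop, ∀ ρ : LocalOp G (graphBall G o N),
      IsFiniteVolumeGroundState G ρ → ‖expectation G ρ A - c‖ ≤ ε := by
  have hT := hG.isTree
  obtain ⟨k, hk⟩ := exists_subset_graphBall hT o Λ
  have hself := mem_graphBall_self hT o
  obtain ⟨c, hc⟩ := eventually_isCloseTo hT (hself k) (closedToward_graphBall hT (hself k))
    (extendOp G hk A)
  refine ⟨c, fun ε hε => ?_⟩
  obtain ⟨N₀, hN₀⟩ := Filter.eventually_atTop.mp (eventually_boundaryMessage hG hdg o (hc ε hε))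
  filter_upwards [Filter.eventually_ge_atTop (max N₀ k + 1)] with N hN ρ hρ
  -- The outermost layer is averaged over coherent states, which leaves product boundary conditions
  -- on the ball of radius M.
  obtain ⟨M, rfl⟩ : ∃ M, N = M + 1 := ⟨N - 1, by omega⟩
  have hkM : k ≤ M := by have := le_max_right N₀ k; omega
  have hM : N₀ ≤ M := by have := le_max_left N₀ k; omega
  have hsub := graphBall_mono hT o hkM
  have hsub' := graphBall_mono hT o (Nat.le_succ M)
  rw [expectation, dif_pos (hk.trans (hsub.trans hsub'))]
  rw [← extendOp_extendOp hk (hsub.trans hsub'), ← extendOp_extendOp hsub hsub']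
  refine norm_trace_mul_sub_le (fun ψ hψ => isCloseTo_doubled_polyOf hsub' ?_ ?_ (fun u hu => ?_) hψ) hρ
  · intro x hx y hy
    rw [SimpleGraph.mem_neighborFinset] at hy
    rw [mem_graphBall hT] at hx ⊢
    have := hT.dist_eq_dist_add_one_of_adj o hy
    omega
  · intro x hx y hy hxy
    rw [mem_graphBall hT] at hx hy
    rw [mem_graphBall hT, mem_graphBall hT]
    have := hT.dist_eq_dist_add_one_of_adj o hxy
    omega
  · obtain ⟨C, hC, hCA⟩ := exists_stateFun_graphBall_eq hT o hu hkM
    have h1 := hCA 1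
    rw [extendOp_one] at h1
    have h2 := hN₀ M hM u hu
    have h3 : (vbsPoly G (graphBall G o k) fun y _ => blochMatrix
        (if y = o then 0 else boundaryMessage G o u (M + 1 - G.dist o y) y)) =
        vbsPoly G (graphBall G o k) fun y _ =>
          blochMatrix (boundaryMessage G o u (M + 1 - G.dist o y) y) := by
      refine vbsPoly_congr fun x _ y hy _ => ?_
      rw [if_neg fun h : y = o => hy (h ▸ hself k)]
    rw [h3] at h2
    have h4 := h2.C_mul hC.le
    rw [IsCloseTo, MvPolynomial.C_mul', map_smul, map_smul, smul_eq_mul, smul_eq_mul] at h4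
    rwa [IsCloseTo, hCA, h1]

/-- Every limit must take the values c. A ground state exists because the zero vectors are a
consistent family, and its one-site states have no magnetization; by uniqueness this holds for every
ground state. -/
theorem hasUniqueGroundState_of_isDecoratedTree {d g : ℕ} {pos : W → W → ℕ}
    (hG : IsDecoratedTree G d g pos) (hdg : d < 3 ^ (g + 1) + 1) (o : W) :
    IsDisordered G o ∧ HasUniqueGroundState G o := by
  choose c hc using fun (Λ : Finset W) (A : LocalOp G Λ) =>
    exists_eventually_norm_expectation_sub_le hG hdg o A
  have huniq : ∀ ω : (Λ : Finset W) → LocalOp G Λ → ℂ, IsInfiniteVolumeGroundState G o ω → ω = c := by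
    rintro ω ⟨ρ, hρ, hω⟩
    funext Λ A
    rw [← sub_eq_zero, ← norm_le_zero_iff]
    refine le_of_forall_pos_le_add fun ε hε => ?_
    rw [zero_add]
    refine le_of_tendsto ((hω Λ A).sub_const (c Λ A)).norm ?_
    filter_upwards [hc Λ A ε hε] with N hN
    exact hN (ρ N) (hρ N)
  obtain ⟨ω₀, hω₀, hω₀A⟩ := exists_infiniteVolumeGroundState hG.isTree o (b := fun _ _ => 0)
    (fun _ _ => by simp) (by simpa only [zero_smul] using isConsistent_zero (G := G))
  refine ⟨fun ω hω x α => ?_, ω₀, hω₀, fun ω hω => (huniq ω hω).trans (huniq ω₀ hω₀).symm⟩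
  rw [(huniq ω hω).trans (huniq ω₀ hω₀).symm, hω₀A]
  simp only [zero_smul, blochMatrix_zero]
  rw [stateFun_spinAt_vbsPoly_one, zero_div]

end Uniqueness

theorem mainTheorem9 {V : Type*} (T : SimpleGraph V) [T.LocallyFinite] (d g : ℕ) (hd : 2 ≤ d)
    (hT : T.IsTree) (hreg : T.IsRegularOfDegree d) (o : V ⊕ T.edgeSet × Fin g) :
    (∀ x : EuclideanSpace ℝ (Fin 3), ‖x‖ ≤ 1 →
      cellTransferFunction d g x = ((3 : ℝ) ^ g)⁻¹ * transferF d ‖x‖) ∧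
    (3 ^ (g + 1) + 1 < d →
      IsOrdered (decorate T g) o ∧ ¬ HasUniqueGroundState (decorate T g) o) ∧
    (d < 3 ^ (g + 1) + 1 →
      IsDisordered (decorate T g) o ∧ HasUniqueGroundState (decorate T g) o) :=
  ⟨fun x _ => cellTransferFunction_eq g hd x,
    fun h => isOrdered_of_isDecoratedTree (isDecoratedTree_decorate g hd hT hreg) h o,
    fun h => hasUniqueGroundState_of_isDecoratedTree (isDecoratedTree_decorate g hd hT hreg) h o⟩
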